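/- A link diagram $D$ consists of finitely many piecewise smooth (regularly parametrized) closed curves $\gamma_1,\dots,\gamma_\mu$ in the plane $\mathbb R^2$, whose only (self-)intersections are finitely many transverse double points, the crossings, together with a choice, at each crossing, of the overpassing and the underpassing strand. The diagram may be split, i.e. $\bigcup_i\gamma_i$ need not be connected. The arcs of $D$ are the pieces into which the curves are cut when they are interrupted at each underpass; the faces of $D$ are the path components of $\mathbb R^2\setminus\bigcup_i\gamma_i$. A checkerboard shading $s$ of $D$ declares each face shaded or unshaded, so that of any two faces whose boundaries share a segment of positive length exactly one is shaded. For an abelian group $A$, the group $\mathcal F_A(D)$ of Fox colorings consists of the maps $f$ from the set of arcs to $A$ (under pointwise addition) such that $f(a_1)+f(a_2)=2f(a_3)$ at each crossing, where $a_1,a_2$ are the underpassing arcs and $a_3$ is the overpassing arc. Let $F_1,\dots,F_n$ be the unshaded faces. The Goeritz index $\eta(c)\in\{1,-1\}$ of a crossing $c$ is $1$ if the overpassing arc is on the right-hand side of the unshaded faces at $c$ (looking from these faces to $c$), and $-1$ if it is on their left-hand side. The unreduced Goeritz matrix $G(D,s)\in\mathbb Z^{n\times n}$ has the entries $G(D,s)_{ij}=-\sum_c\eta(c)$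 for $i\ne j$, the sum being over the crossings $c$ incident on both $F_i$ and $F_j$, and $G(D,s)_{ii}=-\sum_{k\ne i}G(D,s)_{ik}$. Let $\ker_A G(D,s)=\{v\in A^n\mid G(D,s)\cdot v=0\}$. The shaded checkerboard graph has a vertex for each shaded face and, for each crossing, an edge joining the shaded face(s) incident on it; $\beta_s(D)$ is the number of its connected components. **Theorem.** Let $D$ be a link diagram with at least one curve ($\mu\ge 1$), $s$ either of its checkerboard shadings, and $A$ an abelian group. Then $\beta_s(D)\ge 1$, and $$\mathcal F_A(D)\;\cong\;\ker_A G(D,s)\oplus A^{\beta_s(D)-1},$$ where $A^0=\{0\}$. -/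

import Mathlib

open Topology Filter Set
open scoped ContDiff

noncomputable section

/-- The parameter space of a family of `m` closed curves: a disjoint union of `m` circles `ℝ / ℤ`. -/
abbrev LoopParam (m : ℕ) : Type := Fin m × UnitAddCircle

/-- The point reached from the parameter `x` after moving by `h` along its circle. -/
def LoopParam.shift {m : ℕ} (x : LoopParam m) (h : ℝ) : LoopParam m :=
  (x.1, x.2 + (h : UnitAddCircle))

/-- A family of closed curves in the plane is piecewise smooth (with regular pieces): every
parameter has a neighbourhood which it cuts into two closed intervals, on each of which the curve is
smooth up to the end points, with nowhere vanishing (one-sided) derivative. As circles are compact,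
this says that each circle is cut by finitely many points into smooth regular pieces. -/
def IsPiecewiseSmooth {m : ℕ} (γ : LoopParam m → ℂ) : Prop :=
  ∀ x : LoopParam m, ∃ ε : ℝ, 0 < ε ∧ ∀ I : Set ℝ, (I = Icc 0 ε ∨ I = Icc (-ε) 0) →
    ContDiffOn ℝ ∞ (fun h => γ (x.shift h)) I ∧
      ∀ h ∈ I, derivWithin (fun h => γ (x.shift h)) I h ≠ 0

/-- The determinant of two vectors of the oriented plane `ℂ = ℝ²`. -/
def planeDet (z w : ℂ) : ℝ := z.re * w.im - z.im * w.re

/-- A tame classical link diagram: finitely many piecewise smooth closed curves in the plane whose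
only (self-)intersections are finitely many transverse double points, the crossings, together with
the choice, at each crossing, of the overpassing and the underpassing strand. The strands are given
by their parameters. -/
structure LinkDiagram where
  /-- the number of closed curves -/
  numComponents : ℕ
  /-- the number of crossings -/
  numCrossings : ℕ
  /-- the closed curves -/
  curve : LoopParam numComponents → ℂ
  /-- the parameter at which the overpassing strand goes through a crossing -/
  overParam : Fin numCrossings → LoopParam numComponents
  /-- the parameter at which the underpassing strand goes through a crossing -/
  underParam : Fin numCrossings → LoopParam numComponents
  piecewiseSmooth : IsPiecewiseSmooth curve
  /-- each crossing is met by exactly two strands, and different crossings are different points -/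
  passages_injective : Function.Injective (Sum.elim overParam underParam)
  /-- the crossings are exactly the (self-)intersections of the curves -/
  curve_eq_iff : ∀ x y, curve x = curve y ↔
    x = y ∨ ∃ c, (x = overParam c ∧ y = underParam c) ∨ (x = underParam c ∧ y = overParam c)
  smooth_over : ∀ c, ContDiffAt ℝ ∞ (fun h : ℝ => curve ((overParam c).shift h)) 0
  smooth_under : ∀ c, ContDiffAt ℝ ∞ (fun h : ℝ => curve ((underParam c).shift h)) 0
  transverse : ∀ c, planeDet (deriv (fun h : ℝ => curve ((overParam c).shift h)) 0)
    (deriv (fun h : ℝ => curve ((underParam c).shift h)) 0) ≠ 0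

namespace LinkDiagram

variable (D : LinkDiagram)

/-! ### Arcs and Fox colorings -/

/-- The parameters at which the curve does not pass under a strand. -/
abbrev VisibleParam : Type := {x : LoopParam D.numComponents // x ∉ range D.underParam}

/-- The arcs of the diagram: the curves are cut at all underpasses, and the arcs are the path
components of what remains. (They are formed on the parametrizing circles, so an arc that passes
over other arcs is not joined to them.) -/
abbrev Arc : Type := ZerothHomotopy D.VisibleParam

theorem overParam_notMem_range (c : Fin D.numCrossings) : D.overParam c ∉ range D.underParam := by
  rintro ⟨c', h⟩
  have h' : Sum.elim D.overParam D.underParam (Sum.inr c') = Sum.elim D.overParam D.underParam (Sum.inl c) := h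
  exact absurd (D.passages_injective h') (by simp)

/-- The overpassing arc at a crossing. -/
def overArc (c : Fin D.numCrossings) : D.Arc :=
  Quotient.mk _ (⟨D.overParam c, D.overParam_notMem_range c⟩ : D.VisibleParam)

/-- `a` is the underpassing arc that leaves the crossing `c` in the direction of increasing
parameter (for `e = 1`) or of decreasing parameter (for `e = -1`). -/
def IsUnderArc (c : Fin D.numCrossings) (e : ℝ) (a : D.Arc) : Prop :=
  ∀ᶠ ε : ℝ in 𝓝[>] 0, ∃ x : D.VisibleParam, (x : LoopParam D.numComponents) =
    (D.underParam c).shift (e * ε) ∧ (Quotient.mk _ x : D.Arc) = a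

/-- The group of Fox colorings of `D` with values in `A`. -/
def foxColorings (A : Type*) [AddCommGroup A] : AddSubgroup (D.Arc → A) where
  carrier := {f | ∀ (c : Fin D.numCrossings) (a₁ a₂ : D.Arc),
    D.IsUnderArc c (-1) a₁ → D.IsUnderArc c 1 a₂ → f a₁ + f a₂ = 2 • f (D.overArc c)}
  zero_mem' := by
    intro c a₁ a₂ _ _
    simp
  add_mem' := by
    intro f g hf hg c a₁ a₂ h₁ h₂
    have h3 := hf c a₁ a₂ h₁ h₂
    have h4 := hg c a₁ a₂ h₁ h₂
    simp only [Pi.add_apply, smul_add, ← h3, ← h4]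
    abel
  neg_mem' := by
    intro f hf c a₁ a₂ h₁ h₂
    have h3 := hf c a₁ a₂ h₁ h₂
    simp only [Pi.neg_apply, smul_neg, ← h3]
    abel

/-! ### Faces and checkerboard shadings -/

/-- The union of the curves. -/
def trace : Set ℂ := range D.curve

/-- The faces: the path components of the complement of the curves. -/
abbrev Face : Type := ZerothHomotopy (D.traceᶜ : Set ℂ)

/-- A face as a subset of the plane. -/
def region (F : D.Face) : Set ℂ :=
  {p | ∃ h : p ∈ D.traceᶜ, (Quotient.mk _ (⟨p, h⟩ : (D.traceᶜ : Set ℂ)) : D.Face) = F}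

/-- The boundaries of two faces share a segment (of one of the curves) of positive length. -/
def ShareSegment (F F' : D.Face) : Prop :=
  ∃ (x : LoopParam D.numComponents) (ε : ℝ), 0 < ε ∧ ∀ h ∈ Icc 0 ε,
    D.curve (x.shift h) ∈ frontier (D.region F) ∩ frontier (D.region F')

/-- A checkerboard shading of the faces: whenever the boundaries of two faces share a segment of
positive length, exactly one of these faces is shaded. -/
structure Shading where
  /-- the shaded faces -/
  shaded : Set D.Face
  shaded_iff_of_shareSegment : ∀ F F' : D.Face, F ≠ F' → D.ShareSegment F F' →
    (F ∈ shaded ↔ F' ∉ shaded)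

/-- The crossing `c`, as a point of the plane. -/
def crossingPoint (c : Fin D.numCrossings) : ℂ := D.curve (D.overParam c)

/-- The crossing `c` is incident on the face `F`. -/
def Incident (c : Fin D.numCrossings) (F : D.Face) : Prop :=
  D.crossingPoint c ∈ closure (D.region F)

/-- The tangent vector of the overpassing strand at a crossing. -/
def overTangent (c : Fin D.numCrossings) : ℂ :=
  deriv (fun h : ℝ => D.curve ((D.overParam c).shift h)) 0

/-- The tangent vector of the underpassing strand at a crossing. -/
def underTangent (c : Fin D.numCrossings) : ℂ :=
  deriv (fun h : ℝ => D.curve ((D.underParam c).shift h)) 0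

/-- Let `o` be the tangent vector of the overpassing strand, and `u` the one of the underpassing
strand, oriented so that `(o, u)` is a positive basis. Then `o - u` points from the crossing into a
sector bounded by the half strands in the directions `o` and `-u`. Looking from this sector to the
crossing, one sees the overpassing strand on the right-hand side. The same holds for the opposite
sector, and in the two other sectors the overpassing strand is on the left-hand side. -/
def rightDirection (c : Fin D.numCrossings) : ℂ :=
  D.overTangent c -
    Real.sign (planeDet (D.overTangent c) (D.underTangent c)) • D.underTangent c

/-- Near the crossing `c`, the overpassing arc is on the right-hand side of the face `F`. -/
def OverOnRight (c : Fin D.numCrossings) (F : D.Face) : Prop :=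
  ∀ᶠ ε : ℝ in 𝓝[>] 0, D.crossingPoint c + ε • D.rightDirection c ∈ D.region F

namespace Shading

variable {D} (s : D.Shading)

/-- The unshaded faces. -/
abbrev Unshaded : Type := {F : D.Face // F ∉ s.shaded}

open Classical in
/-- The Goeritz index of a crossing: `1` if the overpassing arc is on the right-hand side of the
unshaded faces at the crossing, `-1` if it is on their left-hand side. -/
def goeritzIndex (c : Fin D.numCrossings) : ℤ :=
  if ∃ F : s.Unshaded, D.OverOnRight c F then 1 else -1

open Classical in
/-- The off-diagonal entry of the Goeritz matrix for two different unshaded faces: minus the sum of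
the Goeritz indices of the crossings incident on both. -/
def goeritzEntry (i j : s.Unshaded) : ℤ :=
  -∑ c : Fin D.numCrossings with (D.Incident c i ∧ D.Incident c j), s.goeritzIndex c

open Classical in
/-- The unreduced Goeritz matrix; its rows sum to `0`. -/
def goeritzMatrix : Matrix s.Unshaded s.Unshaded ℤ :=
  fun i j => if i = j then -∑ᶠ (k : s.Unshaded) (_ : k ≠ i), s.goeritzEntry i k
    else s.goeritzEntry i j

/-- The subgroup `{v | G v = 0}` of the direct sum of copies of `A`, one for each unshaded face,
where `G` is the unreduced Goeritz matrix. -/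
def goeritzKernel (A : Type*) [AddCommGroup A] : AddSubgroup (s.Unshaded →₀ A) where
  carrier := {v | ∀ i : s.Unshaded, v.sum (fun j a => s.goeritzMatrix i j • a) = 0}
  zero_mem' := by
    intro i
    simp
  add_mem' := by
    intro v w hv hw i
    rw [Finsupp.sum_add_index' (fun j => smul_zero _) (fun j a b => smul_add _ a b), hv i, hw i,
      add_zero]
  neg_mem' := by
    intro v hv i
    have h : (-v).sum (fun j a => s.goeritzMatrix i j • a) =
        -v.sum (fun j a => s.goeritzMatrix i j • a) := by
      rw [Finsupp.sum_neg_index (fun j => smul_zero _)]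
      simp [Finsupp.sum]
    rw [h, hv i, neg_zero]

/-- The shaded checkerboard graph, without its loops and with parallel edges merged: two different
shaded faces are adjacent if some crossing is incident on both. -/
def shadedGraph : SimpleGraph s.shaded where
  Adj S S' := S ≠ S' ∧ ∃ c : Fin D.numCrossings, D.Incident c S ∧ D.Incident c S'
  symm := ⟨fun _ _ ⟨h, c, h1, h2⟩ => ⟨h.symm, c, h2, h1⟩⟩
  loopless := ⟨fun _ h => h.1 rfl⟩

/-- The number of connected components of the shaded checkerboard graph. -/
def beta : ℕ := Nat.card s.shadedGraph.ConnectedComponent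

end Shading

end LinkDiagram

end

/-! A Fox coloring is integrated to a coloring of the faces. A function on the faces lifts the arc
labels `f` if its values on the two sides of a strand always add up to the label of that arc
(`IsSection`). Around a crossing these four equations are compatible because of the Fox relation, so
lifts exist locally (`exists_local_section`), and `exists_nhds_section_unique` says that a local
lift is determined by one value. The local lifts thus form a covering of the plane with discrete
fibre `A`; as the plane is simply connected, a global lift with any prescribed value exists
(`exists_global_section`, `exists_section`). Conversely, a face function is the lift of some Fox
coloring as soon as its sums across an overpassing strand agree before and after each crossing, i.e.
if it is a Dehn coloring. Hence Fox colorings are the same as Dehn colorings vanishing on a fixed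
face (`nonempty_foxColorings_equiv`).

At a crossing, two opposite sectors are unshaded (`source`, `target`) and two are shaded (`left`,
`right`). The Dehn relation becomes `d left - d right = η • (d source - d target)`
(`mem_dehnColorings_iff`). The Goeritz matrix is a Laplacian with edge weights `η`, so its kernel
consists of those values on the unshaded faces for which the flow `η • (d source - d target)` along
the crossings is conserved at every unshaded face (`mem_goeritzKernel_iff`). By planar duality such
a flow is conserved if and only if it is the difference, across each crossing, of a potential on the
shaded faces (`sum_outflow_smul`, `exists_potential_of_outflow`). The potential is unique up to one
constant for each component of the shaded graph. Taking the face where the Dehn colorings vanish to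
be shaded absorbs one of these constants, which leaves `β - 1` copies of `A`.

Since the diagram may be split, faces need not be discs, and the duality is proved analytically.
Differences are conserved because the corners of the faces can be summed by running once around
every curve (`sum_corners_eq_zero`); winding numbers tell the left side of a segment from the right
one. A potential for a conserved flow is built from logarithms (`exists_potential`): outside the
unshaded faces, each crossing has a logarithm of `(z - p) / (z - q)`, with `p`, `q` in its two
unshaded faces, that jumps by a full turn at that crossing only. Comparison with principal
logarithms yields integers, and conservation cancels the part of their variation that comes from the
branch cuts. -/

noncomputable section

/-! ### Gluing over the simply connected plane -/

/-- Local sections of a locally constant sheaf on the plane, given off a closed set with dense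
complement `T`, can be glued to a global section with a prescribed value. -/
theorem exists_global_section {X : Type*} {T : Set ℂ} (hT : Dense T) (U : ℂ → Set ℂ)
    (hU : ∀ p, IsOpen (U p)) (hpU : ∀ p, p ∈ U p) (σ : ℂ → X → ℂ → X)
    (hbij : ∀ p, ∀ z ∈ U p, z ∈ T → Function.Bijective (fun x => σ p x z))
    (H : ∀ p q, ∀ z ∈ U p ∩ U q, ∃ N ∈ 𝓝 z, ∀ x, ∃ y, ∀ z' ∈ N, z' ∈ T → σ p x z' = σ q y z')
    (z₀ : ℂ) (hz₀ : z₀ ∈ T) (x₀ : X) :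
    ∃ d : ℂ → X, d z₀ = x₀ ∧ ∀ p, ∃ x, ∃ N ∈ 𝓝 p, ∀ z ∈ N, z ∈ T → d z = σ p x z := by
  classical
  have neBot : ∀ z, (𝓝[T] z).NeBot := fun z => mem_closure_iff_nhdsWithin_neBot.1 (hT z)
  -- Since `T` is dense, every germ is tested at some point of `T`, where the label can be read off
  -- from the value.
  have uniq : ∀ q, ∀ z ∈ U q, ∀ y y', (∀ᶠ z' in 𝓝[T] z, σ q y z' = σ q y' z') → y = y' := by
    intro q z hz y y' h
    have := neBot z
    obtain ⟨w, hw1, hw2, hw3⟩ := (h.and ((eventually_nhdsWithin_of_eventually_nhds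
      ((hU q).mem_nhds hz)).and self_mem_nhdsWithin)).exists
    exact (hbij q w hw2 hw3).1 hw1
  have ex : ∀ p q, ∀ z ∈ U p ∩ U q, ∀ x, ∃ y, ∀ᶠ z' in 𝓝[T] z, σ p x z' = σ q y z' := by
    intro p q z hz x
    obtain ⟨N, hN, h⟩ := H p q z hz
    obtain ⟨y, hy⟩ := h x
    refine ⟨y, ?_⟩
    filter_upwards [mem_nhdsWithin_of_mem_nhds hN, self_mem_nhdsWithin] with w h1 h2
    exact hy w h1 h2
  -- The transition maps from chart `p` to chart `q`; the value outside the overlap plays no role.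
  let g : ℂ → ℂ → ℂ → X → X := fun p q z x =>
    if h : z ∈ U p ∩ U q then (ex p q z h x).choose else x
  have hg : ∀ p q, ∀ z ∈ U p ∩ U q, ∀ x, ∀ᶠ z' in 𝓝[T] z, σ p x z' = σ q (g p q z x) z' := by
    intro p q z hz x
    simp only [g, dif_pos hz]
    exact (ex p q z hz x).choose_spec
  -- With a discrete fibre, continuity of the transition maps means that they are locally constant,
  -- which is what `H` provides, and the bundle is a covering.
  let τ : TopologicalSpace X := ⊥
  have hdisc : DiscreteTopology X := ⟨rfl⟩
  let Z : FiberBundleCore ℂ ℂ X :=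
    { baseSet := U
      isOpen_baseSet := hU
      indexAt := id
      mem_baseSet_at := hpU
      coordChange := g
      coordChange_self := by
        intro i z hz v
        refine (uniq i z hz _ _ ?_).symm
        exact hg i i z ⟨hz, hz⟩ v
      continuousOn_coordChange := by
        rintro i j ⟨z, v⟩ ⟨hz, -⟩
        obtain ⟨N, hN, h⟩ := H i j z hz
        obtain ⟨y, hy⟩ := h v
        have key : ∀ z' ∈ interior N ∩ (U i ∩ U j), g i j z' v = y := by
          intro z' hz'
          refine uniq j z' hz'.2.2 _ _ ?_
          filter_upwards [hg i j z' hz'.2 v, self_mem_nhdsWithin,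
            mem_nhdsWithin_of_mem_nhds (isOpen_interior.mem_nhds hz'.1)] with w h1 h2 h3
          rw [← h1, hy w (interior_subset h3) h2]
        have hev : ∀ᶠ p : ℂ × X in 𝓝 (z, v), g i j p.1 p.2 = y := by
          have h1 : (interior N ∩ (U i ∩ U j)) ×ˢ ({v} : Set X) ∈ 𝓝 (z, v) := by
            refine prod_mem_nhds (inter_mem (interior_mem_nhds.2 hN)
              (((hU i).inter (hU j)).mem_nhds hz)) ?_
            simp
          filter_upwards [h1] with p hp
          rw [show p.2 = v from hp.2]
          exact key p.1 hp.1
        exact (ContinuousAt.congr (f := fun _ => y) continuousAt_const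
          (hev.mono fun _ h => h.symm)).continuousWithinAt
      coordChange_comp := by
        rintro i j k z ⟨⟨hi, hj⟩, hk⟩ v
        refine uniq k z hk _ _ ?_
        filter_upwards [hg i j z ⟨hi, hj⟩ v, hg j k z ⟨hj, hk⟩ (g i j z v),
          hg i k z ⟨hi, hk⟩ v] with w h1 h2 h3
        rw [← h2, ← h1, h3] }
  have cov : IsCoveringMap (Bundle.TotalSpace.proj : Bundle.TotalSpace X Z.Fiber → ℂ) :=
    FiberBundle.isCoveringMap
  obtain ⟨y₀, hy₀⟩ := (hbij z₀ z₀ (hpU z₀) hz₀).2 x₀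
  -- A global section is a lift of the identity, which exists by simple connectedness.
  obtain ⟨Γ, ⟨hΓ0, hΓ⟩, -⟩ := cov.existsUnique_continuousMap_lifts (ContinuousMap.id ℂ)
    (a₀ := z₀) (e₀ := (⟨z₀, y₀⟩ : Bundle.TotalSpace X Z.Fiber)) rfl
  have hΓ1 : ∀ z, (Γ z).1 = z := fun z => congrFun hΓ z
  let v : ℂ → X := fun z => (Γ z).2
  refine ⟨fun z => σ z (v z) z, ?_, fun p => ?_⟩
  · have : v z₀ = y₀ := 
      congrArg (fun e : Bundle.TotalSpace X Z.Fiber => (e.2 : X)) hΓ0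
    simp only [this]
    exact hy₀
  -- In the chart at `p` the section is a continuous map to a discrete space, hence constant near
  -- `p`.
  · have hc : ContinuousAt (fun z => ((Z.localTriv p) (Γ z)).2) p := by
      refine continuousAt_snd.comp (ContinuousAt.comp ?_ Γ.continuous.continuousAt)
      refine (Z.localTriv p).continuousAt ?_
      rw [(Z.localTriv p).mem_source]
      exact (congrArg (· ∈ U p) (hΓ1 p)).mpr (hpU p)
    have he : ∀ z, ((Z.localTriv p) (Γ z)).2 = g z p z (v z) := by
      intro z
      have : ((Z.localTriv p) (Γ z)).2 = g (Γ z).1 p (Γ z).1 (Γ z).2 := rfl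
      rw [this, hΓ1]
    simp only [he] at hc
    refine ⟨g p p p (v p), _, inter_mem (hc.preimage_mem_nhds (t := {g p p p (v p)}) (by simp))
      ((hU p).mem_nhds (hpU p)), fun z hz hzT => ?_⟩
    have h1 : g z p z (v z) = g p p p (v p) := hz.1
    rw [← h1]
    exact (hg z p z ⟨hpU z, hz.2⟩ (v z)).self_of_nhdsWithin hzT

/-! ### Parameters, regular points and arcs -/

namespace LoopParam

variable {m : ℕ}

@[simp]
theorem shift_zero (x : LoopParam m) : x.shift 0 = x := by simp [shift]

theorem shift_shift (x : LoopParam m) (a b : ℝ) : (x.shift a).shift b = x.shift (a + b) := by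
  simp [shift, add_assoc]

theorem continuous_shift (x : LoopParam m) : Continuous x.shift :=
  continuous_const.prodMk (continuous_const.add (AddCircle.continuous_mk' 1))

theorem shift_injOn {x : LoopParam m} {a b : ℝ} (h : |a - b| < 1) (hab : x.shift a = x.shift b) :
    a = b := by
  have h1 : ((a - b : ℝ) : UnitAddCircle) = 0 := by
    have := congrArg Prod.snd hab
    simp only [shift, add_right_inj] at this
    rw [AddCircle.coe_sub, this, sub_self]
  obtain ⟨n, hn⟩ := (AddCircle.coe_eq_zero_iff (1 : ℝ)).1 h1
  have h2 : (n : ℝ) = a - b := by simpa using hn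
  rw [← h2] at h
  have h3 : |n| < 1 := by exact_mod_cast h
  rw [Int.abs_lt_one_iff] at h3
  rw [h3] at h2
  simp at h2
  linarith

theorem shift_ne {x : LoopParam m} {h : ℝ} (h0 : h ≠ 0) (h1 : |h| < 1) : x.shift h ≠ x := by
  intro h2
  exact h0 (shift_injOn (x := x) (a := h) (b := 0) (by simpa using h1) (by simpa using h2))

theorem isOpen_image_shift (x : LoopParam m) {s : Set ℝ} (hs : IsOpen s) :
    IsOpen (x.shift '' s) := by
  have h : x.shift '' s = {x.1} ×ˢ ((fun y => x.2 + y) '' ((fun t : ℝ => (t : UnitAddCircle)) '' s)) := by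
    ext ⟨i, y⟩
    simp only [shift, mem_image, Prod.mk.injEq, mem_prod, mem_singleton_iff, exists_exists_and_eq_and]
    constructor
    · rintro ⟨a, ha, h1, h2⟩; exact ⟨h1.symm, a, ha, h2⟩
    · rintro ⟨h1, a, ha, h2⟩; exact ⟨a, ha, h1.symm, h2⟩
  rw [h]
  exact (isOpen_discrete _).prod
    (isOpenMap_add_left x.2 _ (QuotientAddGroup.isOpenMap_coe s hs))

theorem image_shift_mem_nhds (x : LoopParam m) {s : Set ℝ} (hs : s ∈ 𝓝 0) :
    x.shift '' s ∈ 𝓝 x := by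
  obtain ⟨t, hts, ht, h0⟩ := mem_nhds_iff.1 hs
  exact mem_of_superset ((isOpen_image_shift x ht).mem_nhds ⟨0, h0, shift_zero x⟩)
    (image_mono hts)

end LoopParam

theorem IsPiecewiseSmooth.continuous {m : ℕ} {γ : LoopParam m → ℂ} (h : IsPiecewiseSmooth γ) :
    Continuous γ := by
  rw [continuous_iff_continuousAt]
  intro x
  obtain ⟨ε, hε, H⟩ := h x
  have hr := (H (Icc 0 ε) (Or.inl rfl)).1.continuousOn 0 ⟨le_rfl, hε.le⟩
  have hl := (H (Icc (-ε) 0) (Or.inr rfl)).1.continuousOn 0 ⟨by linarith, le_rfl⟩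
  have hc : ContinuousAt (fun h => γ (x.shift h)) 0 := by
    have h1 := hl.union hr
    rw [Icc_union_Icc_eq_Icc (by linarith) hε.le] at h1
    exact h1.continuousAt (Icc_mem_nhds (by linarith) hε)
  intro V hV
  rw [← LoopParam.shift_zero x] at hV
  have := x.image_shift_mem_nhds (hc hV)
  refine mem_map.2 (mem_of_superset this ?_)
  rintro _ ⟨t, ht, rfl⟩
  exact ht

namespace LinkDiagram

variable (D : LinkDiagram)

theorem continuous_curve : Continuous D.curve := D.piecewiseSmooth.continuous

theorem continuous_curve_shift (x : LoopParam D.numComponents) :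
    Continuous fun h => D.curve (x.shift h) :=
  D.continuous_curve.comp x.continuous_shift

theorem isCompact_trace : IsCompact D.trace := isCompact_range D.continuous_curve

theorem isClosed_trace : IsClosed D.trace := D.isCompact_trace.isClosed

theorem curve_mem_trace (x : LoopParam D.numComponents) : D.curve x ∈ D.trace := mem_range_self x

/-- The curve does not go through a crossing at the parameter `x`. -/
def Regular (x : LoopParam D.numComponents) : Prop :=
  x ∉ range D.overParam ∧ x ∉ range D.underParam

variable {D}

theorem Regular.eq_of_curve_eq {x y : LoopParam D.numComponents} (hx : D.Regular x)
    (h : D.curve y = D.curve x) : y = x := by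
  rcases (D.curve_eq_iff y x).1 h with h | ⟨c, h | h⟩
  · exact h
  · exact absurd ⟨c, h.2.symm⟩ hx.2
  · exact absurd ⟨c, h.2.symm⟩ hx.1

theorem overParam_injective : Function.Injective D.overParam :=
  D.passages_injective.comp Sum.inl_injective

theorem overParam_ne_underParam (c c' : Fin D.numCrossings) : D.overParam c ≠ D.underParam c' :=
  fun h => D.overParam_notMem_range c ⟨c', h.symm⟩

theorem curve_overParam (c : Fin D.numCrossings) : D.curve (D.overParam c) = D.crossingPoint c := rfl

theorem curve_underParam (c : Fin D.numCrossings) :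
    D.curve (D.underParam c) = D.crossingPoint c :=
  (D.curve_eq_iff _ _).2 (Or.inr ⟨c, Or.inr ⟨rfl, rfl⟩⟩)

theorem curve_eq_crossingPoint {c : Fin D.numCrossings} {y : LoopParam D.numComponents}
    (h : D.curve y = D.crossingPoint c) : y = D.overParam c ∨ y = D.underParam c := by
  rcases (D.curve_eq_iff y _).1 h with h | ⟨c', h | h⟩
  · exact Or.inl h
  · exact absurd h.2 (overParam_ne_underParam c c')
  · have := overParam_injective h.2
    exact Or.inr (this ▸ h.1)

theorem crossingPoint_injective : Function.Injective D.crossingPoint := by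
  intro c c' h
  rcases curve_eq_crossingPoint (c := c') (y := D.overParam c) h with h | h
  · exact overParam_injective h
  · exact absurd h (overParam_ne_underParam c c')

/-- Points of the trace near `p` have parameters near the parameters of `p`. -/
theorem exists_nhds_params (p : ℂ) {δ : ℝ} (hδ : 0 < δ) :
    ∃ W ∈ 𝓝 p, ∀ y, D.curve y ∈ W → ∃ x h, D.curve x = p ∧ |h| < δ ∧ y = x.shift h := by
  let V : Set (LoopParam D.numComponents) :=
    ⋃ x ∈ {x | D.curve x = p}, x.shift '' Ioo (-δ) δ
  have hV : IsOpen V := isOpen_biUnion fun x _ => x.isOpen_image_shift isOpen_Ioo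
  -- Parameters away from the preimages of `p` form a compact set, so their image is closed and
  -- misses `p`.
  have hK : IsCompact (D.curve '' Vᶜ) := (hV.isClosed_compl.isCompact).image D.continuous_curve
  refine ⟨(D.curve '' Vᶜ)ᶜ, hK.isClosed.isOpen_compl.mem_nhds ?_, fun y hy => ?_⟩
  · rintro ⟨x, hx, rfl⟩
    exact hx (mem_biUnion (show x ∈ {x | D.curve x = D.curve x} from rfl) ⟨0, ⟨by linarith, hδ⟩, x.shift_zero⟩)
  · have : y ∈ V := by
      by_contra h
      exact hy ⟨y, h, rfl⟩
    simp only [V, mem_iUnion] at this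
    obtain ⟨x, hx, h, hh, rfl⟩ := this
    exact ⟨x, h, hx, abs_lt.2 hh, rfl⟩

theorem finite_crossingParams : (range D.overParam ∪ range D.underParam).Finite :=
  (finite_range _).union (finite_range _)

theorem exists_regular_shift (x : LoopParam D.numComponents) :
    ∃ δ, 0 < δ ∧ δ < 1 ∧ ∀ h, h ≠ 0 → |h| < δ → D.Regular (x.shift h) := by
  have hcl : IsClosed ((range D.overParam ∪ range D.underParam) \ {x}) :=
    (finite_crossingParams.sdiff).isClosed
  have : (x.shift) ⁻¹' ((range D.overParam ∪ range D.underParam) \ {x})ᶜ ∈ 𝓝 0 :=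
    (hcl.isOpen_compl.preimage x.continuous_shift).mem_nhds (by simp)
  obtain ⟨δ, hδ, H⟩ := Metric.mem_nhds_iff.1 this
  -- The bound `1 / 2` prevents a nonzero shift from being a full turn back to `x`, which need not
  -- be regular.
  refine ⟨min δ (1 / 2), by positivity, by
    exact lt_of_le_of_lt (min_le_right _ _) (by norm_num), fun h h0 hh => ?_⟩
  have h1 := H (show h ∈ Metric.ball 0 δ by simpa using lt_of_lt_of_le hh (min_le_left _ _))
  have h2 : x.shift h ≠ x := LoopParam.shift_ne h0
    (lt_of_lt_of_le hh ((min_le_right _ _).trans (by norm_num)))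
  simp only [mem_preimage, mem_compl_iff, Set.mem_sdiff, mem_singleton_iff, not_and, not_not] at h1
  exact ⟨fun h3 => h2 (h1 (Or.inl h3)), fun h3 => h2 (h1 (Or.inr h3))⟩

theorem exists_regular (hD : 0 < D.numComponents) : ∃ x, D.Regular x := by
  obtain ⟨δ, h0, h1, h⟩ := exists_regular_shift (D := D) (⟨0, hD⟩, 0)
  exact ⟨_, h (δ / 2) (by positivity) (by rw [abs_of_pos (by positivity)]; linarith)⟩

variable (D) in
/-- The arc through a visible parameter. -/
def arcOf (x : LoopParam D.numComponents) (hx : x ∉ range D.underParam) : D.Arc :=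
  Quotient.mk _ (⟨x, hx⟩ : D.VisibleParam)

theorem arcOf_shift_eq (x : LoopParam D.numComponents) {a b : ℝ}
    (H : ∀ h ∈ uIcc a b, x.shift h ∉ range D.underParam) :
    D.arcOf (x.shift a) (H a left_mem_uIcc) = D.arcOf (x.shift b) (H b right_mem_uIcc) := by
  refine Quotient.sound ?_
  have hmem : ∀ t : unitInterval, AffineMap.lineMap a b (t : ℝ) ∈ uIcc a b := by
    intro t
    rw [← segment_eq_uIcc, segment_eq_image_lineMap]
    exact ⟨t, t.2, rfl⟩
  refine ⟨⟨⟨fun t => ⟨x.shift (AffineMap.lineMap a b (t : ℝ)), H _ (hmem t)⟩, ?_⟩, ?_, ?_⟩⟩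
  · refine Continuous.subtype_mk (x.continuous_shift.comp ?_) _
    exact AffineMap.lineMap_continuous.comp continuous_subtype_val
  · simp
  · simp

theorem isUnderArc_arcOf (c : Fin D.numCrossings) {e δ t : ℝ} (ht : t ∈ Ioo 0 δ)
    (hv : ∀ t ∈ Ioo 0 δ, (D.underParam c).shift (e * t) ∉ range D.underParam) :
    D.IsUnderArc c e (D.arcOf _ (hv t ht)) := by
  filter_upwards [Ioo_mem_nhdsGT (ht.1.trans ht.2)] with r hr
  have H : ∀ s ∈ uIcc (e * r) (e * t), (D.underParam c).shift s ∉ range D.underParam := by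
    intro s hs
    rw [← image_const_mul_uIcc] at hs
    obtain ⟨s, hs, rfl⟩ := hs
    exact hv s (ordConnected_Ioo.uIcc_subset hr ht hs)
  exact ⟨⟨_, hv r hr⟩, rfl, arcOf_shift_eq (D.underParam c) H⟩

theorem exists_underParam_shift_notMem (c : Fin D.numCrossings) {e : ℝ} (he : e = 1 ∨ e = -1) :
    ∃ δ > 0, ∀ t ∈ Ioo 0 δ, D.Regular ((D.underParam c).shift (e * t)) := by
  obtain ⟨δ, h0, -, h⟩ := exists_regular_shift (D := D) (D.underParam c)
  have hee : |e| = 1 := by rcases he with rfl | rfl <;> simp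
  refine ⟨δ, h0, fun t ht => h (e * t) ?_ ?_⟩
  · rcases he with rfl | rfl <;> simp [ht.1.ne']
  · rw [abs_mul, hee, one_mul, abs_of_pos ht.1]; exact ht.2

theorem exists_isUnderArc (c : Fin D.numCrossings) {e : ℝ} (he : e = 1 ∨ e = -1) :
    ∃ a, D.IsUnderArc c e a := by
  obtain ⟨δ, h0, h⟩ := exists_underParam_shift_notMem c he
  exact ⟨_, isUnderArc_arcOf c (t := δ / 2) ⟨by positivity, by linarith⟩ fun t ht => (h t ht).2⟩

theorem IsUnderArc.unique {c : Fin D.numCrossings} {e : ℝ} {a a' : D.Arc}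
    (h : D.IsUnderArc c e a) (h' : D.IsUnderArc c e a') : a = a' := by
  obtain ⟨ε, ⟨x, hx, rfl⟩, ⟨y, hy, rfl⟩⟩ := (h.and h').exists
  rw [Subtype.ext (hx.trans hy.symm)]

end LinkDiagram

/-! ### The two sides of a curve at a regular point -/

/-- The region between the graphs of two continuous functions on an interval is connected. -/
theorem isPreconnected_between {R : ℝ} {f g : ℝ → ℝ} (hf : ContinuousOn f (Ioo 0 R))
    (hg : ContinuousOn g (Ioo 0 R)) (hfg : ∀ r ∈ Ioo 0 R, f r < g r) :
    IsPreconnected {q : ℝ × ℝ | q.1 ∈ Ioo 0 R ∧ q.2 ∈ Ioo (f q.1) (g q.1)} := by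
  have h1 : IsPreconnected (Ioo 0 R ×ˢ Ioo (0 : ℝ) 1) :=
    isPreconnected_Ioo.prod isPreconnected_Ioo
  have h2 : ContinuousOn (fun q : ℝ × ℝ => (q.1, f q.1 + q.2 * (g q.1 - f q.1)))
      (Ioo 0 R ×ˢ Ioo (0 : ℝ) 1) := by
    have hm : MapsTo Prod.fst (Ioo 0 R ×ˢ Ioo (0 : ℝ) 1) (Ioo 0 R) := fun q hq => hq.1
    have hf' := hf.comp continuousOn_fst hm
    have hg' := hg.comp continuousOn_fst hm
    exact continuousOn_fst.prodMk (hf'.add (continuousOn_snd.mul (hg'.sub hf')))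
  convert h1.image _ h2 using 1
  ext ⟨r, φ⟩
  simp only [mem_ofPred_eq, mem_image, Prod.exists, Prod.mk.injEq, mem_prod]
  constructor
  · rintro ⟨hr, h3, h4⟩
    have hd : 0 < g r - f r := by linarith [hfg r hr]
    refine ⟨r, (φ - f r) / (g r - f r), ⟨hr, div_pos (by linarith) hd, ?_⟩, rfl, ?_⟩
    · rw [div_lt_one hd]; linarith
    · field_simp; ring
  · rintro ⟨r', s, ⟨hr, h3, h4⟩, rfl, rfl⟩
    have hd : 0 < g r' - f r' := by linarith [hfg r' hr]
    refine ⟨hr, ?_, ?_⟩ <;> nlinarith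

/-- Two disjoint curves from the centre of a disc to its boundary that meet each concentric circle
once cut the disc into two regions. -/
theorem exists_two_sectors {p : ℂ} {R : ℝ} (hR : 0 < R) {b₀ b₁ : ℝ → ℂ} (h₀ : Continuous b₀)
    (h₁ : Continuous b₁) (n₀ : ∀ r ∈ Ico 0 R, ‖b₀ r - p‖ = r) (n₁ : ∀ r ∈ Ico 0 R, ‖b₁ r - p‖ = r)
    (hne : ∀ r ∈ Ioo 0 R, b₀ r ≠ b₁ r) :
    ∃ S₀ S₁ : Set ℂ, IsOpen S₀ ∧ IsOpen S₁ ∧ IsPreconnected S₀ ∧ IsPreconnected S₁ ∧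
      Disjoint S₀ S₁ ∧
      (∀ z, z ∈ S₀ ∪ S₁ ↔ z ∈ Metric.ball p R ∧ z ≠ p ∧ z ≠ b₀ ‖z - p‖ ∧ z ≠ b₁ ‖z - p‖) ∧
      ∀ z ∈ Metric.ball p R, (z = p ∨ z = b₀ ‖z - p‖ ∨ z = b₁ ‖z - p‖) →
        z ∈ closure S₀ ∩ closure S₁ := by
  -- Polar coordinates straightened along `b₀`: on each circle, `w` rotates `b₀` to `-1`, on the
  -- branch cut of `arg`. Then `arg ∘ w` is an angle in `(-π, π)` off `b₀`, `θ r` is the angle of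
  -- `b₁ r`, and `P` is the inverse map. The sectors are the angles below and above `θ`.
  set w : ℂ → ℂ := fun z => -((z - p) / (b₀ ‖z - p‖ - p)) with hw
  set θ : ℝ → ℝ := fun r => (-((b₁ r - p) / (b₀ r - p))).arg with hθ
  set P : ℝ × ℝ → ℂ := fun q => p - (b₀ q.1 - p) * Complex.exp (q.2 * Complex.I) with hP
  have hPc : Continuous P := by fun_prop
  have hb0 : ∀ r ∈ Ioo 0 R, b₀ r - p ≠ 0 := by
    intro r hr h
    have := n₀ r ⟨hr.1.le, hr.2⟩
    rw [h, norm_zero] at this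
    exact hr.1.ne this
  have hPn : ∀ r ∈ Ioo 0 R, ∀ φ, ‖P (r, φ) - p‖ = r := by
    intro r hr φ
    simp only [hP, sub_sub_cancel_left, norm_neg, norm_mul, Complex.norm_exp_ofReal_mul_I, mul_one]
    exact n₀ r ⟨hr.1.le, hr.2⟩
  have hwP : ∀ r ∈ Ioo 0 R, ∀ φ : ℝ, w (P (r, φ)) = Complex.exp (φ * Complex.I) := by
    intro r hr φ
    simp only [hw]
    rw [hPn r hr]
    simp only [hP, sub_sub_cancel_left]
    field_simp [hb0 r hr]
  have hargP : ∀ r ∈ Ioo 0 R, ∀ φ ∈ Ioc (-Real.pi) Real.pi, (w (P (r, φ))).arg = φ := by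
    intro r hr φ hφ
    rw [hwP r hr, Complex.arg_exp_mul_I]
    exact (toIocMod_eq_self _).2 (by rwa [show -Real.pi + 2 * Real.pi = Real.pi by ring])
  have hwn : ∀ z ∈ Metric.ball p R, z ≠ p → ‖w z‖ = 1 ∧ ‖z - p‖ ∈ Ioo 0 R := by
    intro z hz hzp
    have hr : ‖z - p‖ ∈ Ioo 0 R := ⟨norm_pos_iff.2 (sub_ne_zero.2 hzp), by
      simpa [dist_eq_norm] using hz⟩
    refine ⟨?_, hr⟩
    simp only [hw, norm_neg, norm_div]
    rw [n₀ _ ⟨hr.1.le, hr.2⟩, div_self hr.1.ne']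
  have hPw : ∀ z ∈ Metric.ball p R, z ≠ p → P (‖z - p‖, (w z).arg) = z := by
    intro z hz hzp
    obtain ⟨h1, hr⟩ := hwn z hz hzp
    have h2 := Complex.norm_mul_exp_arg_mul_I (w z)
    rw [h1, Complex.ofReal_one, one_mul] at h2
    change p - (b₀ ‖z - p‖ - p) * Complex.exp ((w z).arg * Complex.I) = z
    have h3 := hb0 _ hr
    rw [h2]
    simp only [hw]
    field_simp
    ring
  have hPpi : ∀ r, P (r, -Real.pi) = b₀ r ∧ P (r, Real.pi) = b₀ r := by
    intro r
    constructor
    · simp [hP, Complex.exp_neg, Complex.exp_pi_mul_I]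
    · simp [hP, Complex.exp_pi_mul_I]
  have hb1 : ∀ r ∈ Ioo 0 R, P (r, θ r) = b₁ r := by
    intro r hr
    have h1 := n₁ r ⟨hr.1.le, hr.2⟩
    have h2 := hPw (b₁ r) (by simpa [dist_eq_norm, h1] using hr.2) (by
      intro h; rw [h] at h1; simp at h1; exact hr.1.ne h1)
    simp only [hw, h1] at h2
    exact h2
  have hθI : ∀ r ∈ Ioo 0 R, θ r ∈ Ioo (-Real.pi) Real.pi := by
    intro r hr
    refine ⟨Complex.neg_pi_lt_arg _, lt_of_le_of_ne (Complex.arg_le_pi _) fun h => ?_⟩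
    have := hb1 r hr
    rw [h, (hPpi r).2] at this
    exact hne r hr this
  have hslit : ∀ z ∈ Metric.ball p R, z ≠ p → (w z ∈ Complex.slitPlane ↔ z ≠ b₀ ‖z - p‖) := by
    intro z hz hzp
    obtain ⟨h1, hr⟩ := hwn z hz hzp
    rw [Complex.mem_slitPlane_iff_arg]
    constructor
    · rintro ⟨h2, -⟩ h3
      apply h2
      have : w z = -1 := by
        simp only [hw]
        nth_rewrite 1 [h3]
        rw [div_self (hb0 _ hr)]
      rw [this, Complex.arg_neg_one]
    · refine fun h => ⟨fun h2 => h ?_, fun h2 => by simp [h2] at h1⟩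
      have := hPw z hz hzp
      rw [h2, (hPpi _).2] at this
      exact this.symm
  have hθc : ContinuousOn θ (Ioo 0 R) := by
    intro r hr
    refine ContinuousAt.continuousWithinAt ?_
    have h1 : ContinuousAt (fun r => -((b₁ r - p) / (b₀ r - p))) r :=
      (((h₁.sub continuous_const).continuousAt.div (h₀.sub continuous_const).continuousAt
        (hb0 r hr))).neg
    refine ContinuousAt.comp (g := Complex.arg) (Complex.continuousAt_arg ?_) h1
    have hn := n₁ r ⟨hr.1.le, hr.2⟩
    have h2 := (hslit (b₁ r) (by simpa [dist_eq_norm, hn] using hr.2) (by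
      intro h; rw [h] at hn; simp at hn; exact hr.1.ne hn)).2 (by rw [hn]; exact (hne r hr).symm)
    simpa only [hw, hn] using h2
  have hwc : ContinuousOn w (Metric.ball p R \ {p}) := by
    intro z hz
    refine ContinuousAt.continuousWithinAt ?_
    exact ((continuous_id.sub continuous_const).continuousAt.div
      ((h₀.comp (continuous_id.sub continuous_const).norm).sub continuous_const).continuousAt
      (hb0 _ (hwn z hz.1 hz.2).2)).neg
  have hO : IsOpen (Metric.ball p R \ {p} ∩ w ⁻¹' Complex.slitPlane) :=
    hwc.isOpen_inter_preimage (Metric.isOpen_ball.sdiff isClosed_singleton)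
      Complex.isOpen_slitPlane
  set O := Metric.ball p R \ {p} ∩ w ⁻¹' Complex.slitPlane with hOdef
  have hdc : ContinuousOn (fun z => (w z).arg - θ ‖z - p‖) O := by
    intro z hz
    have hz' : z ∈ Metric.ball p R \ {p} := hz.1
    refine ContinuousAt.continuousWithinAt ?_
    refine ContinuousAt.sub ?_ ?_
    · exact ContinuousAt.comp (g := Complex.arg) (Complex.continuousAt_arg hz.2)
        (hwc.continuousAt ((Metric.isOpen_ball.sdiff isClosed_singleton).mem_nhds hz'))
    · refine ContinuousAt.comp (g := θ) (f := fun z => ‖z - p‖) ?_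
        (continuous_id.sub continuous_const).norm.continuousAt
      exact hθc.continuousAt (isOpen_Ioo.mem_nhds (hwn z hz'.1 hz'.2).2)
  have hS₀ : O ∩ (fun z => (w z).arg - θ ‖z - p‖) ⁻¹' Iio 0 =
      P '' {q : ℝ × ℝ | q.1 ∈ Ioo 0 R ∧ q.2 ∈ Ioo (-Real.pi) (θ q.1)} := by
    ext z
    constructor
    · rintro ⟨⟨⟨h1, h2⟩, h3⟩, h4⟩
      refine ⟨(‖z - p‖, (w z).arg), ⟨(hwn z h1 h2).2, Complex.neg_pi_lt_arg _, ?_⟩, hPw z h1 h2⟩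
      simpa using h4
    · rintro ⟨⟨r, φ⟩, ⟨h1, h2, h3⟩, rfl⟩
      simp only at h1 h2 h3
      have hn := hPn r h1 φ
      have hb : P (r, φ) ∈ Metric.ball p R := by simpa [dist_eq_norm, hn] using h1.2
      have hp : P (r, φ) ≠ p := by
        intro h; rw [h] at hn; simp at hn; exact h1.1.ne hn
      have ha := hargP r h1 φ ⟨h2, (h3.trans (hθI r h1).2).le⟩
      refine ⟨⟨⟨hb, hp⟩, ?_⟩, ?_⟩
      · refine (Complex.mem_slitPlane_iff_arg).2 ⟨?_, ?_⟩
        · rw [ha]; exact (h3.trans (hθI r h1).2).ne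
        · rw [hwP r h1]; exact Complex.exp_ne_zero _
      · simp only [mem_preimage, mem_Iio, ha, hn]; linarith
  have hS₁ : O ∩ (fun z => (w z).arg - θ ‖z - p‖) ⁻¹' Ioi 0 =
      P '' {q : ℝ × ℝ | q.1 ∈ Ioo 0 R ∧ q.2 ∈ Ioo (θ q.1) Real.pi} := by
    ext z
    constructor
    · rintro ⟨⟨⟨h1, h2⟩, h3⟩, h4⟩
      refine ⟨(‖z - p‖, (w z).arg), ⟨(hwn z h1 h2).2, by simpa using h4, ?_⟩, hPw z h1 h2⟩
      exact lt_of_le_of_ne (Complex.arg_le_pi _) (Complex.mem_slitPlane_iff_arg.1 h3).1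
    · rintro ⟨⟨r, φ⟩, ⟨h1, h2, h3⟩, rfl⟩
      simp only at h1 h2 h3
      have hn := hPn r h1 φ
      have hb : P (r, φ) ∈ Metric.ball p R := by simpa [dist_eq_norm, hn] using h1.2
      have hp : P (r, φ) ≠ p := by
        intro h; rw [h] at hn; simp at hn; exact h1.1.ne hn
      have ha := hargP r h1 φ ⟨(hθI r h1).1.trans h2, h3.le⟩
      refine ⟨⟨⟨hb, hp⟩, ?_⟩, ?_⟩
      · refine (Complex.mem_slitPlane_iff_arg).2 ⟨?_, ?_⟩
        · rw [ha]; exact h3.ne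
        · rw [hwP r h1]; exact Complex.exp_ne_zero _
      · simp only [mem_preimage, mem_Ioi, ha, hn]; linarith
  refine ⟨O ∩ (fun z => (w z).arg - θ ‖z - p‖) ⁻¹' Iio 0,
    O ∩ (fun z => (w z).arg - θ ‖z - p‖) ⁻¹' Ioi 0, hdc.isOpen_inter_preimage hO isOpen_Iio, hdc.isOpen_inter_preimage hO isOpen_Ioi,
    ?_, ?_, ?_, ?_, ?_⟩
  · rw [hS₀]
    exact (isPreconnected_between continuousOn_const hθc fun r hr => (hθI r hr).1).image _
      hPc.continuousOn
  · rw [hS₁]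
    exact (isPreconnected_between hθc continuousOn_const fun r hr => (hθI r hr).2).image _
      hPc.continuousOn
  · rw [disjoint_left]
    rintro z ⟨-, h1⟩ ⟨-, h2⟩
    exact lt_asymm (show _ < (0 : ℝ) from h1) h2
  · intro z
    rw [← inter_union_distrib_left, ← preimage_union, Iio_union_Ioi]
    constructor
    · rintro ⟨⟨⟨h1, h2⟩, h3⟩, h4⟩
      refine ⟨h1, h2, (hslit z h1 h2).1 h3, fun h5 => h4 ?_⟩
      have hr := (hwn z h1 h2).2
      have h6 := hargP _ hr _ ⟨(hθI _ hr).1, (hθI _ hr).2.le⟩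
      rw [hb1 _ hr, ← h5] at h6
      simp [h6]
    · rintro ⟨h1, h2, h3, h4⟩
      refine ⟨⟨⟨h1, h2⟩, (hslit z h1 h2).2 h3⟩, fun h5 => h4 ?_⟩
      have h6 : (w z).arg = θ ‖z - p‖ := sub_eq_zero.1 h5
      have h7 := hPw z h1 h2
      rw [h6, hb1 _ (hwn z h1 h2).2] at h7
      exact h7.symm
  · rw [hS₀, hS₁]
    -- Points of the branches are approached along a circle of fixed radius; the centre is then
    -- approached along `b₁`.
    have key : ∀ r ∈ Ioo 0 R, ∀ f g : ℝ → ℝ, f r < g r → ∀ φ ∈ Icc (f r) (g r),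
        P (r, φ) ∈ closure (P '' {q : ℝ × ℝ | q.1 ∈ Ioo 0 R ∧ q.2 ∈ Ioo (f q.1) (g q.1)}) := by
      intro r hr f g hfg φ hφ
      rw [← closure_Ioo hfg.ne] at hφ
      exact map_mem_closure (f := fun s => P (r, s)) (by fun_prop) hφ
        fun s hs => ⟨(r, s), ⟨hr, hs⟩, rfl⟩
    have hbc : ∀ r ∈ Ioo 0 R, b₁ r ∈
        closure (P '' {q : ℝ × ℝ | q.1 ∈ Ioo 0 R ∧ q.2 ∈ Ioo (-Real.pi) (θ q.1)}) ∩
        closure (P '' {q : ℝ × ℝ | q.1 ∈ Ioo 0 R ∧ q.2 ∈ Ioo (θ q.1) Real.pi}) := by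
      intro r hr
      rw [← hb1 r hr]
      exact ⟨key r hr (fun _ => -Real.pi) θ (hθI r hr).1 _ ⟨(hθI r hr).1.le, le_rfl⟩,
        key r hr θ (fun _ => Real.pi) (hθI r hr).2 _ ⟨le_rfl, (hθI r hr).2.le⟩⟩
    have hp : p = b₁ 0 := by
      have := n₁ 0 ⟨le_rfl, hR⟩
      rw [norm_eq_zero, sub_eq_zero] at this
      exact this.symm
    have h0 : (0 : ℝ) ∈ closure (Ioo 0 R) := by rw [closure_Ioo hR.ne]; exact ⟨le_rfl, hR.le⟩
    rintro z hz (rfl | h)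
    · rw [hp]
      constructor
      · rw [← closure_closure]
        exact map_mem_closure h₁ h0 fun r hr => (hbc r hr).1
      · rw [← closure_closure]
        exact map_mem_closure h₁ h0 fun r hr => (hbc r hr).2
    · by_cases hzp : z = p
      · subst hzp
        rw [hp]
        constructor
        · rw [← closure_closure]
          exact map_mem_closure h₁ h0 fun r hr => (hbc r hr).1
        · rw [← closure_closure]
          exact map_mem_closure h₁ h0 fun r hr => (hbc r hr).2
      have hr := (hwn z hz hzp).2
      rcases h with h | h
      · constructor
        · have := key _ hr (fun _ => -Real.pi) θ (hθI _ hr).1 _ ⟨le_rfl, (hθI _ hr).1.le⟩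
          rwa [(hPpi _).1, ← h] at this
        · have := key _ hr θ (fun _ => Real.pi) (hθI _ hr).2 _ ⟨(hθI _ hr).2.le, le_rfl⟩
          rwa [(hPpi _).2, ← h] at this
      · rw [h]; exact hbc _ hr

/-- A curve with nonzero derivative at its starting point moves away from it for a while. -/
theorem exists_strictMono_dist {α : ℝ → ℂ} {ε : ℝ} (hε : 0 < ε) (hα : ContDiffOn ℝ ∞ α (Icc 0 ε))
    (hd : derivWithin α (Icc 0 ε) 0 ≠ 0) :
    ∃ δ, 0 < δ ∧ δ ≤ ε ∧ StrictMonoOn (fun t => ‖α t - α 0‖) (Icc 0 δ) := by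
  set v := derivWithin α (Icc 0 ε) 0 with hv
  have hvpos : 0 < ‖v‖ := norm_pos_iff.2 hd
  have hc : ContinuousOn (derivWithin α (Icc 0 ε)) (Icc 0 ε) :=
    hα.continuousOn_derivWithin (uniqueDiffOn_Icc hε) (by simp)
  have h0 := hc 0 ⟨le_rfl, hε.le⟩
  rw [Metric.continuousWithinAt_iff] at h0
  obtain ⟨δ', hδ', H⟩ := h0 (‖v‖ / 4) (by positivity)
  refine ⟨min (δ' / 2) ε, by positivity, min_le_right _ _, ?_⟩
  set δ := min (δ' / 2) ε with hδ
  have hδε : δ ≤ ε := min_le_right _ _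
  -- Mean value inequality for `α t - t • v`, whose derivative stays below `‖v‖ / 4` by continuity.
  have hbound : ∀ a ∈ Icc 0 δ, ∀ b ∈ Icc 0 δ, ‖α b - α a - (b - a) • v‖ ≤ ‖v‖ / 4 * |b - a| := by
    intro a ha b hb
    have h1 : ∀ t ∈ Icc 0 δ, HasDerivWithinAt (fun t => α t - t • v)
        (derivWithin α (Icc 0 ε) t - v) (Icc 0 δ) t := by
      intro t ht
      have h2 : HasDerivWithinAt α (derivWithin α (Icc 0 ε) t) (Icc 0 δ) t :=
        ((hα.differentiableOn (by simp)) t ⟨ht.1, ht.2.trans hδε⟩).hasDerivWithinAt.mono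
          (Icc_subset_Icc_right hδε)
      have h3 : HasDerivWithinAt (fun t : ℝ => t • v) ((1 : ℝ) • v) (Icc 0 δ) t :=
        (hasDerivWithinAt_id t _).smul_const v
      rw [one_smul] at h3
      exact h2.sub h3
    have h4 := Convex.norm_image_sub_le_of_norm_hasDerivWithin_le (C := ‖v‖ / 4) h1 (fun t ht => by
      rw [← dist_eq_norm]
      refine (H ⟨ht.1, ht.2.trans hδε⟩ ?_).le
      rw [Real.dist_eq, sub_zero, abs_of_nonneg ht.1]
      have : δ ≤ δ' / 2 := min_le_left _ _
      linarith [ht.2]) (convex_Icc 0 δ) ha hb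
    rw [Real.norm_eq_abs] at h4
    have h5 : α b - α a - (b - a) • v = α b - b • v - (α a - a • v) := by rw [sub_smul]; abel
    rw [h5]
    exact h4
  intro s hs t ht hst
  have h0 : (0 : ℝ) ∈ Icc 0 δ := ⟨le_rfl, hs.1.trans hs.2⟩
  have h1 := hbound s hs t ht
  have h2 := hbound 0 h0 s hs
  have h3 := hbound 0 h0 t ht
  simp only [sub_zero] at h2 h3
  rw [abs_of_pos (by linarith)] at h1
  rw [abs_of_nonneg hs.1] at h2
  rw [abs_of_nonneg ht.1] at h3
  set e₁ := α t - α s - (t - s) • v with he₁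
  set e₂ := (α s - α 0 - s • v) + (α t - α 0 - t • v) with he₂
  have he₂' : ‖e₂‖ ≤ ‖v‖ / 4 * (s + t) := (norm_add_le _ _).trans (by linarith)
  have k1 : α t - α s = (t - s) • v + e₁ := by rw [he₁]; abel
  have k2 : (α t - α 0) + (α s - α 0) = (s + t) • v + e₂ := by rw [he₂, add_smul]; abel
  clear_value e₁ e₂
  -- This inner product is the difference of the squared distances from `α 0`. Its main term is `(t
  -- - s) * (s + t) * ‖v‖ ^ 2`, and the errors are at most `1/4 + 1/4 + 1/16` of that.
  have key : 0 < inner ℝ (α t - α s) ((α t - α 0) + (α s - α 0)) := by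
    rw [k1, k2, inner_add_left, inner_add_right, inner_add_right, real_inner_smul_left,
      real_inner_smul_right, real_inner_self_eq_norm_sq, real_inner_smul_left,
      real_inner_smul_right]
    have a1 := neg_le_of_abs_le (abs_real_inner_le_norm v e₂)
    have a2 := neg_le_of_abs_le (abs_real_inner_le_norm e₁ v)
    have a3 := neg_le_of_abs_le (abs_real_inner_le_norm e₁ e₂)
    have p1 : 0 < t - s := by linarith
    have p2 : 0 < s + t := by linarith [hs.1]
    have b1 : ‖v‖ * ‖e₂‖ ≤ ‖v‖ * (‖v‖ / 4 * (s + t)) := by gcongr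
    have b2 : ‖e₁‖ * ‖v‖ ≤ (‖v‖ / 4 * (t - s)) * ‖v‖ := by gcongr
    have b3 : ‖e₁‖ * ‖e₂‖ ≤ (‖v‖ / 4 * (t - s)) * (‖v‖ / 4 * (s + t)) := by gcongr
    have c1 : -((t - s) * (‖v‖ * (‖v‖ / 4 * (s + t)))) ≤ (t - s) * inner ℝ v e₂ := by nlinarith
    have c2 : -((s + t) * ((‖v‖ / 4 * (t - s)) * ‖v‖)) ≤ (s + t) * inner ℝ e₁ v := by nlinarith
    have hpos : 0 < (t - s) * (s + t) * ‖v‖ ^ 2 := by positivity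
    nlinarith
  have k3 : α t - α s = (α t - α 0) - (α s - α 0) := by abel
  rw [k3, inner_sub_left, inner_add_right, inner_add_right, real_inner_self_eq_norm_sq,
    real_inner_self_eq_norm_sq, real_inner_comm (α t - α 0) (α s - α 0)] at key
  have : ‖α s - α 0‖ ^ 2 < ‖α t - α 0‖ ^ 2 := by linarith
  exact lt_of_pow_lt_pow_left₀ 2 (norm_nonneg _) this

/-- A curve moving away from its starting point can be parametrized by the distance. -/
theorem exists_param_by_dist {α : ℝ → ℂ} {δ : ℝ} (hδ : 0 < δ) (hα : ContinuousOn α (Icc 0 δ))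
    (hm : StrictMonoOn (fun t => ‖α t - α 0‖) (Icc 0 δ)) :
    ∃ b : ℝ → ℂ, Continuous b ∧ (∀ r ∈ Icc 0 ‖α δ - α 0‖, ‖b r - α 0‖ = r) ∧
      (∀ t ∈ Icc 0 δ, α t = b ‖α t - α 0‖) ∧ ∀ r, ∃ t ∈ Icc 0 δ, b r = α t := by
  set ρ : ℝ → ℝ := fun t => ‖α t - α 0‖ with hρ
  have h0 : (0 : ℝ) ∈ Icc 0 δ := ⟨le_rfl, hδ.le⟩
  have h1 : δ ∈ Icc 0 δ := ⟨hδ.le, le_rfl⟩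
  have hρ0 : ρ 0 = 0 := by simp [hρ]
  have hR : 0 < ρ δ := hρ0 ▸ hm h0 h1 hδ
  have hρc : ContinuousOn ρ (Icc 0 δ) := (hα.sub continuousOn_const).norm
  have himg : ρ '' Icc 0 δ = Icc 0 (ρ δ) := by
    refine Subset.antisymm ?_ ?_
    · rintro _ ⟨t, ht, rfl⟩
      exact ⟨norm_nonneg _, hm.monotoneOn ht h1 ht.2⟩
    · have := intermediate_value_Icc hδ.le hρc
      rwa [hρ0] at this
  let e : Icc 0 δ ≃o Icc 0 (ρ δ) := (hm.orderIso ρ (Icc 0 δ)).trans (OrderIso.setCongr _ _ himg)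
  have he : ∀ t : Icc 0 δ, ((e t : Icc 0 (ρ δ)) : ℝ) = ρ t := fun t => rfl
  -- Projecting to the interval of attained distances makes the parametrization continuous on all of
  -- `ℝ`.
  let τ : ℝ → Icc 0 δ := fun r => e.symm (projIcc 0 (ρ δ) hR.le r)
  have hτ : Continuous τ := e.symm.continuous.comp continuous_projIcc
  refine ⟨fun r => α (τ r), hα.comp_continuous (continuous_subtype_val.comp hτ) fun r => (τ r).2,
    fun r hr => ?_, fun t ht => ?_, fun r => ⟨τ r, (τ r).2, rfl⟩⟩
  · change ρ (τ r) = r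
    rw [← he, OrderIso.apply_symm_apply, projIcc_of_mem _ hr]
  · have hmem : ρ t ∈ Icc 0 (ρ δ) := himg ▸ mem_image_of_mem ρ ht
    have : τ (ρ t) = ⟨t, ht⟩ := by
      simp only [τ]
      rw [projIcc_of_mem _ hmem, OrderIso.symm_apply_eq]
      exact Subtype.ext (he ⟨t, ht⟩).symm
    change α t = α (τ (ρ t))
    rw [this]

namespace LinkDiagram

variable (D : LinkDiagram)

/-- `S₀` and `S₁` are the two sides of the curve in the neighbourhood `U` of a point that is not
a crossing. -/
structure IsTwoSided (x : LoopParam D.numComponents) (U S₀ S₁ : Set ℂ) : Prop where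
  isOpen : IsOpen U
  mem : D.curve x ∈ U
  isOpen₀ : IsOpen S₀
  isOpen₁ : IsOpen S₁
  isPreconnected₀ : IsPreconnected S₀
  isPreconnected₁ : IsPreconnected S₁
  disjoint : Disjoint S₀ S₁
  union_eq : S₀ ∪ S₁ = U \ D.trace
  mem_closure₀ : ∀ z ∈ U, z ∈ D.trace → z ∈ closure S₀
  mem_closure₁ : ∀ z ∈ U, z ∈ D.trace → z ∈ closure S₁
  regular : ∀ y, D.curve y ∈ U → D.Regular y
  arcOf_eq : ∀ y, D.curve y ∈ U → ∀ hy hx, D.arcOf y hy = D.arcOf x hx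

variable {D}

/-- Each of the two halves of the curve at `x`, run outwards, is smooth up to its starting point
even if `x` is a corner, so it meets small circles once. As `x` is the only parameter of its point,
the trace in a small disc consists of these two branches, which cut the disc into two sectors. -/
theorem Regular.exists_isTwoSided {x : LoopParam D.numComponents} (hx : D.Regular x) {W : Set ℂ}
    (hW : W ∈ 𝓝 (D.curve x)) : ∃ U S₀ S₁, U ⊆ W ∧ D.IsTwoSided x U S₀ S₁ := by
  set p := D.curve x with hp
  obtain ⟨ε, hε, H⟩ := D.piecewiseSmooth x
  obtain ⟨δr, hδr, hδr1, Hreg⟩ := exists_regular_shift (D := D) x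
  have Hreg' : ∀ h, |h| < δr → D.Regular (x.shift h) := by
    intro h hh
    by_cases h0 : h = 0
    · rwa [h0, LoopParam.shift_zero]
    · exact Hreg h h0 hh
  set α₀ : ℝ → ℂ := fun h => D.curve (x.shift h) with hα₀
  set α₁ : ℝ → ℂ := fun h => D.curve (x.shift (-h)) with hα₁
  have c₀ : Continuous α₀ := D.continuous_curve_shift x
  have c₁ : Continuous α₁ := c₀.comp continuous_neg
  have e₀ : α₀ 0 = p := by simp [hα₀, hp]
  have e₁ : α₁ 0 = p := by simp [hα₁, hp]
  obtain ⟨δ₀, hδ₀, -, m₀⟩ := exists_strictMono_dist hε (H (Icc 0 ε) (Or.inl rfl)).1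
    ((H (Icc 0 ε) (Or.inl rfl)).2 0 ⟨le_rfl, hε.le⟩)
  have hneg : -Icc 0 ε = Icc (-ε) 0 := by simp
  obtain ⟨δ₁, hδ₁, -, m₁⟩ := exists_strictMono_dist (α := α₁) hε
    ((H (Icc (-ε) 0) (Or.inr rfl)).1.comp contDiff_neg.contDiffOn fun t ht =>
      ⟨neg_le_neg ht.2, neg_nonpos.2 ht.1⟩) (by
      have := (H (Icc (-ε) 0) (Or.inr rfl)).2 0 ⟨by linarith, le_rfl⟩
      rw [hα₁, derivWithin_comp_neg (f := fun h => D.curve (x.shift h)), hneg, neg_zero]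
      exact neg_ne_zero.2 this)
  -- With `δ < δr / 2` any two parameters in use are less than a full turn apart, so the two
  -- branches meet only at the centre.
  obtain ⟨δ, hδ, l₀, l₁, lr⟩ : ∃ δ, 0 < δ ∧ δ ≤ δ₀ ∧ δ ≤ δ₁ ∧ δ < δr / 2 :=
    ⟨min (min δ₀ δ₁) (δr / 4), by positivity, (min_le_left _ _).trans (min_le_left _ _),
      (min_le_left _ _).trans (min_le_right _ _), (min_le_right _ _).trans_lt (by linarith)⟩
  replace m₀ := m₀.mono (Icc_subset_Icc_right l₀)
  replace m₁ := m₁.mono (Icc_subset_Icc_right l₁)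
  obtain ⟨b₀, bc₀, bn₀, bα₀, bex₀⟩ := exists_param_by_dist hδ c₀.continuousOn m₀
  obtain ⟨b₁, bc₁, bn₁, bα₁, bex₁⟩ := exists_param_by_dist hδ c₁.continuousOn m₁
  have r₀ : 0 < ‖α₀ δ - α₀ 0‖ := by
    simpa using m₀ (a := 0) ⟨le_rfl, hδ.le⟩ ⟨hδ.le, le_rfl⟩ hδ
  have r₁ : 0 < ‖α₁ δ - α₁ 0‖ := by
    simpa using m₁ (a := 0) ⟨le_rfl, hδ.le⟩ ⟨hδ.le, le_rfl⟩ hδ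
  simp only [e₀] at bn₀ bα₀ r₀
  simp only [e₁] at bn₁ bα₁ r₁
  obtain ⟨W', hW', Hpar⟩ := exists_nhds_params (D := D) p hδ
  obtain ⟨R', hR', HR⟩ := Metric.mem_nhds_iff.1 (inter_mem hW hW')
  obtain ⟨R, hR, lR', lR₀, lR₁⟩ : ∃ R, 0 < R ∧ R ≤ R' ∧ R ≤ ‖α₀ δ - p‖ ∧ R ≤ ‖α₁ δ - p‖ :=
    ⟨min R' (min ‖α₀ δ - p‖ ‖α₁ δ - p‖), by positivity, min_le_left _ _,
      (min_le_right _ _).trans (min_le_left _ _), (min_le_right _ _).trans (min_le_right _ _)⟩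
  have hpar : ∀ y, D.curve y ∈ Metric.ball p R → ∃ h, |h| < δ ∧ y = x.shift h := by
    intro y hy
    obtain ⟨x', h, h1, h2, h3⟩ := Hpar y (HR (Metric.ball_subset_ball lR' hy)).2
    rw [hx.eq_of_curve_eq h1] at h3
    exact ⟨h, h2, h3⟩
  have hbt₀ : ∀ r, b₀ r ∈ D.trace := fun r => by
    obtain ⟨t, -, ht⟩ := bex₀ r
    rw [ht]; exact D.curve_mem_trace _
  have hbt₁ : ∀ r, b₁ r ∈ D.trace := fun r => by
    obtain ⟨t, -, ht⟩ := bex₁ r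
    rw [ht]; exact D.curve_mem_trace _
  have htr : ∀ z ∈ Metric.ball p R, (z ∈ D.trace ↔ z = p ∨ z = b₀ ‖z - p‖ ∨ z = b₁ ‖z - p‖) := by
    intro z hz
    constructor
    · rintro ⟨y, rfl⟩
      obtain ⟨h, hh, rfl⟩ := hpar y hz
      rw [abs_lt] at hh
      rcases le_total 0 h with h0 | h0
      · exact Or.inr (Or.inl (bα₀ h ⟨h0, hh.2.le⟩))
      · have := bα₁ (-h) ⟨by linarith, by linarith⟩
        simp only [hα₁, neg_neg] at this
        exact Or.inr (Or.inr this)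
    · rintro (h | h | h)
      · rw [h]; exact D.curve_mem_trace x
      · rw [h]; exact hbt₀ _
      · rw [h]; exact hbt₁ _
  obtain ⟨S₀, S₁, o₀, o₁, p₀, p₁, hdis, hun, hcl⟩ := exists_two_sectors hR bc₀ bc₁
    (fun r hr => bn₀ r ⟨hr.1, hr.2.le.trans lR₀⟩) (fun r hr => bn₁ r ⟨hr.1, hr.2.le.trans lR₁⟩) (by
      intro r hr heq
      obtain ⟨t, ht, h1⟩ := bex₀ r
      obtain ⟨t', ht', h2⟩ := bex₁ r
      have h3 : D.curve (x.shift t) = D.curve (x.shift (-t')) := by rw [← heq, h1] at h2; exact h2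
      have h4 := (Hreg' (-t') (by rw [abs_neg, abs_of_nonneg ht'.1]; linarith [ht'.2])).eq_of_curve_eq
        h3
      have h5 : t = -t' := LoopParam.shift_injOn (by
        rw [abs_lt]; constructor <;> linarith [ht.1, ht.2, ht'.1, ht'.2]) h4
      have h6 : t = 0 := le_antisymm (by linarith [ht'.1]) ht.1
      have h7 := bn₀ r ⟨hr.1.le, hr.2.le.trans lR₀⟩
      rw [h1, h6, e₀, sub_self, norm_zero] at h7
      exact hr.1.ne h7)
  refine ⟨Metric.ball p R, S₀, S₁, fun z hz => (HR (Metric.ball_subset_ball lR' hz)).1,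
    Metric.isOpen_ball, Metric.mem_ball_self hR, o₀, o₁, p₀, p₁, hdis, ?_,
    fun z hz ht => (hcl z hz ((htr z hz).1 ht)).1, fun z hz ht => (hcl z hz ((htr z hz).1 ht)).2,
    ?_, ?_⟩
  · ext z
    rw [hun]
    constructor
    · rintro ⟨h1, h2⟩
      exact ⟨h1, fun h3 => by simpa [h2] using (htr z h1).1 h3⟩
    · rintro ⟨h1, h2⟩
      rw [htr z h1] at h2
      push Not at h2
      exact ⟨h1, h2⟩
  · intro y hy
    obtain ⟨h, hh, rfl⟩ := hpar y hy
    exact Hreg' h (by linarith)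
  · intro y hy hyv hxv
    obtain ⟨h, hh, rfl⟩ := hpar y hy
    have H : ∀ s ∈ uIcc h 0, x.shift s ∉ range D.underParam := by
      intro s hs
      refine (Hreg' s ?_).2
      have : |s| ≤ |h| := by simpa using abs_sub_right_of_mem_uIcc hs
      linarith
    have := arcOf_shift_eq x H
    simpa only [LoopParam.shift_zero] using this

end LinkDiagram

/-! ### The four sectors at a crossing -/

theorem linearIndependent_of_planeDet {a b : ℂ} (h : planeDet a b ≠ 0) {x y : ℝ}
    (hxy : x • a + y • b = 0) : x = 0 ∧ y = 0 := by
  have h1 := congrArg Complex.re hxy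
  have h2 := congrArg Complex.im hxy
  simp only [Complex.add_re, Complex.add_im, Complex.smul_re, Complex.smul_im, smul_eq_mul,
    Complex.zero_re, Complex.zero_im] at h1 h2
  unfold planeDet at h
  constructor
  · have : x * (a.re * b.im - a.im * b.re) = 0 := by linear_combination b.im * h1 - b.re * h2
    exact (mul_eq_zero.1 this).resolve_right h
  · have : y * (a.re * b.im - a.im * b.re) = 0 := by linear_combination a.re * h2 - a.im * h1
    exact (mul_eq_zero.1 this).resolve_right h

/-- Two transverse curves through a point are the axes of a local coordinate system. -/
theorem exists_crossing_chart {α β : ℝ → ℂ} {p a b : ℂ} (hα0 : α 0 = p) (hβ0 : β 0 = p)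
    (hα : HasStrictDerivAt α a 0) (hβ : HasStrictDerivAt β b 0) (hab : planeDet a b ≠ 0) :
    ∃ E : OpenPartialHomeomorph (ℝ × ℝ) ℂ, (∀ q, E q = α q.1 + β q.2 - p) ∧ (0, 0) ∈ E.source ∧
      ∀ x y : ℝ, HasDerivAt (fun ε : ℝ => E.symm (p + ε • (x • a + y • b))) (x, y) 0 := by
  let L : (ℝ × ℝ) →L[ℝ] ℂ :=
    (ContinuousLinearMap.fst ℝ ℝ ℝ).smulRight a + (ContinuousLinearMap.snd ℝ ℝ ℝ).smulRight b
  have hL : ∀ q, L q = q.1 • a + q.2 • b := fun q => rfl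
  have hinj : Function.Injective L.toLinearMap := by
    rw [← LinearMap.ker_eq_bot, LinearMap.ker_eq_bot']
    rintro ⟨x, y⟩ h
    obtain ⟨rfl, rfl⟩ := linearIndependent_of_planeDet hab (x := x) (y := y) h
    rfl
  let e : (ℝ × ℝ) ≃L[ℝ] ℂ :=
    (LinearMap.linearEquivOfInjective L.toLinearMap hinj
      (by rw [Module.finrank_prod]; simp [Complex.finrank_real_complex])).toContinuousLinearEquiv
  have he : ∀ q, e q = q.1 • a + q.2 • b := fun q => rfl
  -- The inverse function theorem applies because transversality makes the derivative invertible.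
  -- The derivative of the inverse later identifies the quadrant into which a given direction
  -- points.
  have hΦ : HasStrictFDerivAt (fun q : ℝ × ℝ => α q.1 + β q.2 - p) (e : (ℝ × ℝ) →L[ℝ] ℂ) (0, 0) := by
    have h1 : HasStrictFDerivAt (fun q : ℝ × ℝ => α q.1)
        ((ContinuousLinearMap.toSpanSingleton ℝ a).comp (ContinuousLinearMap.fst ℝ ℝ ℝ)) (0, 0) :=
      HasStrictFDerivAt.comp (g := α) (f := Prod.fst) (0, 0) hα.hasStrictFDerivAt
        hasStrictFDerivAt_fst
    have h2 : HasStrictFDerivAt (fun q : ℝ × ℝ => β q.2)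
        ((ContinuousLinearMap.toSpanSingleton ℝ b).comp (ContinuousLinearMap.snd ℝ ℝ ℝ)) (0, 0) :=
      HasStrictFDerivAt.comp (g := β) (f := Prod.snd) (0, 0) hβ.hasStrictFDerivAt
        hasStrictFDerivAt_snd
    have h3 : (e : (ℝ × ℝ) →L[ℝ] ℂ) =
        (ContinuousLinearMap.toSpanSingleton ℝ a).comp (ContinuousLinearMap.fst ℝ ℝ ℝ) +
        (ContinuousLinearMap.toSpanSingleton ℝ b).comp (ContinuousLinearMap.snd ℝ ℝ ℝ) :=
      ContinuousLinearMap.ext fun q => he q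
    rw [h3]
    exact (h1.add h2).sub_const p
  refine ⟨hΦ.toOpenPartialHomeomorph _, fun q => by simp, hΦ.mem_toOpenPartialHomeomorph_source,
    fun x y => ?_⟩
  have h1 := hΦ.to_localInverse.hasFDerivAt
  simp only [hα0, hβ0, add_sub_cancel_right] at h1
  have h2 : HasDerivAt (fun ε : ℝ => p + ε • (x • a + y • b)) (x • a + y • b) 0 := by
    have := ((hasDerivAt_id (0 : ℝ)).smul_const (x • a + y • b)).const_add p
    rwa [one_smul] at this
  have h3 := HasFDerivAt.comp_hasDerivAt (f := fun ε : ℝ => p + ε • (x • a + y • b)) (0 : ℝ)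
    (by simpa using h1) h2
  have h4 : e.symm (x • a + y • b) = (x, y) := e.symm_apply_eq.2 (he (x, y)).symm
  rw [← h4]
  exact h3

theorem HasDerivAt.eventually_pos {g : ℝ → ℝ} {v : ℝ} (hg : HasDerivAt g v 0) (h0 : g 0 = 0)
    (hv : 0 < v) : ∀ᶠ ε in 𝓝[>] 0, 0 < g ε := by
  have h1 := (hasDerivAt_iff_tendsto_slope_zero.1 hg).eventually (lt_mem_nhds hv)
  have h2 := h1.filter_mono (nhdsWithin_mono 0 fun x (hx : 0 < x) => hx.ne')
  filter_upwards [h2, self_mem_nhdsWithin] with ε h3 h4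
  simp only [zero_add, h0, sub_zero, smul_eq_mul] at h3
  exact (pos_iff_pos_of_mul_pos h3).1 (inv_pos.2 h4)

namespace LinkDiagram

variable (D : LinkDiagram)

/-- The sign of the basis formed by the tangent vectors at a crossing. -/
def crossingSign (c : Fin D.numCrossings) : ℝ :=
  Real.sign (planeDet (D.overTangent c) (D.underTangent c))

theorem crossingSign_eq (c : Fin D.numCrossings) :
    D.crossingSign c = 1 ∨ D.crossingSign c = -1 := by
  rcases Real.sign_apply_eq_of_ne_zero _ (D.transverse c) with h | h
  · exact Or.inr h
  · exact Or.inl h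

theorem neg_crossingSign_eq (c : Fin D.numCrossings) :
    -D.crossingSign c = 1 ∨ -D.crossingSign c = -1 := by
  rcases D.crossingSign_eq c with h | h <;> simp [h]

/-- The tangent vector of the underpassing strand, oriented so that it forms a positive basis with
the one of the overpassing strand. -/
def posUnderTangent (c : Fin D.numCrossings) : ℂ := D.crossingSign c • D.underTangent c

theorem planeDet_pos (c : Fin D.numCrossings) :
    0 < planeDet (D.overTangent c) (D.posUnderTangent c) := by
  have h : planeDet (D.overTangent c) (D.posUnderTangent c) =
      D.crossingSign c * planeDet (D.overTangent c) (D.underTangent c) := by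
    simp [planeDet, posUnderTangent]; ring
  rw [h]
  exact Real.sign_mul_pos_of_ne_zero _ (D.transverse c)

/-- The arcs at a crossing in counterclockwise order. The underpassing arcs have the indices `0`
and `2`. -/
def crossingArc (c : Fin D.numCrossings) : Fin 4 → D.Arc :=
  ![(exists_isUnderArc c (D.crossingSign_eq c)).choose, D.overArc c,
    (exists_isUnderArc c (D.neg_crossingSign_eq c)).choose, D.overArc c]

/-- Vectors pointing from a crossing into the sectors cut out by the two strands, in
counterclockwise order. -/
def sectorDir (c : Fin D.numCrossings) : Fin 4 → ℂ :=
  ![D.overTangent c + D.posUnderTangent c, D.posUnderTangent c - D.overTangent c,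
    -(D.overTangent c + D.posUnderTangent c), D.overTangent c - D.posUnderTangent c]

/-- The point on the `i`-th half strand at a crossing, at distance `t` in the parameter space. -/
def branchParam (c : Fin D.numCrossings) (i : Fin 4) (t : ℝ) : LoopParam D.numComponents :=
  (![D.underParam c, D.overParam c, D.underParam c, D.overParam c] i).shift
    (![D.crossingSign c, -1, -D.crossingSign c, 1] i * t)

/-- The point with parameter `y` is on the `i`-th half strand, between the sectors `S i` and
`S (i + 1)`. -/
structure IsBranch (c : Fin D.numCrossings) (S : Fin 4 → Set ℂ) (i : Fin 4)
    (y : LoopParam D.numComponents) : Prop where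
  regular : D.Regular y
  arcOf_eq : ∀ h, D.arcOf y h = D.crossingArc c i
  mem_closure : D.curve y ∈ closure (S i)
  mem_closure_succ : D.curve y ∈ closure (S (i + 1))
  eq_of_mem_closure : ∀ j, D.curve y ∈ closure (S j) → j = i ∨ j = i + 1

/-- `S` are the four sectors of a neighbourhood `U` of the crossing `c`. -/
structure IsFourSided (c : Fin D.numCrossings) (U : Set ℂ) (S : Fin 4 → Set ℂ) : Prop where
  isOpen : IsOpen U
  mem : D.crossingPoint c ∈ U
  isOpen_sector : ∀ i, IsOpen (S i)
  isPreconnected_sector : ∀ i, IsPreconnected (S i)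
  disjoint : Pairwise (Function.onFun Disjoint S)
  iUnion_eq : ⋃ i, S i = U \ D.trace
  exists_branch : ∀ y, D.curve y ∈ U → y = D.overParam c ∨ y = D.underParam c ∨
    ∃ i, D.IsBranch c S i y
  eventually_branch : ∀ i, ∀ᶠ t in 𝓝[>] 0, D.curve (D.branchParam c i t) ∈ U ∧
    D.IsBranch c S i (D.branchParam c i t)
  direction : ∀ i, ∀ᶠ ε : ℝ in 𝓝[>] 0, D.crossingPoint c + ε • D.sectorDir c i ∈ S i

variable {D}

theorem isUnderArc_crossingArc_zero (c : Fin D.numCrossings) :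
    D.IsUnderArc c (D.crossingSign c) (D.crossingArc c 0) :=
  (exists_isUnderArc c (D.crossingSign_eq c)).choose_spec

theorem isUnderArc_crossingArc_two (c : Fin D.numCrossings) :
    D.IsUnderArc c (-D.crossingSign c) (D.crossingArc c 2) :=
  (exists_isUnderArc c (D.neg_crossingSign_eq c)).choose_spec

/-- The indices `0` and `2` order the underpassing arcs by the side of the overpassing strand
instead of by orientation. This swaps them at crossings of one sign, and the relation is symmetric
in the two arcs. -/
theorem mem_foxColorings_iff {A : Type*} [AddCommGroup A] {f : D.Arc → A} :
    f ∈ D.foxColorings A ↔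
      ∀ c, f (D.crossingArc c 0) + f (D.crossingArc c 2) = 2 • f (D.overArc c) := by
  have key : ∀ c, (∀ a₁ a₂, D.IsUnderArc c (-1) a₁ → D.IsUnderArc c 1 a₂ →
      f a₁ + f a₂ = 2 • f (D.overArc c)) ↔
      f (D.crossingArc c 0) + f (D.crossingArc c 2) = 2 • f (D.overArc c) := by
    intro c
    have h0 := isUnderArc_crossingArc_zero c
    have h2 := isUnderArc_crossingArc_two c
    rcases D.crossingSign_eq c with h | h
    · rw [h] at h0 h2
      refine ⟨fun H => by rw [add_comm]; exact H _ _ h2 h0, fun H a₁ a₂ h₁ h₂ => ?_⟩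
      rw [h₁.unique h2, h₂.unique h0, add_comm]; exact H
    · rw [h] at h0 h2
      rw [neg_neg] at h2
      refine ⟨fun H => H _ _ h0 h2, fun H a₁ a₂ h₁ h₂ => ?_⟩
      rw [h₁.unique h0, h₂.unique h2]; exact H
  exact forall_congr' key

/-- Signs of the coordinates in the four quadrants. -/
def quadrantSign : Fin 4 → ℝ × ℝ := ![(1, 1), (-1, 1), (-1, -1), (1, -1)]

/-- Directions of the four half axes. -/
def halfAxis : Fin 4 → ℝ × ℝ := ![(0, 1), (-1, 0), (0, -1), (1, 0)]

/-- The quadrants of a square. -/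
def quadrant (δ : ℝ) (i : Fin 4) : Set (ℝ × ℝ) :=
  ((fun t => (quadrantSign i).1 * t) ⁻¹' Ioo 0 δ) ×ˢ ((fun t => (quadrantSign i).2 * t) ⁻¹' Ioo 0 δ)

theorem quadrantSign_eq (i : Fin 4) :
    ((quadrantSign i).1 = 1 ∨ (quadrantSign i).1 = -1) ∧
      ((quadrantSign i).2 = 1 ∨ (quadrantSign i).2 = -1) := by
  fin_cases i <;> simp [quadrantSign]

theorem preimage_sign_mul_Ioo {e δ : ℝ} (he : e = 1 ∨ e = -1) :
    (fun t => e * t) ⁻¹' Ioo 0 δ = (fun t => e * t) '' Ioo 0 δ := by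
  have hee : e * e = 1 := by rcases he with rfl | rfl <;> norm_num
  ext t
  constructor
  · exact fun h => ⟨e * t, h, by simp [← mul_assoc, hee]⟩
  · rintro ⟨t, ht, rfl⟩
    simpa [← mul_assoc, hee] using ht

theorem isPreconnected_quadrant (δ : ℝ) (i : Fin 4) : IsPreconnected (quadrant δ i) := by
  have h : ∀ e : ℝ, e = 1 ∨ e = -1 → IsPreconnected ((fun t => e * t) ⁻¹' Ioo 0 δ) := by
    intro e he
    rw [preimage_sign_mul_Ioo he]
    exact isPreconnected_Ioo.image _ (by fun_prop)
  exact (h _ (quadrantSign_eq i).1).prod (h _ (quadrantSign_eq i).2)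

theorem isOpen_quadrant (δ : ℝ) (i : Fin 4) : IsOpen (quadrant δ i) :=
  (isOpen_Ioo.preimage (by fun_prop)).prod (isOpen_Ioo.preimage (by fun_prop))

theorem quadrant_subset (δ : ℝ) (i : Fin 4) : quadrant δ i ⊆ Ioo (-δ) δ ×ˢ Ioo (-δ) δ := by
  rintro ⟨s, t⟩ ⟨⟨h1, h2⟩, h3, h4⟩
  simp only at h1 h2 h3 h4
  constructor <;> constructor <;> simp only <;> rcases quadrantSign_eq i with ⟨h | h, h' | h'⟩ <;>
    simp only [h, h'] at h1 h2 h3 h4 <;> linarith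

theorem disjoint_quadrant {δ : ℝ} {i j : Fin 4} (hij : i ≠ j) :
    Disjoint (quadrant δ i) (quadrant δ j) := by
  rw [disjoint_left]
  rintro ⟨s, t⟩ ⟨⟨h1, -⟩, h3, -⟩ ⟨⟨h1', -⟩, h3', -⟩
  revert hij h1 h3 h1' h3'
  fin_cases i <;> fin_cases j <;> simp [quadrantSign] <;> intros <;> linarith

theorem mem_quadrant_or {δ s t : ℝ} (hs : s ∈ Ioo (-δ) δ) (ht : t ∈ Ioo (-δ) δ) (hs0 : s ≠ 0)
    (ht0 : t ≠ 0) : ∃ i, (s, t) ∈ quadrant δ i := by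
  obtain ⟨hs1, hs2⟩ := hs
  obtain ⟨ht1, ht2⟩ := ht
  rcases lt_or_gt_of_ne hs0 with h | h <;> rcases lt_or_gt_of_ne ht0 with h' | h'
  · exact ⟨2, by simp [quadrant, quadrantSign]; refine ⟨⟨?_, ?_⟩, ?_, ?_⟩ <;> linarith⟩
  · exact ⟨1, by simp [quadrant, quadrantSign]; refine ⟨⟨?_, ?_⟩, ?_, ?_⟩ <;> linarith⟩
  · exact ⟨3, by simp [quadrant, quadrantSign]; refine ⟨⟨?_, ?_⟩, ?_, ?_⟩ <;> linarith⟩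
  · exact ⟨0, by simp [quadrant, quadrantSign]; refine ⟨⟨?_, ?_⟩, ?_, ?_⟩ <;> linarith⟩

theorem smul_halfAxis_mem_closure {δ τ : ℝ} (hτ : τ ∈ Ioo 0 δ) (i : Fin 4) :
    τ • halfAxis i ∈ closure (quadrant δ i) ∩ closure (quadrant δ (i + 1)) := by
  have hc : ∀ e : ℝ, e = 1 ∨ e = -1 → ∀ t ∈ Icc 0 δ, e * t ∈ closure ((fun t => e * t) ⁻¹' Ioo 0 δ) := by
    intro e he t ht
    rw [preimage_sign_mul_Ioo he]
    rw [← closure_Ioo (hτ.1.trans hτ.2).ne] at ht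
    exact map_mem_closure (f := fun t => e * t) (by fun_prop) ht fun t ht => mem_image_of_mem _ ht
  have h0 : (0 : ℝ) ∈ Icc 0 δ := ⟨le_rfl, (hτ.1.trans hτ.2).le⟩
  have hτ' := Ioo_subset_Icc_self hτ
  have key : ∀ j, ∀ s ∈ Icc 0 δ, ∀ t ∈ Icc 0 δ,
      ((quadrantSign j).1 * s, (quadrantSign j).2 * t) ∈ closure (quadrant δ j) := by
    intro j s hs t ht
    rw [quadrant, closure_prod_eq]
    exact ⟨hc _ (quadrantSign_eq j).1 s hs, hc _ (quadrantSign_eq j).2 t ht⟩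
  fin_cases i
  · exact ⟨by simpa [quadrantSign, halfAxis] using key 0 0 h0 τ hτ',
      by simpa [quadrantSign, halfAxis] using key 1 0 h0 τ hτ'⟩
  · exact ⟨by simpa [quadrantSign, halfAxis] using key 1 τ hτ' 0 h0,
      by simpa [quadrantSign, halfAxis] using key 2 τ hτ' 0 h0⟩
  · exact ⟨by simpa [quadrantSign, halfAxis] using key 2 0 h0 τ hτ',
      by simpa [quadrantSign, halfAxis] using key 3 0 h0 τ hτ'⟩
  · exact ⟨by simpa [quadrantSign, halfAxis] using key 3 τ hτ' 0 h0,
      by simpa [quadrantSign, halfAxis] using key 0 τ hτ' 0 h0⟩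

/-- The part of a square on the side of a half axis meets only two quadrants. -/
theorem disjoint_halfSquare {δ : ℝ} {i j : Fin 4} (h0 : j ≠ i) (h1 : j ≠ i + 1) :
    Disjoint {q : ℝ × ℝ | 0 < q.1 * (halfAxis i).1 + q.2 * (halfAxis i).2} (quadrant δ j) := by
  rw [disjoint_left]
  rintro ⟨s, t⟩ h ⟨⟨h1', -⟩, h3', -⟩
  simp only [mem_ofPred_eq] at h
  revert h0 h1 h h1' h3'
  fin_cases i <;> fin_cases j <;> simp [quadrantSign, halfAxis] <;> intros <;> linarith

end LinkDiagram

namespace LinkDiagram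

variable {D : LinkDiagram}

theorem exists_branchParam_regular (c : Fin D.numCrossings) :
    ∃ δ > 0, ∀ i, ∀ t ∈ Ioo 0 δ, D.Regular (D.branchParam c i t) ∧
      ∀ h, D.arcOf (D.branchParam c i t) h = D.crossingArc c i := by
  obtain ⟨δ₀, h₀, H₀⟩ := exists_underParam_shift_notMem c (D.crossingSign_eq c)
  obtain ⟨δ₂, h₂, H₂⟩ := exists_underParam_shift_notMem c (D.neg_crossingSign_eq c)
  obtain ⟨δ, h1, -, H⟩ := exists_regular_shift (D := D) (D.overParam c)
  have hover : ∀ e : ℝ, e = 1 ∨ e = -1 → ∀ t ∈ Ioo 0 δ, D.Regular ((D.overParam c).shift (e * t)) ∧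
      ∀ h, D.arcOf ((D.overParam c).shift (e * t)) h = D.overArc c := by
    intro e he t ht
    have hab : |e * t| < δ := by
      rcases he with rfl | rfl <;> simp [abs_of_pos ht.1, ht.2]
    have hne : e * t ≠ 0 := by rcases he with rfl | rfl <;> simp [ht.1.ne']
    refine ⟨H _ hne hab, fun _ => ?_⟩
    have hv : ∀ s ∈ uIcc (e * t) 0, (D.overParam c).shift s ∉ range D.underParam := by
      intro s hs
      by_cases hs0 : s = 0
      · rw [hs0, LoopParam.shift_zero]; exact D.overParam_notMem_range c
      · refine (H s hs0 ?_).2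
        have : |s| ≤ |e * t| := by simpa using abs_sub_right_of_mem_uIcc hs
        linarith
    have := arcOf_shift_eq (D.overParam c) hv
    simp only [LoopParam.shift_zero] at this
    exact this
  refine ⟨min δ (min δ₀ δ₂), by positivity, fun i t ht => ?_⟩
  have ht0 : t ∈ Ioo 0 δ₀ := ⟨ht.1, ht.2.trans_le ((min_le_right _ _).trans (min_le_left _ _))⟩
  have ht2 : t ∈ Ioo 0 δ₂ := ⟨ht.1, ht.2.trans_le ((min_le_right _ _).trans (min_le_right _ _))⟩
  have ht1 : t ∈ Ioo 0 δ := ⟨ht.1, ht.2.trans_le (min_le_left _ _)⟩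
  fin_cases i
  · exact ⟨H₀ t ht0, fun _ => (isUnderArc_arcOf c ht0 fun s hs => (H₀ s hs).2).unique
      (isUnderArc_crossingArc_zero c)⟩
  · exact hover (-1) (Or.inr rfl) t ht1
  · exact ⟨H₂ t ht2, fun _ => (isUnderArc_arcOf c ht2 fun s hs => (H₂ s hs).2).unique
      (isUnderArc_crossingArc_two c)⟩
  · exact hover 1 (Or.inl rfl) t ht1

/-- In a chart with the two strands as coordinate axes, the sectors are the images of the open
quadrants of a square. The square has to be so small that the trace meets it in the axes only, which
holds since the crossing has just two parameters. -/
theorem exists_isFourSided (c : Fin D.numCrossings) {W : Set ℂ} (hW : W ∈ 𝓝 (D.crossingPoint c)) :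
    ∃ U S, U ⊆ W ∧ D.IsFourSided c U S := by
  set p := D.crossingPoint c with hp
  set e := D.crossingSign c with he
  have hee : e * e = 1 := by rcases D.crossingSign_eq c with h | h <;> rw [he, h] <;> norm_num
  set α : ℝ → ℂ := fun s => D.curve ((D.overParam c).shift s) with hα
  set β : ℝ → ℂ := fun t => D.curve ((D.underParam c).shift (e * t)) with hβ
  have cα : Continuous α := D.continuous_curve_shift _
  have cβ : Continuous β := (D.continuous_curve_shift (D.underParam c)).comp (by fun_prop)
  have α0 : α 0 = p := by simp [hα, hp, curve_overParam]
  have β0 : β 0 = p := by simp [hβ, hp, curve_underParam]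
  have dα : HasStrictDerivAt α (D.overTangent c) 0 :=
    (D.smooth_over c).hasStrictDerivAt (by simp)
  have dβ : HasStrictDerivAt β (D.posUnderTangent c) 0 := by
    have h1 : HasStrictDerivAt (fun h : ℝ => D.curve ((D.underParam c).shift h))
        (D.underTangent c) (e * 0) := by
      rw [mul_zero]; exact (D.smooth_under c).hasStrictDerivAt (by simp)
    have h2 : HasStrictDerivAt (fun t : ℝ => e * t) e 0 := by
      simpa using (hasStrictDerivAt_id (0 : ℝ)).const_mul e
    exact HasStrictDerivAt.scomp (h := fun t : ℝ => e * t) (0 : ℝ) h1 h2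
  obtain ⟨E, hE, h0E, hdir⟩ := exists_crossing_chart α0 β0 dα dβ (D.planeDet_pos c).ne'
  have cE : Continuous E := by
    have : (E : ℝ × ℝ → ℂ) = fun q => α q.1 + β q.2 - p := funext hE
    rw [this]; fun_prop
  have E0 : E (0, 0) = p := by rw [hE]; simp [α0, β0]
  have hbr : ∀ i t, D.curve (D.branchParam c i t) = E (t • halfAxis i) := by
    intro i t
    have ho : D.curve (D.overParam c) = p := rfl
    have hu : D.curve (D.underParam c) = p := curve_underParam c
    rw [hE]
    fin_cases i <;> simp [branchParam, halfAxis, hα, hβ, he, ho, hu]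
  obtain ⟨δ₁, hδ₁, Hreg⟩ := exists_branchParam_regular c
  obtain ⟨δ₂, hδ₂, hsq⟩ : ∃ δ₂ > 0, Ioo (-δ₂) δ₂ ×ˢ Ioo (-δ₂) δ₂ ⊆ E.source := by
    obtain ⟨r, hr, H⟩ := Metric.mem_nhds_iff.1 (E.open_source.mem_nhds h0E)
    refine ⟨r, hr, fun q hq => H ?_⟩
    rw [Metric.mem_ball, Prod.dist_eq, Real.dist_eq, Real.dist_eq, sub_zero, sub_zero]
    exact max_lt (abs_lt.2 hq.1) (abs_lt.2 hq.2)
  have hδ : 0 < min δ₁ δ₂ := by positivity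
  set δ := min δ₁ δ₂ with hδdef
  obtain ⟨W', hW', Hpar⟩ := exists_nhds_params (D := D) p hδ
  obtain ⟨η, hη, hηδ, hηW⟩ : ∃ η > 0, η ≤ δ ∧ E '' (Ioo (-η) η ×ˢ Ioo (-η) η) ⊆ W ∩ W' := by
    have : E ⁻¹' (W ∩ W') ∈ 𝓝 ((0, 0) : ℝ × ℝ) := by
      refine cE.continuousAt.preimage_mem_nhds ?_
      rw [E0]; exact inter_mem hW hW'
    obtain ⟨r, hr, H⟩ := Metric.mem_nhds_iff.1 this
    refine ⟨min r δ, by positivity, min_le_right _ _, ?_⟩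
    rintro _ ⟨q, hq, rfl⟩
    refine H ?_
    rw [Metric.mem_ball, Prod.dist_eq, Real.dist_eq, Real.dist_eq, sub_zero, sub_zero]
    exact max_lt ((abs_lt.2 hq.1).trans_le (min_le_left _ _))
      ((abs_lt.2 hq.2).trans_le (min_le_left _ _))
  set Q := Ioo (-η) η ×ˢ Ioo (-η) η with hQ
  have hQo : IsOpen Q := isOpen_Ioo.prod isOpen_Ioo
  have hQs : Q ⊆ E.source := by
    refine Subset.trans ?_ hsq
    have : η ≤ δ₂ := hηδ.trans (min_le_right _ _)
    exact prod_mono (Ioo_subset_Ioo (by linarith) this) (Ioo_subset_Ioo (by linarith) this)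
  have hqQ := quadrant_subset η
  have ha : ∀ i, ∀ t ∈ Ioo 0 η, t • halfAxis i ∈ Q := by
    rintro i t ⟨h1, h2⟩
    fin_cases i <;> refine ⟨⟨?_, ?_⟩, ?_, ?_⟩ <;> simp [halfAxis] <;> linarith
  have hsrc : ∀ i, ∀ t ∈ Ioo 0 δ, t • halfAxis i ∈ E.source := by
    rintro i t ⟨h1, h2⟩
    apply hsq
    have : t < δ₂ := h2.trans_le (min_le_right _ _)
    fin_cases i <;> refine ⟨⟨?_, ?_⟩, ?_, ?_⟩ <;> simp [halfAxis] <;> linarith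
  have hparams : ∀ y, D.curve y ∈ E '' Q → y = D.overParam c ∨ y = D.underParam c ∨
      ∃ i, ∃ t ∈ Ioo 0 δ, y = D.branchParam c i t := by
    intro y hy
    obtain ⟨x, h, h1, h2, h3⟩ := Hpar y (hηW hy).2
    rw [abs_lt] at h2
    have hcase : ∀ k : ℝ, k ∈ Ioo (-δ) δ → k ≠ 0 → k ∈ Ioo 0 δ ∨ -k ∈ Ioo 0 δ := by
      intro k hk hk0
      rcases lt_or_gt_of_ne hk0 with h | h
      · exact Or.inr ⟨by linarith, by linarith [hk.1]⟩
      · exact Or.inl ⟨h, hk.2⟩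
    by_cases hh : h = 0
    · rw [hh, LoopParam.shift_zero] at h3
      rw [h3]
      rcases curve_eq_crossingPoint h1 with h4 | h4
      · exact Or.inl h4
      · exact Or.inr (Or.inl h4)
    · refine Or.inr (Or.inr ?_)
      rcases curve_eq_crossingPoint h1 with rfl | rfl
      · rcases hcase h h2 hh with h4 | h4
        · exact ⟨3, h, h4, by simp [branchParam, h3]⟩
        · exact ⟨1, -h, h4, by simp [branchParam, h3]⟩
      · have heh : e * h ∈ Ioo (-δ) δ := by
          rcases D.crossingSign_eq c with h4 | h4 <;> rw [he, h4] <;> constructor <;>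
            linarith [h2.1, h2.2]
        rcases hcase (e * h) heh (mul_ne_zero (fun h5 => by simp [h5] at hee) hh) with h4 | h4
        · exact ⟨0, e * h, h4, by simp [branchParam, h3, ← he, ← mul_assoc, hee]⟩
        · exact ⟨2, -(e * h), h4, by simp [branchParam, h3, ← he, ← mul_assoc, hee]⟩
  -- The bound on the parameter improves from `δ` to `η`: the point on the half axis lies in the
  -- source of the chart, so by injectivity it is in the square.
  have hparams' : ∀ y, D.curve y ∈ E '' Q → y = D.overParam c ∨ y = D.underParam c ∨
      ∃ i, ∃ t ∈ Ioo 0 η, y = D.branchParam c i t := by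
    intro y hy
    rcases hparams y hy with h | h | ⟨i, t, ht, h⟩
    · exact Or.inl h
    · exact Or.inr (Or.inl h)
    refine Or.inr (Or.inr ⟨i, t, ⟨ht.1, ?_⟩, h⟩)
    rw [h, hbr] at hy
    obtain ⟨q, hq, hqE⟩ := hy
    have h1 := E.injOn (hQs hq) (hsrc i t ht) hqE
    rw [h1, hQ] at hq
    obtain ⟨⟨h2, h3⟩, h4, h5⟩ := hq
    fin_cases i <;> simp [halfAxis] at h2 h3 h4 h5 <;> linarith
  have htrace : ∀ q ∈ Q, (E q ∈ D.trace ↔ q.1 = 0 ∨ q.2 = 0) := by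
    rintro ⟨s, t⟩ hq
    constructor
    · rintro ⟨y, hy⟩
      have hm : D.curve y ∈ E '' Q := ⟨_, hq, hy.symm⟩
      rcases hparams' y hm with rfl | rfl | ⟨i, r, hr, rfl⟩
      · rw [curve_overParam, ← hp, ← E0] at hy
        have := E.injOn h0E (hQs hq) hy
        exact Or.inl (congrArg Prod.fst this).symm
      · rw [curve_underParam, ← hp, ← E0] at hy
        have := E.injOn h0E (hQs hq) hy
        exact Or.inl (congrArg Prod.fst this).symm
      · rw [hbr] at hy
        have := E.injOn (hQs (ha i r hr)) (hQs hq) hy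
        rw [← this]
        fin_cases i <;> simp [halfAxis]
    · rintro (h | h)
      · simp only at h
        rw [h, hE]
        simp only [α0, add_sub_cancel_left]
        exact D.curve_mem_trace _
      · simp only at h
        rw [h, hE]
        simp only [β0, add_sub_cancel_right]
        exact D.curve_mem_trace _
  have hbranch : ∀ i, ∀ t ∈ Ioo 0 η,
      D.IsBranch c (fun i => E '' quadrant η i) i (D.branchParam c i t) := by
    intro i t ht
    have ht' : t ∈ Ioo 0 δ₁ := ⟨ht.1, ht.2.trans_le (hηδ.trans (min_le_left _ _))⟩
    have hcl := smul_halfAxis_mem_closure ht i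
    refine ⟨(Hreg i t ht').1, (Hreg i t ht').2, ?_, ?_, fun j hj => ?_⟩
    · rw [hbr]; exact map_mem_closure cE hcl.1 fun q hq => mem_image_of_mem _ hq
    · rw [hbr]; exact map_mem_closure cE hcl.2 fun q hq => mem_image_of_mem _ hq
    · by_contra hne
      push Not at hne
      -- The half of the square on the side of the half axis is an open neighbourhood of the point
      -- that misses the two remaining quadrants.
      have hdis := disjoint_halfSquare (δ := η) hne.1 hne.2
      set V := {q : ℝ × ℝ | 0 < q.1 * (halfAxis i).1 + q.2 * (halfAxis i).2} with hV
      have hVo : IsOpen V := isOpen_lt continuous_const (by fun_prop)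
      have hmem : E (t • halfAxis i) ∈ E '' (Q ∩ V) := by
        refine mem_image_of_mem _ ⟨ha i t ht, ?_⟩
        simp only [hV, mem_ofPred_eq]
        fin_cases i <;> simp [halfAxis, ht.1]
      rw [hbr, mem_closure_iff] at hj
      obtain ⟨_, ⟨q, hq, rfl⟩, q', hq', hqq⟩ := hj _
        (E.isOpen_image_of_subset_source (hQo.inter hVo) (inter_subset_left.trans hQs)) hmem
      have := E.injOn (hQs (hqQ j hq')) (hQs hq.1) hqq
      rw [this] at hq'
      exact disjoint_left.1 hdis hq.2 hq'
  refine ⟨E '' Q, fun i => E '' quadrant η i, fun z hz => (hηW hz).1,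
    E.isOpen_image_of_subset_source hQo hQs, ⟨(0, 0), by simp [hQ, hη], E0⟩,
    fun i => E.isOpen_image_of_subset_source (isOpen_quadrant η i) ((hqQ i).trans hQs),
    fun i => (isPreconnected_quadrant η i).image _ cE.continuousOn, ?_, ?_, ?_, ?_, ?_⟩
  · intro i j hij
    exact (disjoint_quadrant hij).image E.injOn ((hqQ i).trans hQs) ((hqQ j).trans hQs)
  · ext z
    simp only [mem_iUnion]
    constructor
    · rintro ⟨i, q, hq, rfl⟩
      refine ⟨⟨q, hqQ i hq, rfl⟩, fun h => ?_⟩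
      rw [htrace q (hqQ i hq)] at h
      obtain ⟨⟨h1, -⟩, h2, -⟩ := hq
      rcases h with h | h <;> simp [h] at h1 h2
    · rintro ⟨⟨q, hq, rfl⟩, h⟩
      rw [htrace q hq] at h
      push Not at h
      obtain ⟨i, hi⟩ := mem_quadrant_or hq.1 hq.2 h.1 h.2
      exact ⟨i, q, hi, rfl⟩
  · intro y hy
    rcases hparams' y hy with h | h | ⟨i, t, ht, rfl⟩
    · exact Or.inl h
    · exact Or.inr (Or.inl h)
    · exact Or.inr (Or.inr ⟨i, hbranch i t ht⟩)
  · intro i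
    filter_upwards [Ioo_mem_nhdsGT hη] with t ht
    exact ⟨by rw [hbr]; exact mem_image_of_mem _ (ha i _ ht), hbranch i _ ht⟩
  · intro i
    -- In the chart, the path in the direction `sectorDir c i` starts at the origin with velocity
    -- `quadrantSign i`, so both coordinates soon have the signs of that quadrant.
    have hd : D.sectorDir c i = (quadrantSign i).1 • D.overTangent c +
        (quadrantSign i).2 • D.posUnderTangent c := by
      fin_cases i <;> simp [sectorDir, quadrantSign] <;> ring
    have h1 := hdir (quadrantSign i).1 (quadrantSign i).2
    rw [← hd] at h1
    have hE0 : E.symm p = (0, 0) := by rw [← E0, E.left_inv h0E]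
    set g : ℝ → ℝ × ℝ := fun ε => E.symm (p + ε • D.sectorDir c i) with hg
    have hg0 : g 0 = (0, 0) := by simp [hg, hE0]
    have hpos : ∀ k : ℝ, k = 1 ∨ k = -1 → 0 < k * k := by
      rintro k (rfl | rfl) <;> norm_num
    have h1a : HasDerivAt (fun ε => (g ε).1) (quadrantSign i).1 0 :=
      (hasFDerivAt_fst (𝕜 := ℝ) (p := g 0)).comp_hasDerivAt (0 : ℝ) h1
    have h1b : HasDerivAt (fun ε => (g ε).2) (quadrantSign i).2 0 :=
      (hasFDerivAt_snd (𝕜 := ℝ) (p := g 0)).comp_hasDerivAt (0 : ℝ) h1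
    have g1 : ∀ᶠ ε in 𝓝[>] 0, 0 < (quadrantSign i).1 * (g ε).1 := by
      refine HasDerivAt.eventually_pos (h1a.const_mul (quadrantSign i).1) ?_
        (hpos _ (quadrantSign_eq i).1)
      change _ * (g 0).1 = 0
      simp [hg0]
    have g2 : ∀ᶠ ε in 𝓝[>] 0, 0 < (quadrantSign i).2 * (g ε).2 := by
      refine HasDerivAt.eventually_pos (h1b.const_mul (quadrantSign i).2) ?_
        (hpos _ (quadrantSign_eq i).2)
      change _ * (g 0).2 = 0
      simp [hg0]
    have g3 : ∀ᶠ ε in 𝓝[>] (0 : ℝ), g ε ∈ Q := by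
      refine nhdsWithin_le_nhds (h1.continuousAt.preimage_mem_nhds ?_)
      change Q ∈ 𝓝 (g 0)
      rw [hg0]
      exact hQo.mem_nhds (by simp [hQ, hη])
    have g4 : ∀ᶠ ε : ℝ in 𝓝[>] (0 : ℝ), p + ε • D.sectorDir c i ∈ E.target := by
      have hc : ContinuousAt (fun ε : ℝ => p + ε • D.sectorDir c i) 0 := by fun_prop
      refine nhdsWithin_le_nhds (hc.preimage_mem_nhds (E.open_target.mem_nhds ?_))
      rw [zero_smul, add_zero, ← E0]
      exact E.map_source h0E
    filter_upwards [g1, g2, g3, g4] with ε k1 k2 k3 k4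
    refine ⟨g ε, ⟨⟨k1, ?_⟩, k2, ?_⟩, E.right_inv k4⟩
    · rcases (quadrantSign_eq i).1 with h | h <;> simp only [h] <;> linarith [k3.1.1, k3.1.2]
    · rcases (quadrantSign_eq i).2 with h | h <;> simp only [h] <;> linarith [k3.2.1, k3.2.2]

end LinkDiagram

/-! ### Lifting Fox colorings to locally constant functions off the curves -/

/-- A preconnected set covered by disjoint open sets is contained in each of them that it meets. -/
theorem IsPreconnected.subset_of_mem_iUnion {X ι : Type*} [TopologicalSpace X] {V : Set X}
    (hV : IsPreconnected V) {S : ι → Set X} (ho : ∀ i, IsOpen (S i))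
    (hd : Pairwise (Function.onFun Disjoint S)) (hc : V ⊆ ⋃ i, S i) {i : ι} {z : X} (hzV : z ∈ V)
    (hz : z ∈ S i) : V ⊆ S i := by
  refine hV.subset_left_of_subset_union (v := ⋃ j ∈ {j | j ≠ i}, S j) (ho i)
    (isOpen_biUnion fun j _ => ho j) ?_ ?_ ⟨z, hzV, hz⟩
  · rw [disjoint_iUnion₂_right]
    exact fun j hj => hd (Ne.symm hj)
  · intro w hw
    obtain ⟨j, hj⟩ := mem_iUnion.1 (hc hw)
    by_cases hji : j = i
    · exact Or.inl (hji ▸ hj)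
    · exact Or.inr (mem_biUnion (show j ∈ {j | j ≠ i} from hji) hj)

namespace LinkDiagram

variable {D : LinkDiagram}

namespace IsTwoSided

variable {x : LoopParam D.numComponents} {V T₀ T₁ : Set ℂ}

theorem nonempty₀ (h : D.IsTwoSided x V T₀ T₁) : T₀.Nonempty :=
  closure_nonempty_iff.1 ⟨_, h.mem_closure₀ _ h.mem (D.curve_mem_trace x)⟩

theorem nonempty₁ (h : D.IsTwoSided x V T₀ T₁) : T₁.Nonempty :=
  closure_nonempty_iff.1 ⟨_, h.mem_closure₁ _ h.mem (D.curve_mem_trace x)⟩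

theorem subset₀ (h : D.IsTwoSided x V T₀ T₁) : T₀ ⊆ V \ D.trace := h.union_eq ▸ subset_union_left

theorem subset₁ (h : D.IsTwoSided x V T₀ T₁) : T₁ ⊆ V \ D.trace := h.union_eq ▸ subset_union_right

/-- The two sides of a point in the closures of two regions are in these regions. -/
theorem subset_or (h : D.IsTwoSided x V T₀ T₁) {ι : Type*} {S : ι → Set ℂ} {U : Set ℂ} (hVU : V ⊆ U)
    (ho : ∀ i, IsOpen (S i)) (hd : Pairwise (Function.onFun Disjoint S))
    (hc : ⋃ i, S i = U \ D.trace) {a b : ι} (hab : a ≠ b) (ha : D.curve x ∈ closure (S a))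
    (hb : D.curve x ∈ closure (S b)) : (T₀ ⊆ S a ∧ T₁ ⊆ S b) ∨ (T₀ ⊆ S b ∧ T₁ ⊆ S a) := by
  have hVc : V \ D.trace ⊆ ⋃ i, S i := hc ▸ sdiff_subset_sdiff_left hVU
  have key : ∀ i, D.curve x ∈ closure (S i) → T₀ ⊆ S i ∨ T₁ ⊆ S i := by
    intro i hi
    obtain ⟨z, hzV, hz⟩ := mem_closure_iff.1 hi V h.isOpen h.mem
    have hz' : z ∈ V \ D.trace := ⟨hzV, (hc ▸ mem_iUnion_of_mem i hz : z ∈ U \ D.trace).2⟩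
    rw [← h.union_eq] at hz'
    rcases hz' with hz' | hz'
    · exact Or.inl (h.isPreconnected₀.subset_of_mem_iUnion ho hd (h.subset₀.trans hVc) hz' hz)
    · exact Or.inr (h.isPreconnected₁.subset_of_mem_iUnion ho hd (h.subset₁.trans hVc) hz' hz)
  have hdis : ∀ T : Set ℂ, T.Nonempty → T ⊆ S a → ¬ T ⊆ S b := by
    rintro T ⟨z, hz⟩ h1 h2
    exact disjoint_left.1 (hd hab) (h1 hz) (h2 hz)
  rcases key a ha with h1 | h1 <;> rcases key b hb with h2 | h2
  · exact absurd h2 (hdis _ h.nonempty₀ h1)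
  · exact Or.inl ⟨h1, h2⟩
  · exact Or.inr ⟨h2, h1⟩
  · exact absurd h2 (hdis _ h.nonempty₁ h1)

theorem pairwise_disjoint (h : D.IsTwoSided x V T₀ T₁) :
    Pairwise (Function.onFun Disjoint fun b : Bool => cond b T₁ T₀) := by
  rintro (_ | _) (_ | _) hab
  · exact absurd rfl hab
  · exact h.disjoint
  · exact h.disjoint.symm
  · exact absurd rfl hab

theorem isOpen_cond (h : D.IsTwoSided x V T₀ T₁) (b : Bool) : IsOpen (cond b T₁ T₀) := by
  cases b
  · exact h.isOpen₀
  · exact h.isOpen₁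

theorem iUnion_cond (h : D.IsTwoSided x V T₀ T₁) : ⋃ b, cond b T₁ T₀ = V \ D.trace := by
  rw [← h.union_eq]
  ext z
  simp

end IsTwoSided

namespace IsFourSided

variable {c : Fin D.numCrossings} {U : Set ℂ} {S : Fin 4 → Set ℂ}

theorem sector_subset (h : D.IsFourSided c U S) (i : Fin 4) : S i ⊆ U \ D.trace :=
  h.iUnion_eq ▸ subset_iUnion S i

theorem crossingPoint_mem_closure (h : D.IsFourSided c U S) (i : Fin 4) :
    D.crossingPoint c ∈ closure (S i) := by
  have h1 : Tendsto (fun ε : ℝ => D.crossingPoint c + ε • D.sectorDir c i) (𝓝[>] 0)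
      (𝓝 (D.crossingPoint c)) := by
    have : ContinuousAt (fun ε : ℝ => D.crossingPoint c + ε • D.sectorDir c i) 0 := by fun_prop
    have h2 := this.tendsto
    rw [zero_smul, add_zero] at h2
    exact h2.mono_left nhdsWithin_le_nhds
  exact mem_closure_of_tendsto h1 (h.direction i)

theorem branch_nonempty (h : D.IsFourSided c U S) (i : Fin 4) :
    ∃ y, D.curve y ∈ U ∧ D.IsBranch c S i y :=
  let ⟨_, ht⟩ := (h.eventually_branch i).exists
  ⟨_, ht⟩

theorem nonempty (h : D.IsFourSided c U S) (i : Fin 4) : (S i).Nonempty :=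
  closure_nonempty_iff.1 ⟨_, h.crossingPoint_mem_closure i⟩

end IsFourSided

/-- Every point of the plane is off the trace, a regular point of a curve, or a crossing. -/
theorem point_cases (p : ℂ) : p ∉ D.trace ∨ (∃ x, D.Regular x ∧ D.curve x = p) ∨
    ∃ c, D.crossingPoint c = p := by
  by_cases h : p ∈ D.trace
  · obtain ⟨x, rfl⟩ := h
    by_cases h1 : x ∈ range D.overParam
    · obtain ⟨c, rfl⟩ := h1
      exact Or.inr (Or.inr ⟨c, rfl⟩)
    by_cases h2 : x ∈ range D.underParam
    · obtain ⟨c, rfl⟩ := h2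
      exact Or.inr (Or.inr ⟨c, (curve_underParam c).symm⟩)
    exact Or.inr (Or.inl ⟨x, ⟨h1, h2⟩, rfl⟩)
  · exact Or.inl h

variable (D) in
theorem dense_compl_trace : Dense (D.traceᶜ) := by
  intro p
  rcases D.point_cases p with h | ⟨x, hx, rfl⟩ | ⟨c, rfl⟩
  · exact subset_closure h
  · obtain ⟨V, T₀, T₁, -, h⟩ := hx.exists_isTwoSided univ_mem
    exact closure_mono (h.subset₀.trans fun z hz => hz.2)
      (h.mem_closure₀ _ h.mem (D.curve_mem_trace x))
  · obtain ⟨U, S, -, h⟩ := D.exists_isFourSided c univ_mem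
    exact closure_mono ((h.sector_subset 0).trans fun z hz => hz.2) (h.crossingPoint_mem_closure 0)

variable {A : Type*} [AddCommGroup A]

/-- `g` is constant on the connected parts of `U` off the trace, and its values on the two sides of
a curve have the sum prescribed by the map `f` on the arcs. -/
structure IsSection (f : D.Arc → A) (U : Set ℂ) (g : ℂ → A) : Prop where
  const : ∀ V ⊆ U \ D.trace, IsPreconnected V → ∀ z ∈ V, ∀ w ∈ V, g z = g w
  sum : ∀ x V T₀ T₁, D.IsTwoSided x V T₀ T₁ → V ⊆ U → ∀ z ∈ T₀, ∀ w ∈ T₁, ∀ hx,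
    g z + g w = f (D.arcOf x hx)

theorem IsSection.mono {f : D.Arc → A} {U U' : Set ℂ} {g : ℂ → A} (h : D.IsSection f U g)
    (hU : U' ⊆ U) : D.IsSection f U' g :=
  ⟨fun V hV => h.const V (hV.trans (sdiff_subset_sdiff_left hU)),
    fun x V T₀ T₁ h' hV => h.sum x V T₀ T₁ h' (hV.trans hU)⟩

/-- The values of a section in adjacent sectors at a crossing. -/
theorem IsSection.sum_crossing {f : D.Arc → A} {U V : Set ℂ} {g : ℂ → A} (h : D.IsSection f U g)
    {c : Fin D.numCrossings} {S : Fin 4 → Set ℂ} (h' : D.IsFourSided c V S) (hV : V ⊆ U)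
    {i : Fin 4} {z w : ℂ} (hz : z ∈ S i) (hw : w ∈ S (i + 1)) :
    g z + g w = f (D.crossingArc c i) := by
  obtain ⟨y, hyV, hy⟩ := h'.branch_nonempty i
  obtain ⟨V', T₀, T₁, hV', hT⟩ := hy.regular.exists_isTwoSided (h'.isOpen.mem_nhds hyV)
  have hconst : ∀ j, ∀ z ∈ S j, ∀ w ∈ S j, g z = g w := fun j =>
    h.const _ ((h'.sector_subset j).trans (sdiff_subset_sdiff_left hV)) (h'.isPreconnected_sector j)
  obtain ⟨z', hz'⟩ := hT.nonempty₀
  obtain ⟨w', hw'⟩ := hT.nonempty₁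
  have hs := h.sum y V' T₀ T₁ hT (hV'.trans hV) z' hz' w' hw' hy.regular.2
  rw [hy.arcOf_eq] at hs
  rcases hT.subset_or hV' h'.isOpen_sector h'.disjoint h'.iUnion_eq
    (show i ≠ i + 1 by fin_cases i <;> decide) hy.mem_closure hy.mem_closure_succ with h1 | h1
  · rw [hconst i z hz z' (h1.1 hz'), hconst _ w hw w' (h1.2 hw')]; exact hs
  · rw [hconst i z hz w' (h1.2 hw'), hconst _ w hw z' (h1.1 hz'), add_comm]; exact hs

/-- Local sections are determined by one value. -/
theorem exists_nhds_section_unique (z : ℂ) {W : Set ℂ} (hW : W ∈ 𝓝 z) : ∃ N ∈ 𝓝 z, N ⊆ W ∧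
    ∀ (f : D.Arc → A) (g g' : ℂ → A), D.IsSection f W g → D.IsSection f W g' →
      ∀ w ∈ N \ D.trace, g w = g' w → ∀ w' ∈ N \ D.trace, g w' = g' w' := by
  rcases D.point_cases z with h | ⟨x, hx, rfl⟩ | ⟨c, rfl⟩
  · obtain ⟨r, hr, H⟩ := Metric.mem_nhds_iff.1
      (inter_mem hW (D.isClosed_trace.isOpen_compl.mem_nhds h))
    refine ⟨_, Metric.ball_mem_nhds z hr, fun w hw => (H hw).1, fun f g g' hg hg' w hw e w' hw' => ?_⟩
    have hb := (convex_ball z r).isPreconnected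
    rw [hg.const _ H hb w' hw'.1 w hw.1, e, hg'.const _ H hb w' hw'.1 w hw.1]
  · obtain ⟨V, T₀, T₁, hV, h⟩ := hx.exists_isTwoSided hW
    refine ⟨V, h.isOpen.mem_nhds h.mem, hV, fun f g g' hg hg' w hw e w' hw' => ?_⟩
    have c₀ := fun {g : ℂ → A} (hg : D.IsSection f W g) =>
      hg.const _ (h.subset₀.trans (sdiff_subset_sdiff_left hV)) h.isPreconnected₀
    have c₁ := fun {g : ℂ → A} (hg : D.IsSection f W g) =>
      hg.const _ (h.subset₁.trans (sdiff_subset_sdiff_left hV)) h.isPreconnected₁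
    have hs := fun {g : ℂ → A} (hg : D.IsSection f W g) {z w} hz hw =>
      hg.sum x V T₀ T₁ h hV z hz w hw hx.2
    rw [← h.union_eq] at hw hw'
    rcases hw with hw | hw <;> rcases hw' with hw' | hw'
    · rw [c₀ hg w' hw' w hw, e, c₀ hg' w' hw' w hw]
    · have := (hs hg hw hw').trans (hs hg' hw hw').symm
      rwa [e, add_right_inj] at this
    · have := (hs hg hw' hw).trans (hs hg' hw' hw).symm
      rwa [e, add_left_inj] at this
    · rw [c₁ hg w' hw' w hw, e, c₁ hg' w' hw' w hw]
  · obtain ⟨V, S, hV, h⟩ := D.exists_isFourSided c hW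
    refine ⟨V, h.isOpen.mem_nhds h.mem, hV, fun f g g' hg hg' w hw e w' hw' => ?_⟩
    have cc := fun {g : ℂ → A} (hg : D.IsSection f W g) (i : Fin 4) =>
      hg.const _ ((h.sector_subset i).trans (sdiff_subset_sdiff_left hV)) (h.isPreconnected_sector i)
    -- The value in a sector and the label of the half strand determine the value in the next
    -- sector; three such steps reach every sector.
    have step : ∀ i, (∀ u ∈ S i, g u = g' u) → ∀ u ∈ S (i + 1), g u = g' u := by
      intro i hi u hu
      obtain ⟨v, hv⟩ := h.nonempty i
      have := (hg.sum_crossing h hV hv hu).trans (hg'.sum_crossing h hV hv hu).symm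
      rwa [hi v hv, add_right_inj] at this
    rw [← h.iUnion_eq, mem_iUnion] at hw hw'
    obtain ⟨i, hi⟩ := hw
    obtain ⟨j, hj⟩ := hw'
    have h0 : ∀ u ∈ S i, g u = g' u := fun u hu => by rw [cc hg i u hu w hi, e, cc hg' i u hu w hi]
    have h1 := step i h0
    have h2 := step _ h1
    have h3 := step _ h2
    have : j = i ∨ j = i + 1 ∨ j = i + 1 + 1 ∨ j = i + 1 + 1 + 1 := by
      clear * -
      revert i j; decide
    rcases this with rfl | rfl | rfl | rfl
    · exact h0 _ hj
    · exact h1 _ hj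
    · exact h2 _ hj
    · exact h3 _ hj

/-- A function may be chosen freely on disjoint open sectors: `v i a` is its value on the `i`-th
one, in terms of a parameter `a`. The sum condition then needs checking for a single pair of
distinct sectors adherent to each regular point, as these must contain its two sides. -/
theorem exists_section_of_sectors {f : D.Arc → A} {ι : Type*} {U : Set ℂ} {S : ι → Set ℂ}
    (ho : ∀ i, IsOpen (S i)) (hd : Pairwise (Function.onFun Disjoint S))
    (hc : ⋃ i, S i = U \ D.trace) (v : ι → A → A) (hv : ∀ i, Function.Bijective (v i))
    (hadj : ∀ y, D.curve y ∈ U → D.Regular y → ∃ i j, i ≠ j ∧ D.curve y ∈ closure (S i) ∧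
      D.curve y ∈ closure (S j) ∧ ∀ a h, v i a + v j a = f (D.arcOf y h)) :
    ∃ σ : A → ℂ → A, (∀ a, D.IsSection f U (σ a)) ∧
      ∀ z ∈ U, z ∈ D.traceᶜ → Function.Bijective fun a => σ a z := by
  classical
  let σ : A → ℂ → A := fun a z => if h : ∃ i, z ∈ S i then v h.choose a else a
  have hσ : ∀ i, ∀ z ∈ S i, ∀ a, σ a z = v i a := by
    intro i z hz a
    have h : ∃ i, z ∈ S i := ⟨i, hz⟩
    have : h.choose = i := by
      by_contra hne
      exact disjoint_left.1 (hd hne) h.choose_spec hz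
    simp only [σ, dif_pos h, this]
  refine ⟨σ, fun a => ⟨?_, ?_⟩, ?_⟩
  · intro V hV hVc z hz w hw
    have hV' : V ⊆ ⋃ i, S i := hc ▸ hV
    obtain ⟨i, hi⟩ := mem_iUnion.1 (hV' hz)
    have := hVc.subset_of_mem_iUnion ho hd hV' hz hi
    rw [hσ i z hi, hσ i w (this hw)]
  · intro x V T₀ T₁ h hV z hz w hw hx
    obtain ⟨i, j, hij, hi, hj, H⟩ := hadj x (hV h.mem) (h.regular x h.mem)
    rcases h.subset_or hV ho hd hc hij hi hj with h1 | h1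
    · rw [hσ i z (h1.1 hz), hσ j w (h1.2 hw), H]
    · rw [hσ j z (h1.1 hz), hσ i w (h1.2 hw), add_comm, H]
  · intro z hzU hz
    obtain ⟨i, hi⟩ := mem_iUnion.1 (hc ▸ (⟨hzU, hz⟩ : z ∈ U \ D.trace) : z ∈ ⋃ i, S i)
    simp only [hσ i z hi]
    exact hv i

/-- Off the curves the constants serve, and at a regular point the pair of values `a` and `f - a`.
At a crossing the value `a` in the sector `0` propagates counterclockwise through the half strands
`0`, `1` and, backwards, `3`. The remaining half strand `2` imposes a condition independent of `a`,
which is the Fox relation. -/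
theorem exists_local_section {f : D.Arc → A} (hf : f ∈ D.foxColorings A) (p : ℂ) :
    ∃ U : Set ℂ, IsOpen U ∧ p ∈ U ∧ ∃ σ : A → ℂ → A, (∀ a, D.IsSection f U (σ a)) ∧
      ∀ z ∈ U, z ∈ D.traceᶜ → Function.Bijective fun a => σ a z := by
  rcases D.point_cases p with h | ⟨x, hx, rfl⟩ | ⟨c, rfl⟩
  · refine ⟨D.traceᶜ, D.isClosed_trace.isOpen_compl, h, fun a _ => a, fun a => ⟨?_, ?_⟩, ?_⟩
    · exact fun _ _ _ _ _ _ _ => rfl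
    · intro x V T₀ T₁ h hV
      exact absurd (D.curve_mem_trace x) (hV h.mem)
    · exact fun _ _ _ => Function.bijective_id
  · obtain ⟨V, T₀, T₁, -, h⟩ := hx.exists_isTwoSided univ_mem
    refine ⟨V, h.isOpen, h.mem, exists_section_of_sectors h.isOpen_cond h.pairwise_disjoint
      h.iUnion_cond (fun b a => cond b (f (D.arcOf x hx.2) - a) a) ?_ ?_⟩
    · rintro (_ | _)
      · exact Function.bijective_id
      · exact (Equiv.subLeft _).bijective
    · intro y hyV hy
      refine ⟨false, true, by simp, h.mem_closure₀ _ hyV (D.curve_mem_trace y),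
        h.mem_closure₁ _ hyV (D.curve_mem_trace y), fun a hy' => ?_⟩
      rw [h.arcOf_eq y hyV hy' hx.2]
      simp
  · obtain ⟨V, S, -, h⟩ := D.exists_isFourSided c univ_mem
    have hfc := mem_foxColorings_iff.1 hf c
    refine ⟨V, h.isOpen, h.mem, exists_section_of_sectors h.isOpen_sector h.disjoint h.iUnion_eq
      ![fun a => a, fun a => f (D.crossingArc c 0) - a,
        fun a => f (D.overArc c) - f (D.crossingArc c 0) + a, fun a => f (D.overArc c) - a] ?_ ?_⟩
    · intro i
      fin_cases i
      · exact Function.bijective_id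
      · exact (Equiv.subLeft _).bijective
      · exact (Equiv.addLeft _).bijective
      · exact (Equiv.subLeft _).bijective
    · intro y hyV hy
      rcases h.exists_branch y hyV with rfl | rfl | ⟨i, hi⟩
      · exact absurd ⟨c, rfl⟩ hy.1
      · exact absurd ⟨c, rfl⟩ hy.2
      · refine ⟨i, i + 1, by fin_cases i <;> decide, hi.mem_closure, hi.mem_closure_succ,
          fun a hy' => ?_⟩
        rw [hi.arcOf_eq]
        fin_cases i
        · simp
        · change f (D.crossingArc c 0) - a + (f (D.overArc c) - f (D.crossingArc c 0) + a) =
            f (D.overArc c)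
          abel
        · change f (D.overArc c) - f (D.crossingArc c 0) + a + (f (D.overArc c) - a) =
            f (D.crossingArc c 2)
          rw [two_nsmul] at hfc
          rw [← sub_eq_iff_eq_add'.2 hfc.symm]
          abel
        · change f (D.overArc c) - a + a = f (D.overArc c)
          abel

/-- A section with a prescribed value exists for every Fox coloring. -/
theorem exists_section {f : D.Arc → A} (hf : f ∈ D.foxColorings A) {z₀ : ℂ} (hz₀ : z₀ ∉ D.trace)
    (a₀ : A) : ∃ g : ℂ → A, D.IsSection f univ g ∧ g z₀ = a₀ := by
  choose U hUo hpU σ hσ hbij using D.exists_local_section hf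
  obtain ⟨g, hg0, hg⟩ := exists_global_section D.dense_compl_trace U hUo hpU σ hbij (by
    intro p q z hz
    obtain ⟨N, hN, hNW, H⟩ := exists_nhds_section_unique (D := D) (A := A) z
      (((hUo p).inter (hUo q)).mem_nhds hz)
    obtain ⟨w, hw, hwN⟩ := (D.dense_compl_trace).inter_nhds_nonempty hN
    refine ⟨N, hN, fun x => ?_⟩
    obtain ⟨y, hy⟩ := (hbij q w (hNW hwN).2 hw).2 (σ p x w)
    refine ⟨y, fun z' hz' hzt => ?_⟩
    exact H f _ _ ((hσ p x).mono inter_subset_left) ((hσ q y).mono inter_subset_right) w ⟨hwN, hw⟩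
      hy.symm z' ⟨hz', hzt⟩) z₀ hz₀ a₀
  have hconst : ∀ V ⊆ univ \ D.trace, IsPreconnected V → ∀ z ∈ V, ∀ w ∈ V, g z = g w := by
    intro V hV hVc z hz w hw
    -- For the discrete topology, a function that locally agrees with sections is continuous off the
    -- trace, hence constant on connected sets.
    let τ : TopologicalSpace A := ⊥
    have hdisc : DiscreteTopology A := ⟨rfl⟩
    refine hVc.constant (fun u hu => ContinuousAt.continuousWithinAt ?_) hz hw
    have hut : u ∈ D.traceᶜ := (hV hu).2
    obtain ⟨x, N, hN, H⟩ := hg u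
    obtain ⟨r, hr, Hr⟩ := Metric.mem_nhds_iff.1 (inter_mem (inter_mem hN ((hUo u).mem_nhds (hpU u)))
      (D.isClosed_trace.isOpen_compl.mem_nhds hut))
    refine ContinuousAt.congr (f := fun _ => g u) continuousAt_const ?_
    filter_upwards [Metric.ball_mem_nhds u hr] with v hv
    rw [H u (mem_of_mem_nhds hN) hut, H v (Hr hv).1.1 (Hr hv).2]
    exact (hσ u x).const (Metric.ball u r) (fun w hw => ⟨(Hr hw).1.2, (Hr hw).2⟩)
      (convex_ball u r).isPreconnected u (Metric.mem_ball_self hr) v hv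
  refine ⟨g, ⟨hconst, fun x V T₀ T₁ h _ z hz w hw hx => ?_⟩, hg0⟩
  obtain ⟨a, N, hN, H⟩ := hg (D.curve x)
  -- The two sides of the given neighbourhood contain those of a smaller one, in which the global
  -- function is a local section.
  obtain ⟨V', T₀', T₁', hV', h'⟩ := (h.regular x h.mem).exists_isTwoSided
    (inter_mem (inter_mem hN ((hUo _).mem_nhds (hpU (D.curve x)))) (h.isOpen.mem_nhds h.mem))
  obtain ⟨z', hz'⟩ := h'.nonempty₀
  obtain ⟨w', hw'⟩ := h'.nonempty₁
  have hs := (hσ (D.curve x) a).sum x V' T₀' T₁' h' (fun u hu => (hV' hu).1.2) z' hz' w' hw' hx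
  rw [← H z' (hV' (h'.subset₀ hz').1).1.1 (h'.subset₀ hz').2,
    ← H w' (hV' (h'.subset₁ hw').1).1.1 (h'.subset₁ hw').2] at hs
  have c₀ := hconst T₀ (h.subset₀.trans (sdiff_subset_sdiff_left (subset_univ _))) h.isPreconnected₀
  have c₁ := hconst T₁ (h.subset₁.trans (sdiff_subset_sdiff_left (subset_univ _))) h.isPreconnected₁
  rcases h'.subset_or (fun u hu => (hV' hu).2) h.isOpen_cond h.pairwise_disjoint h.iUnion_cond
    (show false ≠ true by simp) (h.mem_closure₀ _ h.mem (D.curve_mem_trace x))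
    (h.mem_closure₁ _ h.mem (D.curve_mem_trace x)) with h1 | h1
  · rw [c₀ z hz z' (h1.1 hz'), c₁ w hw w' (h1.2 hw')]; exact hs
  · rw [c₀ z hz w' (h1.2 hw'), c₁ w hw z' (h1.1 hz'), add_comm]; exact hs

/-- Sections on the plane are determined by one value. -/
theorem IsSection.eq_of_eq {f : D.Arc → A} {g g' : ℂ → A} (hg : D.IsSection f univ g)
    (hg' : D.IsSection f univ g') {z₀ : ℂ} (hz₀ : z₀ ∉ D.trace) (h₀ : g z₀ = g' z₀) {z : ℂ}
    (hz : z ∉ D.trace) : g z = g' z := by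
  choose N hN hNW H using fun z => exists_nhds_section_unique (D := D) (A := A) z univ_mem
  -- The points near which the two sections agree form a clopen set: neighbourhoods of nearby points
  -- share a point off the trace, and agreement there spreads to both.
  have hcl : IsClopen {z | ∀ w ∈ N z \ D.trace, g w = g' w} := by
    have meet : ∀ z u, u ∈ interior (N z) → ∃ w, w ∈ N z \ D.trace ∧ w ∈ N u \ D.trace := by
      intro z u hu
      obtain ⟨w, h3, h1, h2⟩ := (D.dense_compl_trace).inter_nhds_nonempty
        (inter_mem (isOpen_interior.mem_nhds hu) (hN u))
      exact ⟨w, ⟨interior_subset h1, h3⟩, h2, h3⟩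
    constructor
    · rw [← isOpen_compl_iff, isOpen_iff_mem_nhds]
      intro z hz
      filter_upwards [interior_mem_nhds.2 (hN z)] with u hu hu'
      obtain ⟨w, h1, h2⟩ := meet z u hu
      exact hz (H z f g g' hg hg' w h1 (hu' w h2))
    · rw [isOpen_iff_mem_nhds]
      intro z hz
      filter_upwards [interior_mem_nhds.2 (hN z)] with u hu
      obtain ⟨w, h1, h2⟩ := meet z u hu
      exact H u f g g' hg hg' w h2 (hz w h1)
  have huniv := hcl.eq_univ ⟨z₀, H z₀ f g g' hg hg' z₀ ⟨mem_of_mem_nhds (hN z₀), hz₀⟩ h₀⟩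
  have : z ∈ {z | ∀ w ∈ N z \ D.trace, g w = g' w} := huniv ▸ mem_univ z
  exact this z ⟨mem_of_mem_nhds (hN z), hz⟩

end LinkDiagram

/-! ### Faces, their sectors and their finiteness -/

namespace LinkDiagram

variable {D : LinkDiagram}

variable (D) in
/-- The face containing a point off the trace. -/
def faceOf (z : ℂ) (hz : z ∉ D.trace) : D.Face :=
  Quotient.mk _ (⟨z, hz⟩ : (D.traceᶜ : Set ℂ))

theorem mem_region_faceOf {z : ℂ} (hz : z ∉ D.trace) : z ∈ D.region (D.faceOf z hz) := ⟨hz, rfl⟩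

theorem notMem_trace_of_mem_region {F : D.Face} {z : ℂ} (h : z ∈ D.region F) : z ∉ D.trace := h.1

theorem faceOf_eq_of_mem_region {F : D.Face} {z : ℂ} (h : z ∈ D.region F) :
    D.faceOf z h.1 = F := h.2

theorem exists_mem_region (F : D.Face) : ∃ z, z ∈ D.region F := by
  induction F using Quotient.inductionOn with
  | h z => exact ⟨z, z.2, rfl⟩

theorem eq_of_mem_region {F F' : D.Face} {z : ℂ} (h : z ∈ D.region F) (h' : z ∈ D.region F') :
    F = F' := h.2.symm.trans h'.2

theorem region_eq_pathComponentIn {F : D.Face} {z : ℂ} (hz : z ∈ D.region F) :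
    D.region F = pathComponentIn (D.traceᶜ) z := by
  ext w
  have hzt : z ∈ D.traceᶜ := hz.1
  constructor
  · rintro ⟨hw, h⟩
    have h1 : D.faceOf z hz.1 = D.faceOf w hw := hz.2.trans h.symm
    have h2 := Quotient.exact h1
    exact (joinedIn_iff_joined hzt hw).2 h2
  · intro h
    have hw : w ∈ D.traceᶜ := h.target_mem
    refine ⟨hw, ?_⟩
    rw [← hz.2]
    exact Quotient.sound ((joinedIn_iff_joined hzt hw).1 h).symm

theorem isOpen_region (F : D.Face) : IsOpen (D.region F) := by
  obtain ⟨z, hz⟩ := D.exists_mem_region F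
  rw [region_eq_pathComponentIn hz]
  exact D.isClosed_trace.isOpen_compl.pathComponentIn z

theorem isPreconnected_region (F : D.Face) : IsPreconnected (D.region F) := by
  obtain ⟨z, hz⟩ := D.exists_mem_region F
  rw [region_eq_pathComponentIn hz]
  exact (isPathConnected_pathComponentIn hz.1).isConnected.isPreconnected

theorem iUnion_region : ⋃ F, D.region F = D.traceᶜ := by
  ext z
  simp only [mem_iUnion]
  exact ⟨fun ⟨F, hF⟩ => hF.1, fun hz => ⟨_, mem_region_faceOf hz⟩⟩

theorem pairwise_disjoint_region : Pairwise (Function.onFun Disjoint D.region) :=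
  fun _ _ h => disjoint_left.2 fun _ h1 h2 => h (eq_of_mem_region h1 h2)

theorem subset_region {V : Set ℂ} (hV : IsPreconnected V) (hVt : V ⊆ D.traceᶜ) {F : D.Face} {z : ℂ}
    (hz : z ∈ V) (hF : z ∈ D.region F) : V ⊆ D.region F :=
  hV.subset_of_mem_iUnion isOpen_region pairwise_disjoint_region (hVt.trans iUnion_region.ge) hz hF

theorem exists_subset_region {V : Set ℂ} (hV : IsPreconnected V) (hVt : V ⊆ D.traceᶜ)
    (hne : V.Nonempty) : ∃ F, V ⊆ D.region F :=
  let ⟨_, hz⟩ := hne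
  ⟨_, subset_region hV hVt hz (mem_region_faceOf (hVt hz))⟩

variable {A : Type*} [AddCommGroup A]

open Classical in
/-- The function on the plane given by values on the faces. -/
def faceFun (d : D.Face → A) (z : ℂ) : A := if h : z ∉ D.trace then d (D.faceOf z h) else 0

theorem faceFun_apply {d : D.Face → A} {F : D.Face} {z : ℂ} (h : z ∈ D.region F) :
    faceFun d z = d F := by
  rw [faceFun, dif_pos (notMem_trace_of_mem_region h), faceOf_eq_of_mem_region h]

theorem exists_faceFun_isSection {f : D.Arc → A} (hf : f ∈ D.foxColorings A) (F₀ : D.Face) (a : A) :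
    ∃ d : D.Face → A, D.IsSection f univ (faceFun d) ∧ d F₀ = a := by
  obtain ⟨z₀, hz₀⟩ := D.exists_mem_region F₀
  obtain ⟨g, hg, hg0⟩ := D.exists_section hf hz₀.1 a
  choose r hr using D.exists_mem_region
  have hd : ∀ F, ∀ z ∈ D.region F, g (r F) = g z := fun F z hz =>
    hg.const _ (fun w hw => ⟨mem_univ _, hw.1⟩) (isPreconnected_region F) _ (hr F) z hz
  have he : ∀ z, z ∉ D.trace → faceFun (fun F => g (r F)) z = g z := fun z hz => by
    rw [faceFun_apply (mem_region_faceOf hz)]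
    exact hd _ z (mem_region_faceOf hz)
  refine ⟨fun F => g (r F), ⟨fun V hV hVc z hz w hw => ?_, fun x V T₀ T₁ h hV z hz w hw hx => ?_⟩,
    (hd F₀ z₀ hz₀).trans hg0⟩
  · rw [he z (hV hz).2, he w (hV hw).2]
    exact hg.const V hV hVc z hz w hw
  · rw [he z (h.subset₀ hz).2, he w (h.subset₁ hw).2]
    exact hg.sum x V T₀ T₁ h hV z hz w hw hx

theorem const_of_faceFun (d : D.Face → A) {V : Set ℂ} (hV : V ⊆ univ \ D.trace)
    (hVc : IsPreconnected V) {z w : ℂ} (hz : z ∈ V) (hw : w ∈ V) : faceFun d z = faceFun d w := by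
  have h := subset_region hVc (fun w hw => (hV hw).2) hz (mem_region_faceOf (hV hz).2)
  rw [faceFun_apply (h hz), faceFun_apply (h hw)]

/-- The faces on the two sides of a curve are different. -/
theorem IsTwoSided.face_ne {x : LoopParam D.numComponents} {V T₀ T₁ : Set ℂ}
    (h : D.IsTwoSided x V T₀ T₁) {F₀ F₁ : D.Face} (h₀ : T₀ ⊆ D.region F₀) (h₁ : T₁ ⊆ D.region F₁) :
    F₀ ≠ F₁ := by
  rintro rfl
  -- The constant `1` modulo `2` is a Fox coloring, and its lift changes value across every strand.
  -- This replaces the Jordan curve theorem.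
  have hf : (fun _ => 1 : D.Arc → ZMod 2) ∈ D.foxColorings (ZMod 2) := by
    rw [mem_foxColorings_iff]
    intro c
    decide
  obtain ⟨d, hd, -⟩ := D.exists_faceFun_isSection hf F₀ 0
  obtain ⟨z, hz⟩ := h.nonempty₀
  obtain ⟨w, hw⟩ := h.nonempty₁
  have := hd.sum x V T₀ T₁ h (subset_univ _) z hz w hw (h.regular x h.mem).2
  rw [faceFun_apply (h₀ hz), faceFun_apply (h₁ hw)] at this
  revert this
  generalize d F₀ = y
  revert y
  decide

theorem IsTwoSided.shaded_iff {x : LoopParam D.numComponents} {V T₀ T₁ : Set ℂ}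
    (h : D.IsTwoSided x V T₀ T₁) {F₀ F₁ : D.Face} (h₀ : T₀ ⊆ D.region F₀) (h₁ : T₁ ⊆ D.region F₁)
    (s : D.Shading) : F₀ ∈ s.shaded ↔ F₁ ∉ s.shaded := by
  refine s.shaded_iff_of_shareSegment F₀ F₁ (h.face_ne h₀ h₁) ?_
  have h1 : (fun t => D.curve (x.shift t)) ⁻¹' V ∈ 𝓝 (0 : ℝ) := by
    refine (D.continuous_curve_shift x).continuousAt.preimage_mem_nhds ?_
    rw [LoopParam.shift_zero]
    exact h.isOpen.mem_nhds h.mem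
  obtain ⟨ε, hε, H⟩ := Metric.mem_nhds_iff.1 h1
  refine ⟨x, ε / 2, by positivity, fun t ht => ?_⟩
  have htV : D.curve (x.shift t) ∈ V := H (by
    rw [Metric.mem_ball, Real.dist_eq, sub_zero, abs_of_nonneg ht.1]
    linarith [ht.2])
  have htt := D.curve_mem_trace (x.shift t)
  rw [(isOpen_region F₀).frontier_eq, (isOpen_region F₁).frontier_eq]
  exact ⟨⟨closure_mono h₀ (h.mem_closure₀ _ htV htt), fun h2 => h2.1 htt⟩,
    ⟨closure_mono h₁ (h.mem_closure₁ _ htV htt), fun h2 => h2.1 htt⟩⟩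

theorem IsTwoSided.exists_faces {x : LoopParam D.numComponents} {V T₀ T₁ : Set ℂ}
    (h : D.IsTwoSided x V T₀ T₁) : ∃ F₀ F₁, T₀ ⊆ D.region F₀ ∧ T₁ ⊆ D.region F₁ :=
  let ⟨F₀, h₀⟩ := exists_subset_region h.isPreconnected₀ (h.subset₀.trans fun _ h => h.2) h.nonempty₀
  let ⟨F₁, h₁⟩ := exists_subset_region h.isPreconnected₁ (h.subset₁.trans fun _ h => h.2) h.nonempty₁
  ⟨F₀, F₁, h₀, h₁⟩

variable (D) in
theorem exists_crossingNhd (c : Fin D.numCrossings) :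
    ∃ (U : Set ℂ) (S : Fin 4 → Set ℂ), D.IsFourSided c U S :=
  let ⟨U, S, _, h⟩ := D.exists_isFourSided c univ_mem
  ⟨U, S, h⟩

variable (D) in
/-- A neighbourhood of a crossing. -/
def crossingNhd (c : Fin D.numCrossings) : Set ℂ := (D.exists_crossingNhd c).choose

variable (D) in
/-- The sectors at a crossing, in counterclockwise order. -/
def sector (c : Fin D.numCrossings) : Fin 4 → Set ℂ := (D.exists_crossingNhd c).choose_spec.choose

theorem isFourSided_sector (c : Fin D.numCrossings) :
    D.IsFourSided c (D.crossingNhd c) (D.sector c) :=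
  (D.exists_crossingNhd c).choose_spec.choose_spec

theorem exists_sectorFace (c : Fin D.numCrossings) (i : Fin 4) :
    ∃ F, D.sector c i ⊆ D.region F :=
  exists_subset_region ((isFourSided_sector c).isPreconnected_sector i)
    (((isFourSided_sector c).sector_subset i).trans fun _ h => h.2) ((isFourSided_sector c).nonempty i)

variable (D) in
/-- The faces at a crossing, in counterclockwise order. -/
def sectorFace (c : Fin D.numCrossings) (i : Fin 4) : D.Face := (D.exists_sectorFace c i).choose

theorem sector_subset_region (c : Fin D.numCrossings) (i : Fin 4) :
    D.sector c i ⊆ D.region (D.sectorFace c i) := (D.exists_sectorFace c i).choose_spec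

theorem incident_iff {c : Fin D.numCrossings} {F : D.Face} :
    D.Incident c F ↔ ∃ i, F = D.sectorFace c i := by
  have h := D.isFourSided_sector c
  constructor
  · intro hF
    obtain ⟨z, hzU, hz⟩ := mem_closure_iff.1 hF _ h.isOpen h.mem
    have : z ∈ ⋃ i, D.sector c i := h.iUnion_eq ▸ ⟨hzU, hz.1⟩
    obtain ⟨i, hi⟩ := mem_iUnion.1 this
    exact ⟨i, eq_of_mem_region hz (sector_subset_region c i hi)⟩
  · rintro ⟨i, rfl⟩
    exact closure_mono (sector_subset_region c i) (h.crossingPoint_mem_closure i)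

theorem shaded_sectorFace_iff (s : D.Shading) (c : Fin D.numCrossings) (i : Fin 4) :
    D.sectorFace c i ∈ s.shaded ↔ D.sectorFace c (i + 1) ∉ s.shaded := by
  have h := D.isFourSided_sector c
  obtain ⟨y, hyU, hy⟩ := h.branch_nonempty i
  obtain ⟨V, T₀, T₁, hV, hT⟩ := hy.regular.exists_isTwoSided (h.isOpen.mem_nhds hyU)
  rcases hT.subset_or hV h.isOpen_sector h.disjoint h.iUnion_eq
    (show i ≠ i + 1 by fin_cases i <;> decide) hy.mem_closure hy.mem_closure_succ with h1 | h1
  · exact hT.shaded_iff (h1.1.trans (sector_subset_region c _))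
      (h1.2.trans (sector_subset_region c _)) s
  · have := hT.shaded_iff (h1.1.trans (sector_subset_region c _))
      (h1.2.trans (sector_subset_region c _)) s
    tauto

theorem exists_shaded (hD : 0 < D.numComponents) (s : D.Shading) : ∃ F, F ∈ s.shaded := by
  obtain ⟨x, hx⟩ := exists_regular hD
  obtain ⟨V, T₀, T₁, -, h⟩ := hx.exists_isTwoSided univ_mem
  obtain ⟨F₀, F₁, h₀, h₁⟩ := h.exists_faces
  have := h.shaded_iff h₀ h₁ s
  by_cases h2 : F₀ ∈ s.shaded
  · exact ⟨F₀, h2⟩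
  · exact ⟨F₁, by tauto⟩

/-- A face whose closure misses the trace would be clopen, hence the whole plane, although there is
a curve. -/
theorem exists_mem_trace_closure_region (hD : 0 < D.numComponents) (F : D.Face) :
    ∃ p ∈ D.trace, p ∈ closure (D.region F) := by
  by_contra! H
  have hcl : IsClosed (D.region F) := by
    refine isClosed_of_closure_subset fun p hp => ?_
    have hpt : p ∉ D.trace := fun h => H p h hp
    obtain ⟨z, hz1, hz2⟩ := mem_closure_iff.1 hp _ (isOpen_region _) (mem_region_faceOf hpt)
    rw [eq_of_mem_region hz2 hz1]
    exact mem_region_faceOf hpt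
  have huniv := IsClopen.eq_univ ⟨hcl, isOpen_region F⟩ (D.exists_mem_region F)
  have : D.curve (⟨0, hD⟩, 0) ∈ D.region F := huniv ▸ mem_univ _
  exact this.1 (D.curve_mem_trace _)

/-- Near each point of the trace there are at most two or four faces, the trace is compact, and
every face comes close to it. -/
theorem finite_face (hD : 0 < D.numComponents) : Finite D.Face := by
  have hloc : ∀ p ∈ D.trace, ∃ N, IsOpen N ∧ p ∈ N ∧
      {F : D.Face | (N ∩ D.region F).Nonempty}.Finite := by
    intro p hp
    rcases D.point_cases p with h | ⟨x, hx, rfl⟩ | ⟨c, rfl⟩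
    · exact absurd hp h
    · obtain ⟨V, T₀, T₁, -, h⟩ := hx.exists_isTwoSided univ_mem
      obtain ⟨F₀, F₁, h₀, h₁⟩ := h.exists_faces
      refine ⟨V, h.isOpen, h.mem, (Set.toFinite {F₀, F₁}).subset ?_⟩
      rintro F ⟨z, hzV, hz⟩
      have : z ∈ T₀ ∪ T₁ := h.union_eq ▸ ⟨hzV, hz.1⟩
      rcases this with h2 | h2
      · exact Or.inl (eq_of_mem_region hz (h₀ h2))
      · exact Or.inr (eq_of_mem_region hz (h₁ h2))
    · have h := D.isFourSided_sector c
      refine ⟨_, h.isOpen, h.mem, (finite_range (D.sectorFace c)).subset ?_⟩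
      rintro F ⟨z, hzV, hz⟩
      have : z ∈ ⋃ i, D.sector c i := h.iUnion_eq ▸ ⟨hzV, hz.1⟩
      obtain ⟨i, hi⟩ := mem_iUnion.1 this
      exact ⟨i, eq_of_mem_region (sector_subset_region c i hi) hz⟩
  choose! N hNo hNp hNf using hloc
  obtain ⟨t, ht, hcov⟩ := D.isCompact_trace.elim_nhds_subcover N
    fun p hp => (hNo p hp).mem_nhds (hNp p hp)
  have hfin : (⋃ p ∈ t, {F : D.Face | (N p ∩ D.region F).Nonempty}).Finite :=
    t.finite_toSet.biUnion fun p hp => hNf p (ht p hp)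
  refine Set.finite_univ_iff.1 (hfin.subset fun F _ => ?_)
  obtain ⟨p, hp, hpF⟩ := D.exists_mem_trace_closure_region hD F
  obtain ⟨q, hq, hpq⟩ := mem_iUnion₂.1 (hcov hp)
  exact mem_biUnion hq (mem_closure_iff.1 hpF _ (hNo q (ht q hq)) hpq)

end LinkDiagram

/-! ### Fox colorings and Dehn colorings -/

namespace LinkDiagram

variable {D : LinkDiagram} {A : Type*} [AddCommGroup A]

variable (D A) in
/-- The group of Dehn colorings: maps from the faces to `A` such that at each crossing the
differences along both sides of the overpassing strand agree. -/
def dehnColorings : AddSubgroup (D.Face → A) where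
  carrier := {d | ∀ c, d (D.sectorFace c 3) + d (D.sectorFace c 0) =
    d (D.sectorFace c 1) + d (D.sectorFace c 2)}
  zero_mem' := fun _ => rfl
  add_mem' := by
    intro d d' h h' c
    simp only [Pi.add_apply]
    rw [add_add_add_comm, h c, h' c, add_add_add_comm]
  neg_mem' := by
    intro d h c
    simp only [Pi.neg_apply]
    rw [← neg_add, h c, neg_add]

theorem IsSection.sum_sectorFace {f : D.Arc → A} {d : D.Face → A}
    (h : D.IsSection f univ (faceFun d)) (c : Fin D.numCrossings) (i : Fin 4) :
    d (D.sectorFace c i) + d (D.sectorFace c (i + 1)) = f (D.crossingArc c i) := by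
  have h' := D.isFourSided_sector c
  obtain ⟨z, hz⟩ := h'.nonempty i
  obtain ⟨w, hw⟩ := h'.nonempty (i + 1)
  have := h.sum_crossing h' (subset_univ _) hz hw
  rwa [faceFun_apply (sector_subset_region c _ hz), faceFun_apply (sector_subset_region c _ hw)]
    at this

theorem IsSection.mem_dehnColorings {f : D.Arc → A} {d : D.Face → A}
    (h : D.IsSection f univ (faceFun d)) : d ∈ D.dehnColorings A := fun c =>
  (h.sum_sectorFace c 3).trans (h.sum_sectorFace c 1).symm

/-- The half strands `0` and `2` together involve the same four sectors as `1` and `3`, and the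
latter two both carry the label of the overpassing arc. -/
theorem IsSection.mem_foxColorings {f : D.Arc → A} {d : D.Face → A}
    (h : D.IsSection f univ (faceFun d)) : f ∈ D.foxColorings A := by
  rw [mem_foxColorings_iff]
  intro c
  have h0 := h.sum_sectorFace c 0
  have h1 : _ = f (D.overArc c) := h.sum_sectorFace c 1
  have h2 := h.sum_sectorFace c 2
  have h3 : _ = f (D.overArc c) := h.sum_sectorFace c 3
  rw [two_nsmul, ← h0, ← h2]
  nth_rewrite 1 [← h1]
  rw [← h3]
  change d (D.sectorFace c 0) + d (D.sectorFace c 1) +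
    (d (D.sectorFace c 2) + d (D.sectorFace c 3)) = d (D.sectorFace c 1) + d (D.sectorFace c 2) +
    (d (D.sectorFace c 3) + d (D.sectorFace c 0))
  abel

/-- `a` is the sum of the values of `d` on the two sides of the curve near the parameter `x`. -/
def IsSideSum (d : D.Face → A) (x : LoopParam D.numComponents) (a : A) : Prop :=
  ∃ δ > 0, ∀ h, |h| < δ → D.Regular (x.shift h) → ∀ V T₀ T₁, D.IsTwoSided (x.shift h) V T₀ T₁ →
    ∀ z ∈ T₀, ∀ w ∈ T₁, faceFun d z + faceFun d w = a

theorem IsSideSum.eventually {d : D.Face → A} {x : LoopParam D.numComponents} {a : A}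
    (h : IsSideSum d x a) : ∀ᶠ y in 𝓝 x, IsSideSum d y a := by
  obtain ⟨δ, hδ, H⟩ := h
  filter_upwards [x.image_shift_mem_nhds (Ioo_mem_nhds (neg_lt_zero.2 hδ) hδ)] with y hy
  obtain ⟨t, ht, rfl⟩ := hy
  have ht' := abs_lt.2 ht
  refine ⟨δ - |t|, by linarith, fun h hh => ?_⟩
  rw [LoopParam.shift_shift]
  exact H (t + h) ((abs_add_le t h).trans_lt (by linarith))

theorem IsSideSum.unique {d : D.Face → A} {x : LoopParam D.numComponents} {a b : A}
    (ha : IsSideSum d x a) (hb : IsSideSum d x b) : a = b := by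
  obtain ⟨δ, hδ, H⟩ := ha
  obtain ⟨δ', hδ', H'⟩ := hb
  obtain ⟨δ₀, hδ₀, -, H₀⟩ := exists_regular_shift x
  have hpos : 0 < min (min δ δ') δ₀ := by positivity
  set t := min (min δ δ') δ₀ / 2 with ht
  have ht0 : 0 < t := by positivity
  have hlt : |t| < min (min δ δ') δ₀ := by rw [abs_of_pos ht0]; linarith
  have hr := H₀ t ht0.ne' (hlt.trans_le (min_le_right _ _))
  obtain ⟨V, T₀, T₁, -, h⟩ := hr.exists_isTwoSided univ_mem
  obtain ⟨z, hz⟩ := h.nonempty₀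
  obtain ⟨w, hw⟩ := h.nonempty₁
  rw [← H t (hlt.trans_le ((min_le_left _ _).trans (min_le_left _ _))) hr V T₀ T₁ h z hz w hw,
    ← H' t (hlt.trans_le ((min_le_left _ _).trans (min_le_right _ _))) hr V T₀ T₁ h z hz w hw]

theorem Regular.exists_isSideSum {x : LoopParam D.numComponents} (hx : D.Regular x)
    (d : D.Face → A) : ∃ a, IsSideSum d x a := by
  obtain ⟨V, T₀, T₁, -, h⟩ := hx.exists_isTwoSided univ_mem
  obtain ⟨F₀, F₁, h₀, h₁⟩ := h.exists_faces
  have h1 : (fun t => D.curve (x.shift t)) ⁻¹' V ∈ 𝓝 (0 : ℝ) := by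
    refine (D.continuous_curve_shift x).continuousAt.preimage_mem_nhds ?_
    rw [LoopParam.shift_zero]
    exact h.isOpen.mem_nhds h.mem
  obtain ⟨δ, hδ, H⟩ := Metric.mem_nhds_iff.1 h1
  refine ⟨d F₀ + d F₁, δ, hδ, fun t ht _ V' T₀' T₁' h' z hz w hw => ?_⟩
  have htV : D.curve (x.shift t) ∈ V := H (by simpa using ht)
  have htt := D.curve_mem_trace (x.shift t)
  -- A common smaller neighbourhood compares the sides of an arbitrary `V'` with those of the fixed
  -- `V`.
  obtain ⟨V'', T₀'', T₁'', hV'', h''⟩ := (h.regular _ htV).exists_isTwoSided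
    (inter_mem (h.isOpen.mem_nhds htV) (h'.isOpen.mem_nhds h'.mem))
  obtain ⟨z', hz'⟩ := h''.nonempty₀
  obtain ⟨w', hw'⟩ := h''.nonempty₁
  have e₁ : faceFun d z' + faceFun d w' = d F₀ + d F₁ := by
    rcases h''.subset_or (fun u hu => (hV'' hu).1) h.isOpen_cond h.pairwise_disjoint h.iUnion_cond
      (show false ≠ true by simp) (h.mem_closure₀ _ htV htt) (h.mem_closure₁ _ htV htt) with h2 | h2
    · rw [faceFun_apply (h₀ (h2.1 hz')), faceFun_apply (h₁ (h2.2 hw'))]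
    · rw [faceFun_apply (h₁ (h2.1 hz')), faceFun_apply (h₀ (h2.2 hw')), add_comm]
  have c₀ := fun {u v} (hu : u ∈ T₀') (hv : v ∈ T₀') => const_of_faceFun d
    (h'.subset₀.trans (sdiff_subset_sdiff_left (subset_univ _))) h'.isPreconnected₀ hu hv
  have c₁ := fun {u v} (hu : u ∈ T₁') (hv : v ∈ T₁') => const_of_faceFun d
    (h'.subset₁.trans (sdiff_subset_sdiff_left (subset_univ _))) h'.isPreconnected₁ hu hv
  rw [← e₁]
  rcases h''.subset_or (fun u hu => (hV'' hu).2) h'.isOpen_cond h'.pairwise_disjoint h'.iUnion_cond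
    (show false ≠ true by simp) (h'.mem_closure₀ _ h'.mem htt) (h'.mem_closure₁ _ h'.mem htt)
    with h2 | h2
  · rw [c₀ hz (h2.1 hz'), c₁ hw (h2.2 hw')]
  · rw [c₀ hz (h2.2 hw'), c₁ hw (h2.1 hz'), add_comm]

theorem IsBranch.sum_sides {c : Fin D.numCrossings} {i : Fin 4} {y : LoopParam D.numComponents}
    (hy : D.IsBranch c (D.sector c) i y) (hyU : D.curve y ∈ D.crossingNhd c) (d : D.Face → A)
    {V T₀ T₁ : Set ℂ} (h : D.IsTwoSided y V T₀ T₁) {z w : ℂ} (hz : z ∈ T₀) (hw : w ∈ T₁) :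
    faceFun d z + faceFun d w = d (D.sectorFace c i) + d (D.sectorFace c (i + 1)) := by
  have h' := D.isFourSided_sector c
  obtain ⟨a, δ, hδ, ha⟩ := hy.regular.exists_isSideSum d
  have ha' := fun V T₀ T₁ hT => ha 0 (by simpa using hδ) (by simpa using hy.regular) V T₀ T₁
    (by simpa using hT)
  rw [ha' V T₀ T₁ h z hz w hw]
  obtain ⟨V', T₀', T₁', hV', hT⟩ := hy.regular.exists_isTwoSided (h'.isOpen.mem_nhds hyU)
  obtain ⟨z', hz'⟩ := hT.nonempty₀
  obtain ⟨w', hw'⟩ := hT.nonempty₁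
  rw [← ha' V' T₀' T₁' hT z' hz' w' hw']
  rcases hT.subset_or hV' h'.isOpen_sector h'.disjoint h'.iUnion_eq
    (show i ≠ i + 1 by fin_cases i <;> decide) hy.mem_closure hy.mem_closure_succ with h1 | h1
  · rw [faceFun_apply (sector_subset_region c _ (h1.1 hz')),
      faceFun_apply (sector_subset_region c _ (h1.2 hw'))]
  · rw [faceFun_apply (sector_subset_region c _ (h1.1 hz')),
      faceFun_apply (sector_subset_region c _ (h1.2 hw')), add_comm]

/-- Visible parameters that are not regular are overpasses. There the sums of the sides just before
and just after the crossing agree by the Dehn relation. -/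
theorem exists_isSideSum {d : D.Face → A} (hd : d ∈ D.dehnColorings A)
    {x : LoopParam D.numComponents} (hx : x ∉ range D.underParam) : ∃ a, IsSideSum d x a := by
  by_cases hxo : x ∈ range D.overParam
  · obtain ⟨c, rfl⟩ := hxo
    have h := D.isFourSided_sector c
    obtain ⟨δ₁, hδ₁, H₁⟩ := mem_nhdsGT_iff_exists_Ioo_subset.1 (h.eventually_branch 1)
    obtain ⟨δ₃, hδ₃, H₃⟩ := mem_nhdsGT_iff_exists_Ioo_subset.1 (h.eventually_branch 3)
    refine ⟨d (D.sectorFace c 1) + d (D.sectorFace c 2), min δ₁ δ₃, lt_min hδ₁ hδ₃,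
      fun t ht hr V T₀ T₁ hT z hz w hw => ?_⟩
    rcases lt_trichotomy t 0 with ht0 | rfl | ht0
    · rw [abs_of_neg ht0] at ht
      obtain ⟨k1, k2⟩ := H₁ (show -t ∈ Ioo 0 δ₁ from ⟨by linarith, ht.trans_le (min_le_left _ _)⟩)
      have e : D.branchParam c 1 (-t) = (D.overParam c).shift t := by simp [branchParam]
      rw [e] at k1 k2
      exact k2.sum_sides k1 d hT hz hw
    · rw [LoopParam.shift_zero] at hr
      exact absurd ⟨c, rfl⟩ hr.1
    · rw [abs_of_pos ht0] at ht
      obtain ⟨k1, k2⟩ := H₃ (show t ∈ Ioo 0 δ₃ from ⟨ht0, ht.trans_le (min_le_right _ _)⟩)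
      have e : D.branchParam c 3 t = (D.overParam c).shift t := by simp [branchParam]
      rw [e] at k1 k2
      exact (k2.sum_sides k1 d hT hz hw).trans (hd c)
  · exact Regular.exists_isSideSum ⟨hxo, hx⟩ d

/-- The side sum is locally constant along the visible parameters, hence constant along paths, and
so descends to a label of the arcs. -/
theorem exists_isSection_of_dehn {d : D.Face → A} (hd : d ∈ D.dehnColorings A) :
    ∃ f : D.Arc → A, D.IsSection f univ (faceFun d) := by
  choose v hv using fun x : D.VisibleParam => exists_isSideSum hd x.2
  have hloc : IsLocallyConstant v := by
    rw [IsLocallyConstant.iff_eventually_eq]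
    intro x
    filter_upwards [continuous_subtype_val.continuousAt.eventually (hv x).eventually] with y hy
    exact (hv y).unique hy
  let f : D.Arc → A := Quotient.lift v (by
    rintro x y ⟨p⟩
    have := (hloc.comp_continuous p.continuous).apply_eq_of_preconnectedSpace 0 1
    simpa using this)
  refine ⟨f, fun V hV hVc z hz w hw => const_of_faceFun d hV hVc hz hw,
    fun x V T₀ T₁ h _ z hz w hw hx => ?_⟩
  obtain ⟨δ, hδ, H⟩ := hv ⟨x, hx⟩
  have := H 0 (by simpa using hδ) (by simpa using h.regular x h.mem) V T₀ T₁ (by simpa using h)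
    z hz w hw
  exact this

theorem IsSection.arc_unique {f f' : D.Arc → A} {d : D.Face → A}
    (h : D.IsSection f univ (faceFun d)) (h' : D.IsSection f' univ (faceFun d)) : f = f' := by
  ext a
  induction a using Quotient.inductionOn with
  | h x =>
    obtain ⟨x, hx⟩ := x
    by_cases hxo : x ∈ range D.overParam
    · obtain ⟨c, rfl⟩ := hxo
      exact (h.sum_sectorFace c 1).symm.trans (h'.sum_sectorFace c 1)
    · have hr : D.Regular x := ⟨hxo, hx⟩
      obtain ⟨V, T₀, T₁, -, hT⟩ := hr.exists_isTwoSided univ_mem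
      obtain ⟨z, hz⟩ := hT.nonempty₀
      obtain ⟨w, hw⟩ := hT.nonempty₁
      exact (h.sum x V T₀ T₁ hT (subset_univ _) z hz w hw hx).symm.trans
        (h'.sum x V T₀ T₁ hT (subset_univ _) z hz w hw hx)

theorem IsSection.face_unique {f : D.Arc → A} {d d' : D.Face → A}
    (h : D.IsSection f univ (faceFun d)) (h' : D.IsSection f univ (faceFun d')) {F₀ : D.Face}
    (h₀ : d F₀ = d' F₀) : d = d' := by
  obtain ⟨z₀, hz₀⟩ := D.exists_mem_region F₀
  ext F
  obtain ⟨z, hz⟩ := D.exists_mem_region F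
  have := h.eq_of_eq h' hz₀.1 (by rwa [faceFun_apply hz₀, faceFun_apply hz₀]) hz.1
  rwa [faceFun_apply hz, faceFun_apply hz] at this

theorem faceFun_add (d d' : D.Face → A) (z : ℂ) : faceFun (d + d') z = faceFun d z + faceFun d' z := by
  by_cases h : z ∈ D.trace
  · simp [faceFun, h]
  · simp [faceFun, h]

theorem IsSection.add {f f' : D.Arc → A} {d d' : D.Face → A}
    (h : D.IsSection f univ (faceFun d)) (h' : D.IsSection f' univ (faceFun d')) :
    D.IsSection (f + f') univ (faceFun (d + d')) := by
  refine ⟨fun V hV hVc z hz w hw => const_of_faceFun _ hV hVc hz hw,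
    fun x V T₀ T₁ hT hV z hz w hw hx => ?_⟩
  rw [faceFun_add, faceFun_add, Pi.add_apply, ← h.sum x V T₀ T₁ hT hV z hz w hw hx,
    ← h'.sum x V T₀ T₁ hT hV z hz w hw hx, add_add_add_comm]

variable (D A) in
/-- The Dehn colorings that vanish on a given face. -/
def dehnColoringsAt (F₀ : D.Face) : AddSubgroup (D.Face → A) :=
  D.dehnColorings A ⊓ (Pi.evalAddMonoidHom (fun _ => A) F₀).ker

/-- Fox colorings correspond to Dehn colorings that vanish on a given face. -/
theorem nonempty_foxColorings_equiv (F₀ : D.Face) :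
    Nonempty (D.foxColorings A ≃+ D.dehnColoringsAt A F₀) := by
  choose δ hδ hδ0 using fun f : D.foxColorings A => exists_faceFun_isSection f.2 F₀ 0
  -- The lift vanishing on `F₀` is unique, which makes it additive in the Fox coloring.
  let φ : D.foxColorings A →+ D.dehnColoringsAt A F₀ :=
    AddMonoidHom.mk' (fun f => ⟨δ f, (hδ f).mem_dehnColorings, hδ0 f⟩) fun f f' => Subtype.ext
      ((hδ (f + f')).face_unique ((hδ f).add (hδ f')) (F₀ := F₀) (by simp [hδ0]))
  refine ⟨AddEquiv.ofBijective φ ⟨fun f f' h => ?_, fun d => ?_⟩⟩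
  · have h1 : δ f = δ f' := congrArg Subtype.val h
    exact Subtype.ext ((hδ f).arc_unique (h1 ▸ hδ f'))
  · obtain ⟨f, hf⟩ := exists_isSection_of_dehn d.2.1
    refine ⟨⟨f, hf.mem_foxColorings⟩, Subtype.ext ?_⟩
    exact (hδ _).face_unique hf (F₀ := F₀) ((hδ0 _).trans d.2.2.symm)

end LinkDiagram

/-! ### Continuous logarithms and winding numbers -/

theorem exists_continuous_log {f : ℝ → ℂ} (hf : Continuous f) (h0 : ∀ t, f t ≠ 0) :
    ∃ θ : ℝ → ℂ, Continuous θ ∧ ∀ t, Complex.exp (θ t) = f t := by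
  obtain ⟨F, ⟨-, hF⟩, -⟩ := Complex.isCoveringMapOn_exp.existsUnique_continuousMap_lifts ⟨f, hf⟩
    (a₀ := 0) (e₀ := Complex.log (f 0)) (Complex.exp_log (h0 0)) (fun t => h0 t)
  exact ⟨F, F.continuous, fun t => congrFun hF t⟩

/-- Two continuous logarithms of a function on a connected set differ by a constant. -/
theorem IsPreconnected.sub_eq_of_exp_eq {X : Type*} [TopologicalSpace X] {S : Set X}
    (hS : IsPreconnected S) {f g : X → ℂ} (hf : ContinuousOn f S) (hg : ContinuousOn g S)
    (h : ∀ t ∈ S, Complex.exp (f t) = Complex.exp (g t)) {a b : X} (ha : a ∈ S) (hb : b ∈ S) :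
    f a - g a = f b - g b := by
  have hπ : (2 * Real.pi * Complex.I : ℂ) ≠ 0 := Complex.two_pi_I_ne_zero
  have hT : IsClosedEmbedding ((↑) : ℤ → ℂ) :=
    Complex.isometry_intCast.isClosedEmbedding
  have hd : DiscreteTopology (range ((↑) : ℤ → ℂ)) := by
    exact hT.isEmbedding.toHomeomorph.symm.isEmbedding.discreteTopology
  have := hS.constant_of_mapsTo (f := fun t => (f t - g t) / (2 * Real.pi * Complex.I))
    (T := range ((↑) : ℤ → ℂ)) ⟨hd⟩ ((hf.sub hg).div_const _) (fun t ht => by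
      obtain ⟨n, hn⟩ := Complex.exp_eq_exp_iff_exists_int.1 (h t ht)
      exact ⟨n, by simp only [hn, add_sub_cancel_left]; rw [mul_div_cancel_right₀ _ hπ]⟩) ha hb
  exact (div_left_inj' hπ).1 this

/-- A nonpositive ratio would place `z` between the two points. The principal logarithm of the ratio
is therefore continuous off the segment, and this is the tool for comparing angles seen from two
points. -/
theorem div_mem_slitPlane_of_notMem_segment {z z₀ z₁ : ℂ} (h : z ∉ segment ℝ z₀ z₁) :
    (z - z₀) / (z - z₁) ∈ Complex.slitPlane := by
  have h1 : z - z₁ ≠ 0 := fun h1 => h (by rw [sub_eq_zero.1 h1]; exact right_mem_segment ℝ _ _)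
  by_contra hc
  rw [Complex.mem_slitPlane_iff_not_le_zero, not_not, Complex.le_def] at hc
  obtain ⟨hre, him⟩ := hc
  simp only [Complex.zero_re, Complex.zero_im] at hre him
  set r := ((z - z₀) / (z - z₁)).re with hr
  have h2 : (z - z₀) / (z - z₁) = (r : ℂ) := Complex.ext (by simp [hr]) (by simp [him])
  have h3 : z - z₀ = r * (z - z₁) := by rw [← h2, div_mul_cancel₀ _ h1]
  have h4 : (1 - r : ℝ) ≠ 0 := by linarith
  refine h ⟨1 / (1 - r), -r / (1 - r), by apply div_nonneg <;> linarith,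
    by apply div_nonneg <;> linarith, by field_simp; ring, ?_⟩
  have h5 : ((1 - r : ℝ) : ℂ) ≠ 0 := by exact_mod_cast h4
  simp only [Complex.real_smul]
  push_cast at h5 ⊢
  field_simp
  linear_combination -h3

theorem div_mem_slitPlane_of_ne {z z₀ w : ℂ} (hw : w ≠ 0)
    (h : ∀ τ : ℝ, 0 ≤ τ → z ≠ z₀ - τ • w) : (z - z₀) / w ∈ Complex.slitPlane := by
  by_contra hc
  rw [Complex.mem_slitPlane_iff_not_le_zero, not_not, Complex.le_def] at hc
  obtain ⟨hre, him⟩ := hc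
  simp only [Complex.zero_re, Complex.zero_im] at hre him
  set r := ((z - z₀) / w).re with hr
  have h2 : (z - z₀) / w = (r : ℂ) := Complex.ext (by simp [hr]) (by simp [him])
  refine h (-r) (by linarith) ?_
  have h3 : z - z₀ = r * w := by rw [← h2, div_mul_cancel₀ _ hw]
  simp only [Complex.real_smul]
  push_cast
  linear_combination h3

/-- The arguments of `X` and `Y` lie in `(0, π)` and `(-π, 0)`, so `arg X - arg Y - π` lies in `(-π,
π)` and is the principal argument of `-(X / Y)`. This is one of the two half turns in
`turn_sub_turn`. -/
theorem Complex.log_sub_log_of_im_pos {X Y : ℂ} (hX : 0 < X.im) (hY : Y.im < 0) :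
    Complex.log X - Complex.log Y - Complex.log (-(X / Y)) = Real.pi * Complex.I := by
  have hX0 : X ≠ 0 := fun h => by simp [h] at hX
  have hY0 : Y ≠ 0 := fun h => by simp [h] at hY
  have hpi : Complex.exp (Real.pi * Complex.I) = -1 := Complex.exp_pi_mul_I
  have key : Complex.log (-(X / Y)) = Complex.log X - Complex.log Y - Real.pi * Complex.I := by
    rw [show -(X / Y) = Complex.exp (Complex.log X - Complex.log Y - Real.pi * Complex.I) by
      rw [Complex.exp_sub, Complex.exp_sub, Complex.exp_log hX0, Complex.exp_log hY0, hpi]; ring]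
    have a1 := Complex.arg_lt_pi_iff.2 (Or.inr hX.ne')
    have a2 := Complex.neg_pi_lt_arg Y
    have a3 := Complex.arg_neg_iff.2 hY
    have a4 : 0 ≤ X.arg := Complex.arg_nonneg_iff.2 hX.le
    apply Complex.log_exp <;> simp [Complex.log_im] <;> linarith
  rw [key]; ring

theorem Complex.log_sub_log_of_im_neg {X Y : ℂ} (hX : X.im < 0) (hY : 0 < Y.im) :
    Complex.log X - Complex.log Y - Complex.log (-(X / Y)) = -(Real.pi * Complex.I) := by
  have hX0 : X ≠ 0 := fun h => by simp [h] at hX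
  have hY0 : Y ≠ 0 := fun h => by simp [h] at hY
  have hpi : Complex.exp (Real.pi * Complex.I) = -1 := Complex.exp_pi_mul_I
  have key : Complex.log (-(X / Y)) = Complex.log X - Complex.log Y + Real.pi * Complex.I := by
    rw [show -(X / Y) = Complex.exp (Complex.log X - Complex.log Y + Real.pi * Complex.I) by
      rw [Complex.exp_add, Complex.exp_sub, Complex.exp_log hX0, Complex.exp_log hY0, hpi]; ring]
    have a1 := Complex.arg_lt_pi_iff.2 (Or.inr hY.ne')
    have a2 := Complex.neg_pi_lt_arg X
    have a3 := Complex.arg_neg_iff.2 hX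
    have a4 : 0 ≤ Y.arg := Complex.arg_nonneg_iff.2 hY.le
    apply Complex.log_exp <;> simp [Complex.log_im] <;> linarith
  rw [key]; ring

/-- The angles swept out, as seen from two points on the two sides of a closed curve, differ by a
full turn, if the segment joining the two points meets the curve only near the parameter `0`, where
the curve passes between the two rays that prolong the segment. -/
theorem turn_sub_turn {f θ₀ θ₁ : ℝ → ℂ} {δ r : ℝ} {z₀ z₁ w : ℂ} (hδ : 0 < δ) (hδ' : δ < 1 / 2)
    (hf : Continuous f) (hper : f (-δ) = f (1 - δ))
    (hθ₀ : Continuous θ₀) (hθ₁ : Continuous θ₁) (e₀ : ∀ t, Complex.exp (θ₀ t) = f t - z₀)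
    (e₁ : ∀ t, Complex.exp (θ₁ t) = f t - z₁) (hw : w ≠ 0) (hz : z₀ - z₁ = r • w)
    (hseg : ∀ t ∈ Icc δ (1 - δ), f t ∉ segment ℝ z₀ z₁)
    (hray₀ : ∀ t ∈ Icc (-δ) δ, ∀ τ : ℝ, 0 ≤ τ → f t ≠ z₀ + τ • w)
    (hray₁ : ∀ t ∈ Icc (-δ) δ, ∀ τ : ℝ, 0 ≤ τ → f t ≠ z₁ - τ • w)
    (hpos : 0 < planeDet (f δ - z₀) w) (hneg : planeDet (f (-δ) - z₀) w < 0) :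
    (θ₀ (1 - δ) - θ₀ (-δ)) - (θ₁ (1 - δ) - θ₁ (-δ)) = 2 * Real.pi * Complex.I := by
  have n₀ : ∀ t, f t - z₀ ≠ 0 := fun t => e₀ t ▸ Complex.exp_ne_zero _
  have n₁ : ∀ t, f t - z₁ ≠ 0 := fun t => e₁ t ▸ Complex.exp_ne_zero _
  have s1 : ∀ t ∈ Icc δ (1 - δ), (f t - z₀) / (f t - z₁) ∈ Complex.slitPlane := fun t ht =>
    div_mem_slitPlane_of_notMem_segment (hseg t ht)
  have s2 : ∀ t ∈ Icc (-δ) δ, (f t - z₀) / (-w) ∈ Complex.slitPlane := fun t ht =>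
    div_mem_slitPlane_of_ne (neg_ne_zero.2 hw) fun τ hτ => by
      rw [smul_neg, sub_neg_eq_add]; exact hray₀ t ht τ hτ
  have s3 : ∀ t ∈ Icc (-δ) δ, (f t - z₁) / w ∈ Complex.slitPlane := fun t ht =>
    div_mem_slitPlane_of_ne hw (hray₁ t ht)
  have c0 : Continuous fun t => (f t - z₀) := hf.sub continuous_const
  have c1 : Continuous fun t => (f t - z₁) := hf.sub continuous_const
  -- Where the curve avoids the segment, `θ₀ - θ₁` follows the logarithm of the ratio, slit along
  -- the segment.
  have k1 := isPreconnected_Icc.sub_eq_of_exp_eq (S := Icc δ (1 - δ)) (f := fun t => θ₀ t - θ₁ t)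
    (g := fun t => Complex.log ((f t - z₀) / (f t - z₁))) (hθ₀.sub hθ₁).continuousOn
    ((c0.div c1 n₁).continuousOn.clog s1) (fun t _ => by
      rw [Complex.exp_sub, e₀, e₁, Complex.exp_log (div_ne_zero (n₀ t) (n₁ t))])
    (a := 1 - δ) (b := δ) ⟨by linarith, le_rfl⟩ ⟨le_rfl, by linarith⟩
  -- Near the parameter `0` the curve avoids the two outer rays instead, and `θ₀ - θ₁` follows a
  -- difference of logarithms slit along these rays.
  have k2 := isPreconnected_Icc.sub_eq_of_exp_eq (S := Icc (-δ) δ)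
    (f := fun t => θ₀ t - θ₁ t + Real.pi * Complex.I)
    (g := fun t => Complex.log ((f t - z₀) / (-w)) - Complex.log ((f t - z₁) / w))
    ((hθ₀.sub hθ₁).add continuous_const).continuousOn
    ((((c0.div_const _).continuousOn.clog s2)).sub ((c1.div_const _).continuousOn.clog s3))
    (fun t _ => by
      rw [Complex.exp_add, Complex.exp_sub, Complex.exp_sub, e₀, e₁, Complex.exp_pi_mul_I,
        Complex.exp_log (div_ne_zero (n₀ t) (neg_ne_zero.2 hw)),
        Complex.exp_log (div_ne_zero (n₁ t) hw)]
      have := n₁ t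
      field_simp)
    (a := -δ) (b := δ) ⟨le_rfl, by linarith⟩ ⟨by linarith, le_rfl⟩
  have him : ∀ a : ℂ, (a / w).im = -(planeDet a w / Complex.normSq w) := fun a => by
    rw [Complex.div_im]; unfold planeDet; ring
  have hN : 0 < Complex.normSq w := Complex.normSq_pos.2 hw
  have hdet : ∀ t, planeDet (f t - z₁) w = planeDet (f t - z₀) w := fun t => by
    have : f t - z₁ = f t - z₀ + r • w := by rw [← hz]; ring
    rw [this]; simp [planeDet]; ring
  have hq : ∀ t, -((f t - z₀) / (-w) / ((f t - z₁) / w)) = (f t - z₀) / (f t - z₁) := fun t => by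
    have := n₁ t
    field_simp
  -- At the ends `δ` and `-δ` the two branches differ by `π * I` and `-(π * I)`, which accounts for
  -- the full turn.
  have j1 := Complex.log_sub_log_of_im_pos (X := (f δ - z₀) / (-w)) (Y := (f δ - z₁) / w)
    (by rw [div_neg, Complex.neg_im, him, neg_neg]; exact div_pos hpos hN)
    (by rw [him, hdet]; exact neg_neg_of_pos (div_pos hpos hN))
  have j2 := Complex.log_sub_log_of_im_neg (X := (f (-δ) - z₀) / (-w)) (Y := (f (-δ) - z₁) / w)
    (by rw [div_neg, Complex.neg_im, him, neg_neg]; exact div_neg_of_neg_of_pos hneg hN)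
    (by rw [him, hdet]; exact neg_pos.2 (div_neg_of_neg_of_pos hneg hN))
  rw [hq] at j1 j2
  rw [hper] at k2 j2
  linear_combination k1 - k2 - j2 + j1

theorem HasDerivAt.eventually_abs_sub_le {g : ℝ → ℝ} {v C : ℝ} (hg : HasDerivAt g v 0)
    (h0 : g 0 = 0) (hC : 0 < C) : ∀ᶠ t in 𝓝 0, |g t - t * v| ≤ C * |t| := by
  have := (hasDerivAt_iff_isLittleO.1 hg).def hC
  filter_upwards [this] with t ht
  simpa [h0] using ht

theorem HasDerivAt.planeDet_left {α : ℝ → ℂ} {v p : ℂ} (w : ℂ) (h : HasDerivAt α v 0) :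
    HasDerivAt (fun t => planeDet (α t - p) w) (planeDet v w) 0 := by
  have h1 := (Complex.reCLM.hasFDerivAt.comp_hasDerivAt (0 : ℝ) (h.sub_const p)).mul_const w.im
  have h2 := (Complex.imCLM.hasFDerivAt.comp_hasDerivAt (0 : ℝ) (h.sub_const p)).mul_const w.re
  exact h1.sub h2

theorem planeDet_swap (z w : ℂ) : planeDet z w = -planeDet w z := by unfold planeDet; ring

theorem planeDet_add_smul (z a b w : ℂ) (s t : ℝ) :
    planeDet (z + (s • a + t • b)) w = planeDet z w + s * planeDet a w + t * planeDet b w := by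
  simp [planeDet]; ring

theorem planeDet_self (z : ℂ) : planeDet z z = 0 := by unfold planeDet; ring

/-- A short segment that is parallel to a strand through a transverse double point and ends on its
two sides meets the other strand near that point only, and the rays prolonging it do not. -/
theorem exists_transverse_bounds {α β : ℝ → ℂ} {p v w : ℂ} {r e δ₀ : ℝ} (hα0 : α 0 = p)
    (hβ0 : β 0 = p) (hα : HasDerivAt α v 0) (hβ : HasDerivAt β (r • w) 0) (hr : r ≠ 0)
    (hvw : 0 < planeDet v w) (he : e = 1 ∨ e = -1) (hδ₀ : 0 < δ₀) :
    ∃ δ, 0 < δ ∧ δ ≤ δ₀ ∧ ∀ᶠ ε : ℝ in 𝓝[>] 0,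
      (∀ t ∈ Icc (-δ) δ, ∀ τ : ℝ, 0 ≤ τ → α t ≠ p + ε • (e • v + w) + τ • w) ∧
      (∀ t ∈ Icc (-δ) δ, ∀ τ : ℝ, 0 ≤ τ → α t ≠ p + ε • (e • v - w) - τ • w) ∧
      (∀ t ∈ Icc (-δ) δ, β t ∉ segment ℝ (p + ε • (e • v + w)) (p + ε • (e • v - w))) ∧
      0 < planeDet (α δ - (p + ε • (e • v + w))) w ∧
      planeDet (α (-δ) - (p + ε • (e • v + w))) w < 0 := by
  set Δ := planeDet v w with hΔ
  have hwv : planeDet w v = -Δ := by rw [hΔ, planeDet_swap]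
  have hr' : 0 < |r| := abs_pos.2 hr
  have z0 : ∀ x, planeDet 0 x = 0 := fun x => by simp [planeDet]
  -- `planeDet · w` and `planeDet · v` are coordinates along `v` and `w`. For small `t`, both curves
  -- follow their tangents in these coordinates with an error of a quarter of the linear rate.
  have a1 := (hα.planeDet_left (p := p) w).eventually_abs_sub_le (by simp [hα0, z0])
    (C := Δ / 4) (by positivity)
  have a2 := (hα.planeDet_left (p := p) v).eventually_abs_sub_le (by simp [hα0, z0])
    (C := Δ / 4) (by positivity)
  have b1 := (hβ.planeDet_left (p := p) w).eventually_abs_sub_le (by simp [hβ0, z0])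
    (C := |r| * Δ / 4) (by positivity)
  have b2 := (hβ.planeDet_left (p := p) v).eventually_abs_sub_le (by simp [hβ0, z0])
    (C := |r| * Δ / 4) (by positivity)
  have hrw : ∀ x, planeDet (r • w) x = r * planeDet w x := fun x => by simp [planeDet]; ring
  rw [planeDet_self] at a2
  rw [hrw, planeDet_self] at b1
  rw [hrw, hwv] at b2
  simp only [mul_zero, sub_zero] at a2 b1
  obtain ⟨δ₁, hδ₁, H⟩ := Metric.eventually_nhds_iff.1 (a1.and (a2.and (b1.and b2)))
  obtain ⟨δ, hδ, l₀, l₁⟩ : ∃ δ, 0 < δ ∧ δ ≤ δ₀ ∧ δ < δ₁ :=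
    ⟨min δ₀ (δ₁ / 2), by positivity, min_le_left _ _, (min_le_right _ _).trans_lt (by linarith)⟩
  have K := fun t (ht : t ∈ Icc (-δ) δ) => H (y := t) (by
    rw [Real.dist_eq, sub_zero]; exact (abs_le.2 ht).trans_lt l₁)
  clear H a1 a2 b1 b2
  have hab : |e| = 1 := by rcases he with rfl | rfl <;> simp
  -- points `p + ε (e v + τ w)`
  have pt : ∀ (ε τ : ℝ) (z : ℂ), z = p + ε • (e • v) + τ • w →
      planeDet (z - p) w = ε * e * Δ ∧ planeDet (z - p) v = -(τ * Δ) := by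
    rintro ε τ z rfl
    have h1 : p + ε • (e • v) + τ • w - p = 0 + ((ε * e) • v + τ • w) := by
      rw [smul_smul]; abel
    rw [h1, planeDet_add_smul, planeDet_add_smul, planeDet_self, planeDet_self, z0, z0, hwv]
    constructor <;> ring
  -- The `v`-coordinate gives `|t| ≤ 4 ε / 3`, and the `w`-coordinate gives `|τ| ≤ |t| / 4`, against
  -- `ε ≤ |τ|`.
  have av : ∀ ε t : ℝ, 0 < ε → t ∈ Icc (-δ) δ → ∀ τ : ℝ, ε ≤ |τ| →
      α t ≠ p + ε • (e • v) + τ • w := by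
    intro ε t hε ht τ hτ h
    obtain ⟨h1, h2⟩ := pt ε τ _ h
    obtain ⟨k1, k2, -⟩ := K t ht
    rw [h1] at k1
    rw [h2, abs_neg, abs_mul, abs_of_pos hvw] at k2
    have k3 : |t| * Δ ≤ ε * Δ + Δ / 4 * |t| := by
      have := abs_sub_abs_le_abs_sub (t * Δ) (ε * e * Δ)
      rw [abs_sub_comm, abs_mul, abs_mul, abs_mul, hab, abs_of_pos hε, abs_of_pos hvw] at this
      linarith
    have k4 : |t| * 3 ≤ 4 * ε := by
      by_contra hh
      nlinarith
    have k5 : |τ| * 4 ≤ |t| := by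
      by_contra hh
      nlinarith
    linarith
  -- The coordinates give `4 ε ≤ |r| |t|` and `3 |r| |t| ≤ 4 |τ|`, hence `|τ| ≥ 3 ε`.
  have bv : ∀ ε t : ℝ, 0 < ε → t ∈ Icc (-δ) δ → ∀ τ : ℝ, |τ| ≤ ε →
      β t ≠ p + ε • (e • v) + τ • w := by
    intro ε t hε ht τ hτ h
    obtain ⟨h1, h2⟩ := pt ε τ _ h
    obtain ⟨-, -, k1, k2⟩ := K t ht
    rw [h1, abs_mul, abs_mul, hab, abs_of_pos hε, abs_of_pos hvw] at k1
    rw [h2] at k2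
    have k3 : |t| * (|r| * Δ) ≤ |τ| * Δ + |r| * Δ / 4 * |t| := by
      have := abs_sub_abs_le_abs_sub (t * (r * -Δ)) (-(τ * Δ))
      rw [abs_sub_comm, abs_mul, abs_mul, abs_neg, abs_neg, abs_mul, abs_of_pos hvw] at this
      linarith
    have k4 : ε * 4 ≤ |r| * |t| := by
      by_contra hh
      nlinarith
    have k5 : 3 * (|r| * |t|) ≤ 4 * |τ| := by
      by_contra hh
      nlinarith
    linarith
  refine ⟨δ, hδ, l₀, ?_⟩
  filter_upwards [Ioo_mem_nhdsGT (show (0 : ℝ) < δ / 2 by positivity)] with ε hε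
  have e1 : ∀ t, planeDet (α t - (p + ε • (e • v + w))) w = planeDet (α t - p) w - ε * e * Δ := by
    intro t
    have : α t - (p + ε • (e • v + w)) = α t - p + ((-(ε * e)) • v + (-ε) • w) := by
      rw [smul_add, smul_smul, neg_smul, neg_smul]; abel
    rw [this, planeDet_add_smul, planeDet_self]; ring
  have e2 : ε * e * Δ ≤ ε * Δ ∧ -(ε * Δ) ≤ ε * e * Δ := by
    have := mul_pos hε.1 hvw
    rcases he with rfl | rfl <;> constructor <;> linarith
  refine ⟨fun t ht τ hτ h => ?_, fun t ht τ hτ h => ?_, fun t ht h => ?_, ?_, ?_⟩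
  · refine av ε t hε.1 ht (ε + τ) ?_ (h.trans ?_)
    · rw [abs_of_nonneg (by linarith [hε.1])]; linarith
    · rw [smul_add, add_smul]; abel
  · refine av ε t hε.1 ht (-(ε + τ)) ?_ (h.trans ?_)
    · rw [abs_neg, abs_of_nonneg (by linarith [hε.1])]; linarith
    · rw [smul_sub, neg_smul, add_smul]; abel
  · obtain ⟨a, b, ha, hb, hab', h⟩ := h
    refine bv ε t hε.1 ht ((a - b) * ε) ?_ (h.symm.trans ?_)
    · rw [abs_mul, abs_of_pos hε.1]
      have : |a - b| ≤ 1 := abs_le.2 ⟨by linarith, by linarith⟩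
      nlinarith [hε.1]
    · have hb' : b = 1 - a := by linarith
      rw [hb']
      module
  · rw [e1]
    have := (abs_le.1 (K δ ⟨by linarith, le_rfl⟩).1).1
    rw [abs_of_pos hδ] at this
    nlinarith [hε.2]
  · rw [e1]
    have := (abs_le.1 (K (-δ) ⟨le_rfl, by linarith⟩).1).2
    rw [abs_neg, abs_of_pos hδ] at this
    nlinarith [hε.2]

namespace LinkDiagram

variable (D : LinkDiagram)

theorem exists_curve_log (x : LoopParam D.numComponents) {z : ℂ} (hz : z ∉ D.trace) :
    ∃ θ : ℝ → ℂ, Continuous θ ∧ ∀ t, Complex.exp (θ t) = D.curve (x.shift t) - z :=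
  exists_continuous_log ((D.continuous_curve_shift x).sub continuous_const) fun t h =>
    hz (sub_eq_zero.1 h ▸ D.curve_mem_trace _)

open Classical in
/-- The logarithm swept out by the vector from `z` to a point running along the `k`-th curve. -/
def turn (k : Fin D.numComponents) (z : ℂ) : ℂ :=
  if hz : z ∉ D.trace then (D.exists_curve_log (k, 0) hz).choose 1 -
    (D.exists_curve_log (k, 0) hz).choose 0 else 0

variable {D}

theorem _root_.LoopParam.shift_add_one {m : ℕ} (x : LoopParam m) (t : ℝ) :
    x.shift (t + 1) = x.shift t := by
  simp [LoopParam.shift]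

/-- Two continuous logarithms of the same function differ by a constant, so the increment over a
period depends neither on the choice of the logarithm nor on the starting parameter. -/
theorem sub_eq_turn {x : LoopParam D.numComponents} {z : ℂ} (hz : z ∉ D.trace) {θ : ℝ → ℂ}
    (hθ : Continuous θ) (h : ∀ t, Complex.exp (θ t) = D.curve (x.shift t) - z) {a b : ℝ}
    (hab : b = a + 1) : θ b - θ a = D.turn x.1 z := by
  obtain ⟨k, y⟩ := x
  obtain ⟨τ, rfl⟩ := QuotientAddGroup.mk_surjective y
  rw [turn, dif_pos hz]
  set H := D.exists_curve_log (k, 0) hz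
  obtain ⟨c, h'⟩ := H.choose_spec
  set θ' := H.choose
  have e : ∀ t, LoopParam.shift (k, (τ : UnitAddCircle)) t = LoopParam.shift (k, 0) (t + τ) := by
    intro t
    simp [LoopParam.shift, add_comm]
  have k1 := isPreconnected_univ.sub_eq_of_exp_eq (f := θ) (g := fun t => θ' (t + τ))
    hθ.continuousOn (c.comp (continuous_add_const τ)).continuousOn (fun t _ => by
      rw [h, h']
      exact congrArg (fun q => D.curve q - z) (e t)) (mem_univ b) (mem_univ a)
  have k2 := isPreconnected_univ.sub_eq_of_exp_eq (f := fun t => θ' (t + 1)) (g := θ')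
    (c.comp (continuous_add_const 1)).continuousOn c.continuousOn (fun t _ => by
      rw [h', h', LoopParam.shift_add_one]) (mem_univ (a + τ)) (mem_univ 0)
  simp only [zero_add] at k2
  rw [hab, show a + 1 + τ = a + τ + 1 by ring] at k1
  rw [hab]
  linear_combination k1 + k2

/-- The difference of the two angles is, up to a constant, the principal logarithm of the ratio,
which is a periodic function of the parameter. -/
theorem turn_eq_of_segment {k : Fin D.numComponents} {z₀ z₁ : ℂ}
    (h : ∀ t, D.curve (k, t) ∉ segment ℝ z₀ z₁) (h₀ : z₀ ∉ D.trace) (h₁ : z₁ ∉ D.trace) :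
    D.turn k z₀ = D.turn k z₁ := by
  obtain ⟨θ₀, c₀, e₀⟩ := D.exists_curve_log (k, 0) h₀
  obtain ⟨θ₁, c₁, e₁⟩ := D.exists_curve_log (k, 0) h₁
  have n₀ : ∀ t, D.curve (LoopParam.shift (k, 0) t) - z₀ ≠ 0 := fun t => e₀ t ▸ Complex.exp_ne_zero _
  have n₁ : ∀ t, D.curve (LoopParam.shift (k, 0) t) - z₁ ≠ 0 := fun t => e₁ t ▸ Complex.exp_ne_zero _
  have cc := D.continuous_curve_shift (k, 0)
  have key := isPreconnected_univ.sub_eq_of_exp_eq (f := fun t => θ₀ t - θ₁ t)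
    (g := fun t => Complex.log ((D.curve (LoopParam.shift (k, 0) t) - z₀) /
      (D.curve (LoopParam.shift (k, 0) t) - z₁))) (c₀.sub c₁).continuousOn
    (((cc.sub continuous_const).div (cc.sub continuous_const) n₁).continuousOn.clog fun t _ =>
      div_mem_slitPlane_of_notMem_segment (h _)) (fun t _ => by
      rw [Complex.exp_sub, e₀, e₁, Complex.exp_log (div_ne_zero (n₀ t) (n₁ t))])
    (mem_univ (0 + 1)) (mem_univ 0)
  rw [← sub_eq_turn h₀ c₀ e₀ (a := 0) (b := 0 + 1) rfl,
    ← sub_eq_turn h₁ c₁ e₁ (a := 0) (b := 0 + 1) rfl]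
  rw [LoopParam.shift_add_one] at key
  linear_combination key

variable (D) in
/-- The winding number around a point of the whole family of curves. -/
def winding (z : ℂ) : ℂ := (∑ k, D.turn k z) / (2 * Real.pi * Complex.I)

theorem winding_eq_of_mem_region {F : D.Face} {z z' : ℂ} (hz : z ∈ D.region F)
    (hz' : z' ∈ D.region F) : D.winding z = D.winding z' := by
  refine (isPreconnected_region F).induction₂ (fun a b => D.winding a = D.winding b) ?_
    (fun a b c _ _ _ => Eq.trans) (fun a b _ _ => Eq.symm) hz hz'
  intro a ha
  obtain ⟨r, hr, H⟩ := Metric.isOpen_iff.1 (isOpen_region F) a ha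
  filter_upwards [nhdsWithin_le_nhds (Metric.ball_mem_nhds a hr)] with b hb
  rw [winding, winding]
  congr 1
  refine Finset.sum_congr rfl fun k _ => turn_eq_of_segment (fun t ht => ?_) ha.1 (H hb).1
  exact (H ((convex_ball a r).segment_subset (Metric.mem_ball_self hr) hb ht)).1
    (D.curve_mem_trace _)

variable (D) in
/-- The winding number around a face of the whole family of curves. -/
def faceWinding (F : D.Face) : ℤ := ⌊(D.winding (exists_mem_region F).choose).re⌋

/-- That winding numbers are integers is not needed: the floor of the real part respects differences
of exactly one. -/
theorem faceWinding_sub {F F' : D.Face} {z z' : ℂ} (hz : z ∈ D.region F)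
    (hz' : z' ∈ D.region F') (h : D.winding z - D.winding z' = 1) :
    D.faceWinding F - D.faceWinding F' = 1 := by
  unfold faceWinding
  rw [winding_eq_of_mem_region (exists_mem_region F).choose_spec hz,
    winding_eq_of_mem_region (exists_mem_region F').choose_spec hz']
  have : D.winding z = D.winding z' + 1 := by linear_combination h
  rw [this, Complex.add_re, Complex.one_re, Int.floor_add_one]
  ring

/-- The winding number is larger by one on the left of a strand than on its right. -/
theorem eventually_winding_sub {x y : LoopParam D.numComponents} {p v w : ℂ} {r e : ℝ}
    (hx : D.curve x = p) (hy : D.curve y = p) (hp : ∀ q, D.curve q = p → q = x ∨ q = y)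
    (hv : HasDerivAt (fun t => D.curve (x.shift t)) v 0)
    (hw : HasDerivAt (fun t => D.curve (y.shift t)) (r • w) 0) (hr : r ≠ 0)
    (hvw : 0 < planeDet v w) (he : e = 1 ∨ e = -1) :
    ∀ᶠ ε : ℝ in 𝓝[>] 0, p + ε • (e • v + w) ∉ D.trace → p + ε • (e • v - w) ∉ D.trace →
      D.winding (p + ε • (e • v + w)) - D.winding (p + ε • (e • v - w)) = 1 := by
  have hw0 : w ≠ 0 := by rintro rfl; simp [planeDet] at hvw
  obtain ⟨δ, hδ, hδ', H⟩ := exists_transverse_bounds (by simpa using hx) (by simpa using hy)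
    hv hw hr hvw he (show (0 : ℝ) < 1 / 4 by norm_num)
  obtain ⟨W, hW, HW⟩ := exists_nhds_params (D := D) p hδ
  obtain ⟨R, hR, HR⟩ := Metric.mem_nhds_iff.1 hW
  have near : ∀ u : ℂ, ∀ᶠ ε : ℝ in 𝓝[>] 0, p + ε • u ∈ Metric.ball p R := by
    intro u
    have hc : ContinuousAt (fun ε : ℝ => p + ε • u) 0 := by fun_prop
    refine nhdsWithin_le_nhds (hc.preimage_mem_nhds ?_)
    simpa using Metric.ball_mem_nhds p hR
  filter_upwards [H, near (e • v + w), near (e • v - w), self_mem_nhdsWithin] with ε H n₀ n₁ hε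
    h₀ h₁
  obtain ⟨r₀, r₁, hβ, hpos, hneg⟩ := H
  set z₀ := p + ε • (e • v + w) with hz₀
  set z₁ := p + ε • (e • v - w) with hz₁
  -- The second strand through `p` runs along the segment and misses it, so only the strand at `x`
  -- contributes, even if both belong to the same curve.
  have hsegW : ∀ q, D.curve q ∈ segment ℝ z₀ z₁ → ∃ h, |h| < δ ∧ q = x.shift h := by
    intro q hq
    obtain ⟨q', h, h1, h2, rfl⟩ := HW q (HR ((convex_ball p R).segment_subset n₀ n₁ hq))
    rcases hp q' h1 with rfl | rfl
    · exact ⟨h, h2, rfl⟩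
    · exact absurd hq (hβ h (abs_le.1 h2.le))
  have hoth : ∀ k, k ≠ x.1 → D.turn k z₀ = D.turn k z₁ := by
    intro k hk
    refine turn_eq_of_segment (fun t ht => ?_) h₀ h₁
    obtain ⟨h, -, h2⟩ := hsegW _ ht
    exact hk (congrArg Prod.fst h2)
  obtain ⟨θ₀, c₀, e₀⟩ := D.exists_curve_log x h₀
  obtain ⟨θ₁, c₁, e₁⟩ := D.exists_curve_log x h₁
  have key := turn_sub_turn (f := fun t => D.curve (x.shift t)) (r := 2 * ε) hδ (by linarith)
    (D.continuous_curve_shift x) (by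
      rw [show (1 : ℝ) - δ = -δ + 1 by ring, LoopParam.shift_add_one]) c₀ c₁ e₀ e₁ hw0
    (by rw [hz₀, hz₁]; module) (fun t ht hs => by
      obtain ⟨h, h1, h2⟩ := hsegW _ hs
      rw [abs_lt] at h1
      have := LoopParam.shift_injOn (by rw [abs_lt]; constructor <;> linarith [ht.1, ht.2]) h2
      linarith [ht.1]) r₀ r₁ hpos hneg
  rw [sub_eq_turn h₀ c₀ e₀ (by ring), sub_eq_turn h₁ c₁ e₁ (by ring)] at key
  rw [winding, winding, ← sub_div, ← Finset.sum_sub_distrib, Finset.sum_eq_single x.1, key,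
    div_self Complex.two_pi_I_ne_zero]
  · intro k _ hk
    rw [hoth k hk, sub_self]
  · simp

end LinkDiagram

/-! ### Summation along the curves -/

/-- The total of the jumps of a function that is locally constant outside a finite set. -/
theorem sub_eq_sum_jumps {M ι : Type*} [AddCommGroup M] [Fintype ι] {τ : ι → ℝ}
    (hτ : Function.Injective τ) {a b : ℝ} (hab : a ≤ b) (hmem : ∀ i, τ i ∈ Ioo a b) {K : ℝ → M}
    {J : ι → M} (hreg : ∀ t ∈ Icc a b, (∀ i, τ i ≠ t) → ∀ᶠ s in 𝓝 t, K s = K t)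
    (hjump : ∀ i, ∃ m, (∀ᶠ s in 𝓝[<] τ i, K s = m) ∧ ∀ᶠ s in 𝓝[>] τ i, K s = m + J i) :
    K b - K a = ∑ i, J i := by
  classical
  choose m hl hr using hjump
  -- `Φ` collects the jumps passed so far. After subtracting it, and taking the left limits at the
  -- jumps, a locally constant function remains.
  let Φ : ℝ → M := fun t => ∑ i with τ i < t, J i
  let G : ℝ → M := fun t => (if h : ∃ i, τ i = t then m h.choose else K t) - Φ t
  have hG : ∀ t, (∀ i, τ i ≠ t) → G t = K t - Φ t := fun t h => by
    simp only [G]; rw [dif_neg (by push Not; exact h)]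
  have hGτ : ∀ i, G (τ i) = m i - Φ (τ i) := fun i => by
    have h : ∃ j, τ j = τ i := ⟨i, rfl⟩
    simp only [G]; rw [dif_pos h, hτ h.choose_spec]
  have hnear : ∀ t, ∀ᶠ s in 𝓝 t, ∀ i, (τ i < t → τ i < s) ∧ (t < τ i → s < τ i) := by
    intro t
    refine eventually_all.2 fun i => ?_
    rcases lt_trichotomy (τ i) t with h | h | h
    · filter_upwards [lt_mem_nhds h] with s hs
      exact ⟨fun _ => hs, fun h' => absurd h' h.asymm⟩
    · exact Eventually.of_forall fun s => ⟨fun h' => absurd h h'.ne, fun h' => absurd h h'.ne'⟩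
    · filter_upwards [gt_mem_nhds h] with s hs
      exact ⟨fun h' => absurd h' h.asymm, fun _ => hs⟩
  have hloc : ∀ t ∈ Icc a b, ∀ᶠ s in 𝓝 t, G s = G t := by
    intro t ht
    by_cases hex : ∃ i, τ i = t
    · obtain ⟨i, rfl⟩ := hex
      have h1 := eventually_nhdsWithin_iff.1 (hl i)
      have h2 := eventually_nhdsWithin_iff.1 (hr i)
      filter_upwards [h1, h2, hnear (τ i)] with s h1 h2 h3
      have hne : s ≠ τ i → ∀ j, τ j ≠ s := by
        intro hs j hj
        rcases lt_trichotomy (τ j) (τ i) with h | h | h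
        · exact ((h3 j).1 h).ne hj
        · exact hs (hj ▸ h)
        · exact ((h3 j).2 h).ne' hj
      rcases lt_trichotomy s (τ i) with h | h | h
      · rw [hG s (hne h.ne), hGτ, h1 h]
        have : Φ s = Φ (τ i) := by
          refine Finset.sum_congr (Finset.filter_congr fun j _ => ?_) fun _ _ => rfl
          exact ⟨fun hj => hj.trans h, (h3 j).1⟩
        rw [this]
      · rw [h]
      · rw [hG s (hne h.ne'), hGτ, h2 h]
        have : Φ s = Φ (τ i) + J i := by
          have : (Finset.univ.filter fun j => τ j < s) =
              insert i (Finset.univ.filter fun j => τ j < τ i) := by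
            ext j
            simp only [Finset.mem_filter, Finset.mem_univ, true_and, Finset.mem_insert]
            constructor
            · intro hj
              rcases lt_trichotomy (τ j) (τ i) with h' | h' | h'
              · exact Or.inr h'
              · exact Or.inl (hτ h')
              · exact absurd hj ((h3 j).2 h').asymm
            · rintro (rfl | hj)
              · exact h
              · exact hj.trans h
          simp only [Φ]
          rw [this, Finset.sum_insert (by simp), add_comm]
        rw [this]; abel
    · push Not at hex
      filter_upwards [hreg t ht hex, hnear t] with s h1 h3
      have hne : ∀ j, τ j ≠ s := by
        intro j hj
        rcases lt_or_gt_of_ne (hex j) with h | h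
        · exact ((h3 j).1 h).ne hj
        · exact ((h3 j).2 h).ne' hj
      rw [hG s hne, hG t hex, h1]
      congr 1
      refine Finset.sum_congr (Finset.filter_congr fun j _ => ?_) fun _ _ => rfl
      constructor
      · intro hj
        rcases lt_or_gt_of_ne (hex j) with h | h
        · exact h
        · exact absurd hj ((h3 j).2 h).asymm
      · exact (h3 j).1
  have hconst : G a = G b := by
    refine isPreconnected_Icc.induction₂ (fun x y => G x = G y) (fun x hx => ?_)
      (fun _ _ _ _ _ _ => Eq.trans) (fun _ _ _ _ => Eq.symm) (left_mem_Icc.2 hab)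
      (right_mem_Icc.2 hab)
    filter_upwards [nhdsWithin_le_nhds (hloc x hx)] with y hy
    exact hy.symm
  rw [hG a fun i => (hmem i).1.ne', hG b fun i => (hmem i).2.ne] at hconst
  have e1 : Φ a = 0 := by
    refine Finset.sum_eq_zero fun i hi => ?_
    exact absurd (Finset.mem_filter.1 hi).2 (hmem i).1.asymm
  have e2 : Φ b = ∑ i, J i := by
    simp only [Φ]
    rw [Finset.filter_true_of_mem fun i _ => (hmem i).2]
  rw [e1, e2] at hconst
  rw [sub_zero] at hconst
  rw [hconst]; abel

namespace LinkDiagram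

variable {D : LinkDiagram}

theorem faceWinding_sectorFace_sub {c : Fin D.numCrossings} {x y : LoopParam D.numComponents}
    {v w : ℂ} {r e : ℝ} {i j : Fin 4} (hx : D.curve x = D.crossingPoint c)
    (hy : D.curve y = D.crossingPoint c)
    (hp : ∀ q, D.curve q = D.crossingPoint c → q = x ∨ q = y)
    (hv : HasDerivAt (fun t => D.curve (x.shift t)) v 0)
    (hw : HasDerivAt (fun t => D.curve (y.shift t)) (r • w) 0) (hr : r ≠ 0)
    (hvw : 0 < planeDet v w) (he : e = 1 ∨ e = -1) (hi : D.sectorDir c i = e • v + w)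
    (hj : D.sectorDir c j = e • v - w) :
    D.faceWinding (D.sectorFace c i) - D.faceWinding (D.sectorFace c j) = 1 := by
  have h1 := (D.isFourSided_sector c).direction i
  have h2 := (D.isFourSided_sector c).direction j
  rw [hi] at h1
  rw [hj] at h2
  obtain ⟨ε, h3, h4, h5⟩ := ((eventually_winding_sub hx hy hp hv hw hr hvw he).and
    (h1.and h2)).exists
  have h4' := D.sector_subset_region c i h4
  have h5' := D.sector_subset_region c j h5
  exact faceWinding_sub h4' h5' (h3 h4'.1 h5'.1)

theorem hasDerivAt_over (c : Fin D.numCrossings) :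
    HasDerivAt (fun t => D.curve ((D.overParam c).shift t)) (D.overTangent c) 0 :=
  ((D.smooth_over c).differentiableAt (by simp)).hasDerivAt

theorem hasDerivAt_under (c : Fin D.numCrossings) :
    HasDerivAt (fun t => D.curve ((D.underParam c).shift t)) (D.underTangent c) 0 :=
  ((D.smooth_under c).differentiableAt (by simp)).hasDerivAt

theorem crossingSign_mul_self (c : Fin D.numCrossings) :
    D.crossingSign c * D.crossingSign c = 1 := by
  rcases D.crossingSign_eq c with h | h <;> rw [h] <;> norm_num

theorem crossingSign_smul_posUnderTangent (c : Fin D.numCrossings) :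
    D.crossingSign c • D.posUnderTangent c = D.underTangent c := by
  rw [posUnderTangent, smul_smul, crossingSign_mul_self, one_smul]

theorem faceWinding_over (c : Fin D.numCrossings) :
    D.faceWinding (D.sectorFace c 0) - D.faceWinding (D.sectorFace c 3) = 1 ∧
      D.faceWinding (D.sectorFace c 1) - D.faceWinding (D.sectorFace c 2) = 1 := by
  have hs : D.crossingSign c ≠ 0 := fun h => by simpa [h] using crossingSign_mul_self c
  have hw := hasDerivAt_under c
  rw [← crossingSign_smul_posUnderTangent] at hw
  constructor
  · exact faceWinding_sectorFace_sub (curve_overParam c) (curve_underParam c)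
      (fun q => curve_eq_crossingPoint) (hasDerivAt_over c) hw hs (D.planeDet_pos c) (Or.inl rfl)
      (by simp [sectorDir]) (by simp [sectorDir])
  · exact faceWinding_sectorFace_sub (curve_overParam c) (curve_underParam c)
      (fun q => curve_eq_crossingPoint) (hasDerivAt_over c) hw hs (D.planeDet_pos c) (Or.inr rfl)
      (by simp [sectorDir]; ring) (by simp [sectorDir]; ring)

/-- The strand passing under runs along `posUnderTangent` or against it according to the sign of the
crossing, so the sign decides which sectors are on its left. -/
theorem faceWinding_under (c : Fin D.numCrossings) :
    D.crossingSign c = 1 ∧ D.faceWinding (D.sectorFace c 1) - D.faceWinding (D.sectorFace c 0) = 1 ∧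
      D.faceWinding (D.sectorFace c 2) - D.faceWinding (D.sectorFace c 3) = 1 ∨
    D.crossingSign c = -1 ∧ D.faceWinding (D.sectorFace c 0) - D.faceWinding (D.sectorFace c 1) = 1 ∧
      D.faceWinding (D.sectorFace c 3) - D.faceWinding (D.sectorFace c 2) = 1 := by
  have hp : ∀ q, D.curve q = D.crossingPoint c → q = D.underParam c ∨ q = D.overParam c :=
    fun q h => (curve_eq_crossingPoint h).symm
  have hdet := D.planeDet_pos c
  have hu := crossingSign_smul_posUnderTangent c
  have hv := hasDerivAt_under c
  rw [← hu] at hv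
  rcases D.crossingSign_eq c with h | h
  · refine Or.inl ⟨h, ?_⟩
    rw [h, one_smul] at hv
    have hw : HasDerivAt (fun t => D.curve ((D.overParam c).shift t))
        ((-1 : ℝ) • -D.overTangent c) 0 := by simpa using hasDerivAt_over c
    have hd : 0 < planeDet (D.posUnderTangent c) (-D.overTangent c) := by
      rw [planeDet] at hdet ⊢
      simp only [Complex.neg_re, Complex.neg_im]
      linarith
    constructor
    · exact faceWinding_sectorFace_sub (curve_underParam c) (curve_overParam c) hp hv hw
        (by norm_num) hd (Or.inl rfl) (by simp [sectorDir]; ring) (by simp [sectorDir]; ring)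
    · exact faceWinding_sectorFace_sub (curve_underParam c) (curve_overParam c) hp hv hw
        (by norm_num) hd (Or.inr rfl) (by simp [sectorDir]) (by simp [sectorDir]; ring)
  · refine Or.inr ⟨h, ?_⟩
    rw [h, neg_smul, one_smul] at hv
    have hw : HasDerivAt (fun t => D.curve ((D.overParam c).shift t))
        ((1 : ℝ) • D.overTangent c) 0 := by simpa using hasDerivAt_over c
    have hd : 0 < planeDet (-D.posUnderTangent c) (D.overTangent c) := by
      rw [planeDet] at hdet ⊢
      simp only [Complex.neg_re, Complex.neg_im]
      linarith
    constructor
    · exact faceWinding_sectorFace_sub (curve_underParam c) (curve_overParam c) hp hv hw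
        (by norm_num) hd (Or.inr rfl) (by simp [sectorDir]; ring) (by simp [sectorDir])
    · exact faceWinding_sectorFace_sub (curve_underParam c) (curve_overParam c) hp hv hw
        (by norm_num) hd (Or.inl rfl) (by simp [sectorDir]; ring) (by simp [sectorDir]; ring)

/-! ### The faces along the two sides of the curves -/

variable (D) in
/-- `F` and `F'` are the faces on the two sides of the curve at the parameter `x`. -/
structure HasSides (x : LoopParam D.numComponents) (F F' : D.Face) : Prop where
  mem_closure_left : D.curve x ∈ closure (D.region F)
  mem_closure_right : D.curve x ∈ closure (D.region F')
  eq_or_eq : ∀ G, D.curve x ∈ closure (D.region G) → G = F ∨ G = F'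

theorem HasSides.apply_eq {M : Type*} {g : D.Face → D.Face → M} (hg : ∀ F F', g F F' = g F' F)
    {x : LoopParam D.numComponents} {F F' G G' : D.Face} (h : D.HasSides x F F')
    (h' : D.HasSides x G G') : g F F' = g G G' := by
  rcases h'.eq_or_eq F h.1 with rfl | rfl <;> rcases h'.eq_or_eq F' h.2 with rfl | rfl
  · rcases h.eq_or_eq G' h'.2 with rfl | rfl <;> rfl
  · rfl
  · exact hg _ _
  · rcases h.eq_or_eq G h'.1 with rfl | rfl <;> rfl

theorem Regular.exists_hasSides {x : LoopParam D.numComponents} (hx : D.Regular x) :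
    ∃ F F', ∀ᶠ h in 𝓝 0, D.HasSides (x.shift h) F F' := by
  obtain ⟨U, S₀, S₁, -, H⟩ := hx.exists_isTwoSided univ_mem
  obtain ⟨F, F', hF, hF'⟩ := H.exists_faces
  refine ⟨F, F', ?_⟩
  have hc : ContinuousAt (fun h => D.curve (x.shift h)) 0 :=
    (D.continuous_curve_shift x).continuousAt
  have hU : ∀ᶠ h in 𝓝 0, D.curve (x.shift h) ∈ U := hc.preimage_mem_nhds (by
    rw [LoopParam.shift_zero]; exact H.isOpen.mem_nhds H.mem)
  filter_upwards [hU] with h hh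
  refine ⟨closure_mono hF (H.mem_closure₀ _ hh (D.curve_mem_trace _)),
    closure_mono hF' (H.mem_closure₁ _ hh (D.curve_mem_trace _)), fun G hG => ?_⟩
  obtain ⟨z, hzU, hzG⟩ := mem_closure_iff.1 hG U H.isOpen hh
  have hz : z ∈ S₀ ∪ S₁ := H.union_eq ▸ ⟨hzU, hzG.1⟩
  rcases hz with hz | hz
  · exact Or.inl (eq_of_mem_region hzG (hF hz))
  · exact Or.inr (eq_of_mem_region hzG (hF' hz))

theorem eventually_hasSides_branchParam (c : Fin D.numCrossings) (i : Fin 4) :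
    ∀ᶠ t in 𝓝[>] 0, D.HasSides (D.branchParam c i t) (D.sectorFace c i)
      (D.sectorFace c (i + 1)) := by
  have H := D.isFourSided_sector c
  filter_upwards [H.eventually_branch i] with t ht
  obtain ⟨hU, hb⟩ := ht
  refine ⟨closure_mono (D.sector_subset_region c _) hb.mem_closure,
    closure_mono (D.sector_subset_region c _) hb.mem_closure_succ, fun G hG => ?_⟩
  have h1 : D.curve (D.branchParam c i t) ∈ closure (D.crossingNhd c ∩ D.region G) :=
    H.isOpen.inter_closure ⟨hU, hG⟩
  have h2 : D.crossingNhd c ∩ D.region G ⊆ ⋃ j ∈ {j | D.sectorFace c j = G}, D.sector c j := by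
    rintro z ⟨hz, hzG⟩
    have : z ∈ ⋃ j, D.sector c j := H.iUnion_eq ▸ ⟨hz, hzG.1⟩
    obtain ⟨j, hj⟩ := mem_iUnion.1 this
    exact mem_biUnion (show D.sectorFace c j = G from
      eq_of_mem_region (D.sector_subset_region c j hj) hzG) hj
  have h3 := closure_mono h2 h1
  rw [(toFinite {j | D.sectorFace c j = G}).closure_biUnion] at h3
  obtain ⟨j, hj, h4⟩ := mem_iUnion₂.1 h3
  rcases hb.eq_of_mem_closure j h4 with rfl | rfl
  · exact Or.inl hj.symm
  · exact Or.inr hj.symm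

theorem exists_regular_fst_eq (k : Fin D.numComponents) : ∃ b, D.Regular b ∧ b.1 = k := by
  obtain ⟨δ, hδ, -, H⟩ := exists_regular_shift (D := D) (k, 0)
  exact ⟨LoopParam.shift (k, 0) (δ / 2), H _ (by positivity) (by
    rw [abs_of_pos (by positivity)]; linarith), rfl⟩

theorem _root_.LoopParam.exists_eq_shift {m : ℕ} {x y : LoopParam m} (h : y.1 = x.1) :
    ∃ t ∈ Ico (0 : ℝ) 1, y = x.shift t := by
  obtain ⟨k, a⟩ := x
  obtain ⟨l, b⟩ := y
  obtain rfl : l = k := h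
  obtain ⟨d, hd⟩ := QuotientAddGroup.mk_surjective (b - a)
  refine ⟨Int.fract d, ⟨Int.fract_nonneg d, Int.fract_lt_one d⟩, ?_⟩
  have h1 : ((Int.fract d : ℝ) : UnitAddCircle) = b - a := by
    rw [← hd, Int.fract, AddCircle.coe_sub]
    have : (((⌊d⌋ : ℤ) : ℝ) : UnitAddCircle) = 0 :=
      (AddCircle.coe_eq_zero_iff (1 : ℝ)).2 ⟨⌊d⌋, by simp⟩
    rw [this, sub_zero]
  simp [LoopParam.shift, h1]

/-- Going once around all curves, the changes of a function of the two neighbouring faces add up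
to zero. -/
theorem sum_jump_sides {M : Type*} [AddCommGroup M] {g : D.Face → D.Face → M}
    (hg : ∀ F F', g F F' = g F' F) (J : Fin D.numCrossings ⊕ Fin D.numCrossings → M)
    (hJ : ∀ q, ∃ F F' G G', J q = g G G' - g F F' ∧
      (∀ᶠ t in 𝓝[>] 0, D.HasSides ((Sum.elim D.overParam D.underParam q).shift (-t)) F F') ∧
      ∀ᶠ t in 𝓝[>] 0, D.HasSides ((Sum.elim D.overParam D.underParam q).shift t) G G') :
    ∑ q, J q = 0 := by
  classical
  set P := Sum.elim D.overParam D.underParam with hP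
  -- By symmetry, `g` depends only on the unordered pair of sides. Values at the crossings are
  -- irrelevant, since only the one-sided behaviour there is used.
  let H : LoopParam D.numComponents → M := fun x =>
    if h : ∃ q : D.Face × D.Face, D.HasSides x q.1 q.2 then g h.choose.1 h.choose.2 else 0
  have hH : ∀ {x F F'}, D.HasSides x F F' → H x = g F F' := by
    intro x F F' h
    have hex : ∃ q : D.Face × D.Face, D.HasSides x q.1 q.2 := ⟨(F, F'), h⟩
    simp only [H]
    rw [dif_pos hex]
    exact hex.choose_spec.apply_eq hg h
  rw [← Fintype.sum_fiberwise (fun q => (P q).1)]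
  refine Finset.sum_eq_zero fun k _ => ?_
  obtain ⟨b, hb, rfl⟩ := exists_regular_fst_eq k
  have hreg : ∀ q, P q ≠ b := by
    rintro (c | c) h
    · exact hb.1 ⟨c, h⟩
    · exact hb.2 ⟨c, h⟩
  have hτ : ∀ q : {q // (P q).1 = b.1}, ∃ t ∈ Ioo (0 : ℝ) 1, P q = b.shift t := by
    rintro ⟨q, hq⟩
    obtain ⟨t, ht, h⟩ := LoopParam.exists_eq_shift hq
    refine ⟨t, ⟨lt_of_le_of_ne ht.1 ?_, ht.2⟩, h⟩
    rintro rfl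
    exact hreg q (by rw [h, LoopParam.shift_zero])
  choose τ hτm hτe using hτ
  -- Starting from a regular parameter `b` puts all jumps of this curve into the open interval, and
  -- the total change over a period is zero.
  have key := sub_eq_sum_jumps (τ := τ) (a := 0) (b := 1) (K := fun t => H (b.shift t))
    (J := fun q : {q // (P q).1 = b.1} => J q) (by
      intro q q' h
      have : P q = P q' := by rw [hτe, hτe, h]
      exact Subtype.ext (D.passages_injective this)) zero_le_one hτm ?_ ?_
  · rw [← key]
    have : b.shift 1 = b.shift 0 := by simpa using LoopParam.shift_add_one b 0
    simp only [this, sub_self]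
  · intro t ht hne
    have hbt : D.Regular (b.shift t) := by
      have hall : ∀ q, P q ≠ b.shift t := by
        intro q h
        have hq : (P q).1 = b.1 := by rw [h]; rfl
        have h1 := hτe ⟨q, hq⟩
        rw [h] at h1
        have h2 := hτm ⟨q, hq⟩
        have h3 := hne ⟨q, hq⟩
        rcases eq_or_lt_of_le ht.2 with h4 | h4
        · refine hreg q ?_
          rw [h, h4]
          simpa using LoopParam.shift_add_one b 0
        · exact h3 (LoopParam.shift_injOn (by
            rw [abs_lt]; constructor <;> linarith [ht.1, h2.1, h2.2]) h1).symm
      exact ⟨fun ⟨c, h⟩ => hall (Sum.inl c) h, fun ⟨c, h⟩ => hall (Sum.inr c) h⟩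
    obtain ⟨F, F', hF⟩ := hbt.exists_hasSides
    have h0 := hF.self_of_nhds
    rw [LoopParam.shift_zero] at h0
    have h1 : Tendsto (fun s => s - t) (𝓝 t) (𝓝 0) := by
      have : ContinuousAt (fun s => s - t) t := by fun_prop
      simpa [ContinuousAt] using this
    filter_upwards [h1.eventually hF] with s hs
    rw [LoopParam.shift_shift, add_sub_cancel] at hs
    rw [hH hs, hH h0]
  · intro q
    obtain ⟨F, F', G, G', hJq, hl, hr⟩ := hJ q
    rw [hτe q] at hl hr
    refine ⟨g F F', ?_, ?_⟩
    · have h1 : Tendsto (fun s => τ q - s) (𝓝[<] τ q) (𝓝[>] 0) := by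
        refine tendsto_nhdsWithin_iff.2 ⟨?_, ?_⟩
        · have : ContinuousAt (fun s => τ q - s) (τ q) := by fun_prop
          refine Tendsto.mono_left ?_ nhdsWithin_le_nhds
          simpa [ContinuousAt] using this
        · filter_upwards [self_mem_nhdsWithin] with s hs
          exact sub_pos.2 (mem_Iio.1 hs)
      filter_upwards [h1.eventually hl] with s hs
      rw [LoopParam.shift_shift] at hs
      have e : τ q + -(τ q - s) = s := by ring
      rw [e] at hs
      exact hH hs
    · have h1 : Tendsto (fun s => s - τ q) (𝓝[>] τ q) (𝓝[>] 0) := by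
        refine tendsto_nhdsWithin_iff.2 ⟨?_, ?_⟩
        · have : ContinuousAt (fun s => s - τ q) (τ q) := by fun_prop
          refine Tendsto.mono_left ?_ nhdsWithin_le_nhds
          simpa [ContinuousAt] using this
        · filter_upwards [self_mem_nhdsWithin] with s hs
          exact sub_pos.2 (mem_Ioi.1 hs)
      filter_upwards [h1.eventually hr] with s hs
      rw [LoopParam.shift_shift, add_sub_cancel] at hs
      rw [hH hs, hJq]; abel

/-- The corners of the faces, each with the pair of faces along one of the two half strands that
bound it, are matched by the segments of the curves. -/
theorem sum_corners_eq_zero {M : Type*} [AddCommGroup M] (B : D.Face → D.Face → M) :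
    ∑ c, ∑ i, (B (D.sectorFace c (i + 1)) (D.sectorFace c i) -
      B (D.sectorFace c i) (D.sectorFace c (i + 1))) = 0 := by
  let N := D.faceWinding
  -- The two sides of a segment next to a crossing have winding numbers differing by one. The factor
  -- `N F - N F'` thus orients the pair: it makes `g` symmetric and equal to `B left right - B right
  -- left`. The four summands at a crossing are then the changes of `g` along its two strands.
  let g : D.Face → D.Face → M := fun F F' => (N F - N F') • (B F F' - B F' F)
  have hg : ∀ F F', g F F' = g F' F := fun F F' => by
    simp only [g]
    rw [← neg_sub (N F') (N F), ← neg_sub (B F' F), neg_smul_neg]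
  let σ : Fin D.numCrossings → ℤ := fun c => if D.crossingSign c = 1 then 1 else -1
  have key := sum_jump_sides hg (J := Sum.elim
    (fun c => g (D.sectorFace c 3) (D.sectorFace c 0) - g (D.sectorFace c 1) (D.sectorFace c 2))
    (fun c => σ c • (g (D.sectorFace c 0) (D.sectorFace c 1) -
      g (D.sectorFace c 2) (D.sectorFace c 3)))) ?_
  · rw [Fintype.sum_sum_type] at key
    simp only [Sum.elim_inl, Sum.elim_inr] at key
    rw [← Finset.sum_add_distrib] at key
    rw [← key]
    refine Finset.sum_congr rfl fun c _ => ?_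
    rw [Fin.sum_univ_four, show (0 : Fin 4) + 1 = 1 from rfl, show (1 : Fin 4) + 1 = 2 from rfl,
      show (2 : Fin 4) + 1 = 3 from rfl, show (3 : Fin 4) + 1 = 0 from rfl]
    obtain ⟨h1, h2⟩ := faceWinding_over c
    have e1 : N (D.sectorFace c 3) - N (D.sectorFace c 0) = -1 := by rw [← neg_sub]; exact congrArg _ h1
    have e2 : N (D.sectorFace c 1) - N (D.sectorFace c 2) = 1 := h2
    rcases faceWinding_under c with ⟨hs, h3, h4⟩ | ⟨hs, h3, h4⟩
    · have e3 : N (D.sectorFace c 0) - N (D.sectorFace c 1) = -1 := by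
        rw [← neg_sub]; exact congrArg _ h3
      have e4 : N (D.sectorFace c 2) - N (D.sectorFace c 3) = 1 := h4
      have e5 : σ c = 1 := if_pos hs
      simp only [g, e1, e2, e3, e4, e5]
      simp only [neg_smul, one_smul]
      abel
    · have e3 : N (D.sectorFace c 2) - N (D.sectorFace c 3) = -1 := by
        rw [← neg_sub]; exact congrArg _ h4
      have e4 : N (D.sectorFace c 0) - N (D.sectorFace c 1) = 1 := h3
      have e5 : σ c = -1 := if_neg (by rw [hs]; norm_num)
      simp only [g, e1, e2, e3, e4, e5]
      simp only [neg_smul, one_smul]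
      abel
  · have hb := fun c i => eventually_hasSides_branchParam (D := D) c i
    rintro (c | c)
    · refine ⟨_, _, _, _, rfl, ?_, ?_⟩
      · simpa [branchParam] using hb c 1
      · simpa [branchParam] using hb c 3
    · rcases D.crossingSign_eq c with hs | hs
      · have e5 : σ c = 1 := if_pos hs
        refine ⟨_, _, _, _, by simp only [Sum.elim_inr, e5, one_smul]; rfl, ?_, ?_⟩
        · simpa [branchParam, hs] using hb c 2
        · simpa [branchParam, hs] using hb c 0
      · have e5 : σ c = -1 := if_neg (by rw [hs]; norm_num)
        refine ⟨_, _, _, _, by simp only [Sum.elim_inr, e5, neg_smul, one_smul, neg_sub]; rfl, ?_, ?_⟩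
        · simpa [branchParam, hs] using hb c 0
        · simpa [branchParam, hs] using hb c 2

end LinkDiagram

/-! ### Potentials of conserved flows -/

theorem Complex.tendsto_log_nhdsWithin_neg_one :
    Tendsto Complex.log (𝓝[{z | z.im < 0}] (-1)) (𝓝 (-(Real.pi * Complex.I))) := by
  have := Complex.tendsto_log_nhdsWithin_im_neg_of_re_neg_of_im_zero (z := -1) (by simp) (by simp)
  simpa using this

namespace LinkDiagram

variable {D : LinkDiagram}

/-- For nearby `p` and `q` the principal logarithm of the ratio works, because the segment between
them stays inside the face. Connectedness of the face chains such logarithms together. -/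
theorem exists_log_div {F : D.Face} {p q : ℂ} (hp : p ∈ D.region F) (hq : q ∈ D.region F) :
    ∃ L : ℂ → ℂ, ContinuousOn L (D.region F)ᶜ ∧
      ∀ z ∉ D.region F, Complex.exp (L z) = (z - p) / (z - q) := by
  have hne : ∀ z ∉ D.region F, ∀ w ∈ D.region F, z - w ≠ 0 := fun z hz w hw h =>
    hz (sub_eq_zero.1 h ▸ hw)
  refine (isPreconnected_region F).induction₂ (fun p q => ∃ L : ℂ → ℂ,
    ContinuousOn L (D.region F)ᶜ ∧ ∀ z ∉ D.region F, Complex.exp (L z) = (z - p) / (z - q))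
    ?_ ?_ ?_ hp hq
  · intro p hp
    obtain ⟨r, hr, H⟩ := Metric.isOpen_iff.1 (isOpen_region F) p hp
    filter_upwards [nhdsWithin_le_nhds (Metric.ball_mem_nhds p hr)] with q hq
    refine ⟨fun z => Complex.log ((z - p) / (z - q)), ?_, fun z hz =>
      Complex.exp_log (div_ne_zero (hne z hz p hp) (hne z hz q (H hq)))⟩
    refine ContinuousOn.clog (ContinuousOn.div (by fun_prop) (by fun_prop)
      fun z hz => hne z hz q (H hq)) fun z hz => ?_
    refine div_mem_slitPlane_of_notMem_segment fun h => hz (H ?_)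
    exact (convex_ball p r).segment_subset (Metric.mem_ball_self hr) hq h
  · rintro a b c - hb - ⟨L, hL, eL⟩ ⟨L', hL', eL'⟩
    refine ⟨fun z => L z + L' z, hL.add hL', fun z hz => ?_⟩
    rw [Complex.exp_add, eL z hz, eL' z hz, div_mul_div_cancel₀ (hne z hz b hb)]
  · rintro a b - - ⟨L, hL, eL⟩
    refine ⟨fun z => -L z, hL.neg, fun z hz => ?_⟩
    rw [Complex.exp_neg, eL z hz, inv_div]

variable (D) in
/-- A point of a face. -/
def basePoint (F : D.Face) : ℂ := (exists_mem_region F).choose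

theorem basePoint_mem (F : D.Face) : D.basePoint F ∈ D.region F := (exists_mem_region F).choose_spec

theorem sectorDir_add_two (c : Fin D.numCrossings) (i : Fin 4) :
    D.sectorDir c (i + 2) = -D.sectorDir c i := by
  fin_cases i <;> simp [sectorDir]

theorem planeDet_sectorDir (c : Fin D.numCrossings) (i : Fin 4) :
    0 < planeDet (D.sectorDir c i) (D.sectorDir c (i + 1)) := by
  have h := D.planeDet_pos c
  unfold planeDet at h ⊢
  fin_cases i <;> simp [sectorDir] <;> linarith

theorem tendsto_crossingPoint_add (c : Fin D.numCrossings) (u : ℂ) :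
    Tendsto (fun ε : ℝ => D.crossingPoint c + ε • u) (𝓝[>] 0) (𝓝 (D.crossingPoint c)) := by
  have hc : ContinuousAt (fun ε : ℝ => D.crossingPoint c + ε • u) 0 := by fun_prop
  refine Tendsto.mono_left ?_ nhdsWithin_le_nhds
  simpa [ContinuousAt] using hc

theorem crossingPoint_mem_trace (c : Fin D.numCrossings) : D.crossingPoint c ∈ D.trace :=
  D.curve_mem_trace _

/-- A logarithm of `(z - p) / (z - q)`, for two points `p` and `q` of opposite faces at a crossing,
that is continuous outside these faces and jumps by a full turn at the crossing. -/
theorem exists_log_div_of_crossing (c : Fin D.numCrossings) (i : Fin 4) {K : Set D.Face}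
    (h0 : D.sectorFace c i ∈ K) (h2 : D.sectorFace c (i + 2) ∈ K) (h1 : D.sectorFace c (i + 1) ∉ K)
    (h3 : D.sectorFace c (i + 3) ∉ K) :
    ∃ a : ℂ → ℂ, ContinuousOn a ((⋃ F ∈ K, D.region F)ᶜ \ {D.crossingPoint c}) ∧
      (∀ z ∈ (⋃ F ∈ K, D.region F)ᶜ \ {D.crossingPoint c}, Complex.exp (a z) =
        (z - D.basePoint (D.sectorFace c i)) / (z - D.basePoint (D.sectorFace c (i + 2)))) ∧
      Tendsto (fun ε : ℝ => a (D.crossingPoint c + ε • D.sectorDir c (i + 3)) -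
        a (D.crossingPoint c + ε • D.sectorDir c (i + 1))) (𝓝[>] 0)
        (𝓝 (-(2 * Real.pi * Complex.I))) := by
  set x := D.crossingPoint c with hx
  set Y := (⋃ F ∈ K, D.region F)ᶜ with hY
  set s := D.sectorDir c i with hs
  have hin : ∀ k, ∀ᶠ ε : ℝ in 𝓝[>] 0, x + ε • D.sectorDir c k ∈ D.region (D.sectorFace c k) :=
    fun k => ((D.isFourSided_sector c).direction k).mono fun ε h => D.sector_subset_region c k h
  have hYF : ∀ F ∈ K, Y ⊆ (D.region F)ᶜ := fun F hF z hz h => hz (mem_biUnion hF h)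
  have hxY : x ∈ Y := by
    rw [hY, mem_compl_iff, mem_iUnion₂]
    rintro ⟨F, -, h⟩
    exact h.1 (crossingPoint_mem_trace c)
  have hFY : ∀ F, F ∉ K → D.region F ⊆ Y := by
    intro F hF z hz h
    obtain ⟨F', hF', h'⟩ := mem_iUnion₂.1 h
    exact hF (eq_of_mem_region h' hz ▸ hF')
  have e2 := hin (i + 2)
  rw [sectorDir_add_two, ← hs] at e2
  obtain ⟨δ₁, hδ₁, H₁⟩ := mem_nhdsGT_iff_exists_Ioo_subset.1 ((hin i).and e2)
  rw [mem_Ioi] at hδ₁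
  set δ := δ₁ / 2 with hδ
  have hδ0 : 0 < δ := by positivity
  have Hs : ∀ τ ∈ Ioc 0 δ, x + τ • s ∈ D.region (D.sectorFace c i) ∧
      x + τ • -s ∈ D.region (D.sectorFace c (i + 2)) := fun τ hτ => H₁ ⟨hτ.1, by linarith [hτ.2]⟩
  set p := x + δ • s with hp
  set q := x + δ • -s with hq
  obtain ⟨hpF, hqF⟩ : p ∈ D.region (D.sectorFace c i) ∧ q ∈ D.region (D.sectorFace c (i + 2)) :=
    Hs δ ⟨hδ0, le_rfl⟩
  obtain ⟨L, cL, eL⟩ := exists_log_div (basePoint_mem (D.sectorFace c i)) hpF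
  obtain ⟨L', cL', eL'⟩ := exists_log_div hqF (basePoint_mem (D.sectorFace c (i + 2)))
  have hne : ∀ z ∈ Y, ∀ F ∈ K, ∀ w ∈ D.region F, z - w ≠ 0 := fun z hz F hF w hw h =>
    hYF F hF hz (sub_eq_zero.1 h ▸ hw)
  have hseg : ∀ z ∈ Y \ {x}, z ∉ segment ℝ p q := by
    rintro z ⟨hz, hzx⟩ ⟨a, b, ha, hb, hab, rfl⟩
    have e : a • p + b • q = x + ((a - b) * δ) • s := by
      have : a = 1 - b := by linarith
      rw [hp, hq, this]; module
    rw [e] at hz hzx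
    rcases lt_trichotomy (a - b) 0 with h | h | h
    · refine hYF _ h2 hz ?_
      have := (Hs (-((a - b) * δ)) ⟨by nlinarith, by nlinarith⟩).2
      rwa [smul_neg, neg_smul, neg_neg] at this
    · exact hzx (by simp [h])
    · exact hYF _ h0 hz (Hs ((a - b) * δ) ⟨by positivity, by nlinarith⟩).1
  -- The segment from `p` to `q` goes through the crossing and otherwise lies in the two faces, so
  -- the first term is continuous off the crossing. `L` and `L'` move its end points to the base
  -- points without jumping at the crossing.
  refine ⟨fun z => Complex.log ((z - p) / (z - q)) + L z + L' z, ?_, ?_, ?_⟩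
  · refine ((ContinuousOn.clog (ContinuousOn.div (by fun_prop) (by fun_prop) ?_) ?_).add
      (cL.mono (sdiff_subset.trans (hYF _ h0)))).add (cL'.mono (sdiff_subset.trans (hYF _ h2)))
    · exact fun z hz => hne z hz.1 _ h2 q hqF
    · exact fun z hz => div_mem_slitPlane_of_notMem_segment (hseg z hz)
  · intro z hz
    have n1 := hne z hz.1 _ h0 p hpF
    have n2 := hne z hz.1 _ h2 q hqF
    have n3 := hne z hz.1 _ h2 _ (basePoint_mem _)
    rw [Complex.exp_add, Complex.exp_add, Complex.exp_log (div_ne_zero n1 n2),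
      eL z (hYF _ h0 hz.1), eL' z (hYF _ h2 hz.1)]
    field_simp
  · set l := D.sectorDir c (i + 3) with hl
    have hr : D.sectorDir c (i + 1) = -l := by
      rw [hl, show i + 3 = i + 1 + 2 by rw [add_assoc]; rfl, sectorDir_add_two, neg_neg]
    rw [hr]
    have hlF := hin (i + 3)
    have hrF := hin (i + 1)
    rw [hr] at hrF
    rw [← hl] at hlF
    have hdet : planeDet s l < 0 := by
      have := D.planeDet_sectorDir c (i + 3)
      rw [show i + 3 + 1 = i by rw [add_assoc]; exact add_zero i, ← hl, ← hs, planeDet_swap] at this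
      linarith
    have hcont : ∀ {M : ℂ → ℂ} {F : D.Face}, F ∈ K → ContinuousOn M (D.region F)ᶜ →
        Tendsto (fun ε : ℝ => M (x + ε • l) - M (x + ε • -l)) (𝓝[>] 0) (𝓝 0) := by
      intro M F hF hM
      have hw := (hM x (hYF F hF hxY))
      have t1 : Tendsto (fun ε : ℝ => x + ε • l) (𝓝[>] 0) (𝓝[(D.region F)ᶜ] x) :=
        tendsto_nhdsWithin_iff.2 ⟨tendsto_crossingPoint_add c l,
          hlF.mono fun ε h => hYF F hF (hFY _ h3 h)⟩
      have t2 : Tendsto (fun ε : ℝ => x + ε • -l) (𝓝[>] 0) (𝓝[(D.region F)ᶜ] x) :=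
        tendsto_nhdsWithin_iff.2 ⟨tendsto_crossingPoint_add c (-l),
          hrF.mono fun ε h => hYF F hF (hFY _ h1 h)⟩
      simpa using (hw.tendsto.comp t1).sub (hw.tendsto.comp t2)
    have hs0 : s ≠ 0 := by
      intro h
      rw [h] at hdet
      simp [planeDet] at hdet
    have key : Tendsto (fun ε : ℝ => Complex.log ((x + ε • l - p) / (x + ε • l - q)) -
        Complex.log ((x + ε • -l - p) / (x + ε • -l - q))) (𝓝[>] 0)
        (𝓝 (-(2 * Real.pi * Complex.I))) := by
      have hv : ∀ ε : ℝ, (x + ε • l - p) / (x + ε • l - q) = (ε * l - δ * s) / (ε * l + δ * s) := by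
        intro ε
        rw [hp, hq]
        simp only [Complex.real_smul]
        congr 1 <;> ring
      -- At opposite points the ratios are inverse to each other, so the difference of their
      -- logarithms is twice one logarithm. The ratio tends to `-1` from the lower half plane,
      -- giving twice `-(π * I)`.
      have hv' : ∀ ε : ℝ, (x + ε • -l - p) / (x + ε • -l - q) =
          ((ε * l - δ * s) / (ε * l + δ * s))⁻¹ := by
        intro ε
        rw [hp, hq, inv_div, ← neg_div_neg_eq]
        simp only [Complex.real_smul]
        congr 1 <;> ring
      have him : ∀ ε : ℝ, 0 < ε → ((ε * l - δ * s) / (ε * l + δ * s)).im < 0 := by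
        intro ε hε
        have hN : 0 < Complex.normSq (ε * l + δ * s) := by
          refine Complex.normSq_pos.2 fun h => ?_
          have h5 : planeDet s (ε * l + δ * s) = 0 := by rw [h]; simp [planeDet]
          have h6 : planeDet s (ε * l + δ * s) = ε * planeDet s l := by
            simp [planeDet]; ring
          rw [h6] at h5
          exact absurd h5 (mul_neg_of_pos_of_neg hε hdet).ne
        rw [Complex.div_im, ← sub_div]
        refine div_neg_of_neg_of_pos ?_ hN
        have : 0 < ε * δ := by positivity
        have h7 : (ε * l - δ * s).im * (ε * l + δ * s).re - (ε * l - δ * s).re * (ε * l + δ * s).im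
            = 2 * (ε * δ) * planeDet s l := by
          simp [planeDet]; ring
        rw [h7]
        nlinarith
      have hlim : Tendsto (fun ε : ℝ => ((ε : ℂ) * l - δ * s) / (ε * l + δ * s)) (𝓝[>] 0)
          (𝓝[{z | z.im < 0}] (-1)) := by
        refine tendsto_nhdsWithin_iff.2 ⟨?_, ?_⟩
        · have hδs : (δ : ℂ) * s ≠ 0 := mul_ne_zero (by exact_mod_cast hδ0.ne') hs0
          have hc : ContinuousAt (fun ε : ℝ => ((ε : ℂ) * l - δ * s) / (ε * l + δ * s)) 0 := by
            refine ContinuousAt.div (by fun_prop) (by fun_prop) (by simpa using hδs)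
          refine Tendsto.mono_left ?_ nhdsWithin_le_nhds
          have h8 : ((0 : ℝ) : ℂ) * l - δ * s = -((((0 : ℝ) : ℂ)) * l + δ * s) := by
            push_cast; ring
          rw [ContinuousAt, h8, neg_div, div_self (by simpa using hδs)] at hc
          exact hc
        · filter_upwards [self_mem_nhdsWithin] with ε hε
          exact him ε hε
      have h9 := Complex.tendsto_log_nhdsWithin_neg_one.comp hlim
      have h10 := h9.add h9
      have h11 : -(Real.pi * Complex.I) + -(Real.pi * Complex.I) = -(2 * Real.pi * Complex.I) := by
        ring
      rw [h11] at h10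
      refine h10.congr' ?_
      filter_upwards [self_mem_nhdsWithin] with ε hε
      rw [hv, hv', Complex.log_inv, sub_neg_eq_add]
      · rfl
      · intro h
        have := Complex.arg_neg_iff.2 (him ε hε)
        rw [h] at this
        linarith [Real.pi_pos]
    have := (key.add (hcont h0 cL)).add (hcont h2 cL')
    rw [add_zero, add_zero] at this
    refine this.congr fun ε => ?_
    ring

end LinkDiagram

theorem Filter.Tendsto.eventually_int_eq {ι : Type*} {l : Filter ι} {f : ι → ℤ} {g : ι → ℂ}
    {k : ℂ} {m : ℤ} (hk : k ≠ 0) (h : Tendsto g l (𝓝 (m * k))) (hf : ∀ᶠ x in l, g x = f x * k) :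
    ∀ᶠ x in l, f x = m := by
  have h1 : Tendsto (fun x => ‖(f x : ℂ) - m‖) l (𝓝 0) := by
    have h2 : Tendsto (fun x => ‖g x / k - m‖) l (𝓝 ‖m * k / k - m‖) :=
      ((h.div_const k).sub_const _).norm
    rw [mul_div_cancel_right₀ _ hk, sub_self, norm_zero] at h2
    refine h2.congr' ?_
    filter_upwards [hf] with x hx
    rw [hx, mul_div_cancel_right₀ _ hk]
  filter_upwards [h1.eventually (gt_mem_nhds one_pos)] with x hx
  have h3 : ‖((f x - m : ℤ) : ℂ)‖ < 1 := by push_cast; exact hx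
  rw [Complex.norm_intCast] at h3
  have h4 : |f x - m| < 1 := by exact_mod_cast h3
  rw [Int.abs_lt_one_iff] at h4
  linarith

theorem exists_int_of_exp_eq {a b : ℂ} (h : Complex.exp a = Complex.exp b) :
    ∃ n : ℤ, a - b = n * (2 * Real.pi * Complex.I) := by
  obtain ⟨n, hn⟩ := Complex.exp_eq_exp_iff_exists_int.1 h
  exact ⟨n, by rw [hn]; ring⟩

namespace LinkDiagram

variable {D : LinkDiagram} {A : Type*} [AddCommGroup A]

/-- A flow along the crossings, from a face in `K` to the opposite one, that has no sources and
sinks is given by the differences of a potential on the other faces. -/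
theorem exists_potential {K : Set D.Face} {j : Fin D.numCrossings → Fin 4}
    (h0 : ∀ c, D.sectorFace c (j c) ∈ K) (h2 : ∀ c, D.sectorFace c (j c + 2) ∈ K)
    (h1 : ∀ c, D.sectorFace c (j c + 1) ∉ K) (h3 : ∀ c, D.sectorFace c (j c + 3) ∉ K)
    {φ : Fin D.numCrossings → A}
    (hφ : ∀ m : D.Face → ℤ,
      ∑ c, (m (D.sectorFace c (j c)) - m (D.sectorFace c (j c + 2))) • φ c = 0) :
    ∃ W : D.Face → A, ∀ c,
      W (D.sectorFace c (j c + 3)) - W (D.sectorFace c (j c + 1)) = φ c := by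
  have hπ : (2 * Real.pi * Complex.I : ℂ) ≠ 0 := Complex.two_pi_I_ne_zero
  set Y := (⋃ F ∈ K, D.region F)ᶜ with hY
  have hYF : ∀ F ∈ K, Y ⊆ (D.region F)ᶜ := fun F hF z hz h => hz (mem_biUnion hF h)
  have hFY : ∀ F, F ∉ K → D.region F ⊆ Y := by
    intro F hF z hz h
    obtain ⟨F', hF', h'⟩ := mem_iUnion₂.1 h
    exact hF (eq_of_mem_region h' hz ▸ hF')
  have hxY : ∀ c, D.crossingPoint c ∈ Y := by
    intro c
    rw [hY, mem_compl_iff, mem_iUnion₂]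
    rintro ⟨F, -, h⟩
    exact h.1 (crossingPoint_mem_trace c)
  choose a ca ea ta using fun c => exists_log_div_of_crossing c (j c) (h0 c) (h2 c) (h1 c) (h3 c)
  set b : D.Face → ℂ := D.basePoint with hb
  have hzb : ∀ z ∈ Y, ∀ F ∈ K, z - b F ≠ 0 := fun z hz F hF h =>
    hYF F hF hz (sub_eq_zero.1 h ▸ basePoint_mem F)
  set Y' := Y \ range D.crossingPoint with hY'
  have hY'c : ∀ c, Y' ⊆ Y \ {D.crossingPoint c} := fun c z hz =>
    ⟨hz.1, fun h => hz.2 ⟨c, h.symm⟩⟩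
  have hFY' : ∀ F, F ∉ K → D.region F ⊆ Y' := by
    intro F hF z hz
    refine ⟨hFY F hF hz, ?_⟩
    rintro ⟨c, rfl⟩
    exact hz.1 (crossingPoint_mem_trace c)
  -- `n z c` counts the turns by which `a c` differs from the principal logarithms at `z`.
  have hn : ∀ z c, ∃ n : ℤ, z ∈ Y' → a c z - (Complex.log (z - b (D.sectorFace c (j c))) -
      Complex.log (z - b (D.sectorFace c (j c + 2)))) = n * (2 * Real.pi * Complex.I) := by
    intro z c
    by_cases hz : z ∈ Y'
    · obtain ⟨n, hn⟩ := exists_int_of_exp_eq (a := a c z)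
        (b := Complex.log (z - b (D.sectorFace c (j c))) -
          Complex.log (z - b (D.sectorFace c (j c + 2)))) (by
          rw [ea c z (hY'c c hz), Complex.exp_sub, Complex.exp_log (hzb z hz.1 _ (h0 c)),
            Complex.exp_log (hzb z hz.1 _ (h2 c))])
      exact ⟨n, fun _ => hn⟩
    · exact ⟨0, fun h => absurd h hz⟩
  choose n hn using hn
  -- As `z` moves, the numbers `n z c` change for two reasons. At a branch cut belonging to a face
  -- `F`, all crossings with `F` as an end change together, which cancels by conservation. At a
  -- crossing `c`, the jump of `a c` changes `V` by `φ c`.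
  let V : ℂ → A := fun z => -∑ c, n z c • φ c
  -- the logarithm of the ratio of the distances of `z` and `z₀` to the base point of a face
  let ℓ : ℂ → ℂ → D.Face → ℂ := fun z₀ z F => Complex.log ((z - b F) / (z₀ - b F))
  have eℓ : ∀ z₀ ∈ Y, ∀ z ∈ Y, ∀ F ∈ K, Complex.exp (ℓ z₀ z F) = (z - b F) / (z₀ - b F) :=
    fun z₀ h₀ z hz F hF => Complex.exp_log (div_ne_zero (hzb z hz F hF) (hzb z₀ h₀ F hF))
  have hdiff : ∀ z₀ ∈ Y, ∀ z ∈ Y', ∀ z' ∈ Y', ∀ I : Fin D.numCrossings → ℤ,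
      (∀ c, a c z - a c z' - ((ℓ z₀ z (D.sectorFace c (j c)) - ℓ z₀ z' (D.sectorFace c (j c))) -
        (ℓ z₀ z (D.sectorFace c (j c + 2)) - ℓ z₀ z' (D.sectorFace c (j c + 2)))) =
          I c * (2 * Real.pi * Complex.I)) → V z - V z' = -∑ c, I c • φ c := by
    intro z₀ h₀ z hz z' hz' I hI
    -- `m F` is the discrepancy between the principal logarithm and the branch `ℓ` normalized at
    -- `z₀`. It depends on the face only, so `hφ` removes its contribution.
    have hM : ∀ F, ∃ m : ℤ, F ∈ K → Complex.log (z - b F) - Complex.log (z' - b F) -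
        (ℓ z₀ z F - ℓ z₀ z' F) = m * (2 * Real.pi * Complex.I) := by
      intro F
      by_cases hF : F ∈ K
      · obtain ⟨m, hm⟩ := exists_int_of_exp_eq
          (a := Complex.log (z - b F) - Complex.log (z' - b F)) (b := ℓ z₀ z F - ℓ z₀ z' F) (by
            have n1 := hzb z hz.1 F hF
            have n2 := hzb z' hz'.1 F hF
            have n3 := hzb z₀ h₀ F hF
            rw [Complex.exp_sub, Complex.exp_sub, Complex.exp_log n1, Complex.exp_log n2,
              eℓ z₀ h₀ z hz.1 F hF, eℓ z₀ h₀ z' hz'.1 F hF]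
            field_simp)
        exact ⟨m, fun _ => hm⟩
      · exact ⟨0, fun h => absurd h hF⟩
    choose m hm using hM
    have hc : ∀ c, n z c - n z' c =
        I c - (m (D.sectorFace c (j c)) - m (D.sectorFace c (j c + 2))) := by
      intro c
      have k1 := hn z c hz
      have k2 := hn z' c hz'
      have k3 := hI c
      have k4 := hm _ (h0 c)
      have k5 := hm _ (h2 c)
      have : ((n z c - n z' c : ℤ) : ℂ) * (2 * Real.pi * Complex.I) =
          ((I c - (m (D.sectorFace c (j c)) - m (D.sectorFace c (j c + 2))) : ℤ) : ℂ) *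
            (2 * Real.pi * Complex.I) := by
        push_cast
        linear_combination k3 - k4 + k5 - k1 + k2
      exact_mod_cast mul_right_cancel₀ hπ this
    have e1 : V z - V z' = -∑ c, (n z c - n z' c) • φ c := by
      simp only [V, sub_smul, Finset.sum_sub_distrib]; abel
    have e2 : ∑ c, (n z c - n z' c) • φ c = ∑ c, I c • φ c := by
      rw [← sub_zero (∑ c, I c • φ c), ← hφ m, ← Finset.sum_sub_distrib]
      exact Finset.sum_congr rfl fun c _ => by rw [hc, sub_smul (I c)]
    rw [e1, e2]
  have hconst : ∀ F, F ∉ K → ∀ z ∈ D.region F, ∀ z' ∈ D.region F, V z = V z' := by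
    intro F hF z hz z' hz'
    refine (isPreconnected_region F).induction₂ (fun x y => V x = V y) (fun x hx => ?_)
      (fun _ _ _ _ _ _ => Eq.trans) (fun _ _ _ _ => Eq.symm) hz hz'
    obtain ⟨r, hr, H⟩ := Metric.isOpen_iff.1 (isOpen_region F) x hx
    filter_upwards [nhdsWithin_le_nhds (Metric.ball_mem_nhds x hr)] with y hy
    have hxr : x ∈ Metric.ball x r := Metric.mem_ball_self hr
    have hslit : ∀ z ∈ Metric.ball x r, ∀ G ∈ K, (z - b G) / (x - b G) ∈ Complex.slitPlane := by
      intro z hz G hG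
      rw [← neg_div_neg_eq, neg_sub, neg_sub]
      refine div_mem_slitPlane_of_notMem_segment fun h => ?_
      have := H ((convex_ball x r).segment_subset hz hxr h)
      exact hF (eq_of_mem_region (basePoint_mem G) this ▸ hG)
    have hB : Metric.ball x r ⊆ Y' := H.trans (hFY' F hF)
    have cℓ : ∀ G ∈ K, ContinuousOn (fun z => ℓ x z G) (Metric.ball x r) := fun G hG =>
      ContinuousOn.clog (by fun_prop) fun z hz => hslit z hz G hG
    -- On a ball inside one face, both `a c` and the branches `ℓ` are continuous, so no turns are
    -- left over and `V` is constant.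
    have := hdiff x (hB hxr).1 x (hB hxr) y (hB hy) 0 (fun c => by
      have k := (convex_ball x r).isPreconnected.sub_eq_of_exp_eq (f := a c)
        (g := fun z => ℓ x z (D.sectorFace c (j c)) - ℓ x z (D.sectorFace c (j c + 2)) +
          Complex.log ((x - b (D.sectorFace c (j c))) / (x - b (D.sectorFace c (j c + 2)))))
        ((ca c).mono (hB.trans (hY'c c)))
        (((cℓ _ (h0 c)).sub (cℓ _ (h2 c))).add continuousOn_const) (fun z hz => by
          have n1 := hzb x (hB hxr).1 _ (h0 c)
          have n2 := hzb z (hB hz).1 _ (h2 c)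
          have n3 := hzb x (hB hxr).1 _ (h2 c)
          rw [ea c z (hY'c c (hB hz)), Complex.exp_add, Complex.exp_sub,
            eℓ x (hB hxr).1 z (hB hz).1 _ (h0 c), eℓ x (hB hxr).1 z (hB hz).1 _ (h2 c),
            Complex.exp_log (div_ne_zero n1 n3)]
          change (z - b _) / (z - b _) = _
          field_simp) hxr hy
      simp only [Pi.zero_apply, Int.cast_zero, zero_mul]
      linear_combination k)
    simpa [sub_eq_zero] using this
  refine ⟨fun F => V (b F), fun c₀ => ?_⟩
  set x := D.crossingPoint c₀ with hx
  have hin : ∀ k, ∀ᶠ ε : ℝ in 𝓝[>] 0,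
      x + ε • D.sectorDir c₀ k ∈ D.region (D.sectorFace c₀ k) :=
    fun k => ((D.isFourSided_sector c₀).direction k).mono fun ε h =>
      D.sector_subset_region c₀ k h
  have hI : ∀ z z' c, ∃ m : ℤ, z ∈ Y' → z' ∈ Y' →
      a c z - a c z' - ((ℓ x z (D.sectorFace c (j c)) - ℓ x z' (D.sectorFace c (j c))) -
        (ℓ x z (D.sectorFace c (j c + 2)) - ℓ x z' (D.sectorFace c (j c + 2)))) =
          m * (2 * Real.pi * Complex.I) := by
    intro z z' c
    by_cases h : z ∈ Y' ∧ z' ∈ Y'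
    · obtain ⟨hz, hz'⟩ := h
      obtain ⟨m, hm⟩ := exists_int_of_exp_eq (a := a c z - a c z')
        (b := (ℓ x z (D.sectorFace c (j c)) - ℓ x z' (D.sectorFace c (j c))) -
          (ℓ x z (D.sectorFace c (j c + 2)) - ℓ x z' (D.sectorFace c (j c + 2)))) (by
          have n1 := hzb x (hxY c₀) _ (h0 c)
          have n2 := hzb x (hxY c₀) _ (h2 c)
          have n3 := hzb z hz.1 _ (h0 c)
          have n4 := hzb z hz.1 _ (h2 c)
          have n5 := hzb z' hz'.1 _ (h0 c)
          have n6 := hzb z' hz'.1 _ (h2 c)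
          rw [Complex.exp_sub, Complex.exp_sub, Complex.exp_sub, Complex.exp_sub,
            ea c z (hY'c c hz), ea c z' (hY'c c hz'), eℓ x (hxY c₀) z hz.1 _ (h0 c),
            eℓ x (hxY c₀) z' hz'.1 _ (h0 c), eℓ x (hxY c₀) z hz.1 _ (h2 c),
            eℓ x (hxY c₀) z' hz'.1 _ (h2 c)]
          change (z - b _) / (z - b _) / ((z' - b _) / (z' - b _)) = _
          field_simp)
      exact ⟨m, fun _ _ => hm⟩
    · exact ⟨0, fun hz hz' => absurd ⟨hz, hz'⟩ h⟩
  choose I hI using hI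
  have hl := hin (j c₀ + 3)
  have hr := hin (j c₀ + 1)
  have tl := tendsto_crossingPoint_add c₀ (D.sectorDir c₀ (j c₀ + 3))
  have tr := tendsto_crossingPoint_add c₀ (D.sectorDir c₀ (j c₀ + 1))
  have tℓ : ∀ F ∈ K, Tendsto (fun ε : ℝ => ℓ x (x + ε • D.sectorDir c₀ (j c₀ + 3)) F -
      ℓ x (x + ε • D.sectorDir c₀ (j c₀ + 1)) F) (𝓝[>] 0) (𝓝 0) := by
    intro F hF
    have hc : ContinuousAt (fun z => ℓ x z F) x := by
      refine ContinuousAt.clog (by fun_prop) ?_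
      rw [div_self (hzb x (hxY c₀) F hF)]
      exact Complex.one_mem_slitPlane
    simpa using (hc.tendsto.comp tl).sub (hc.tendsto.comp tr)
  -- At the crossing `c₀`, the logarithm `a c₀` alone jumps, by minus one turn; the other ones are
  -- continuous there.
  have ta' : ∀ c, Tendsto (fun ε : ℝ => a c (x + ε • D.sectorDir c₀ (j c₀ + 3)) -
      a c (x + ε • D.sectorDir c₀ (j c₀ + 1))) (𝓝[>] 0)
      (𝓝 (((if c = c₀ then -1 else 0 : ℤ) : ℂ) * (2 * Real.pi * Complex.I))) := by
    intro c
    by_cases hc : c = c₀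
    · rw [hc, if_pos rfl, Int.cast_neg, Int.cast_one, neg_one_mul]
      exact ta c₀
    · rw [if_neg hc, Int.cast_zero, zero_mul]
      have hcx : x ∈ Y \ {D.crossingPoint c} :=
        ⟨hxY c₀, fun h => hc (crossingPoint_injective h).symm⟩
      have hw := (ca c) x hcx
      have t1 := tendsto_nhdsWithin_iff.2 ⟨tl, hl.mono fun ε h => hY'c c (hFY' _ (h3 c₀) h)⟩
      have t2 := tendsto_nhdsWithin_iff.2 ⟨tr, hr.mono fun ε h => hY'c c (hFY' _ (h1 c₀) h)⟩
      simpa using (hw.tendsto.comp t1).sub (hw.tendsto.comp t2)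
  have hev : ∀ c, ∀ᶠ ε : ℝ in 𝓝[>] 0, I (x + ε • D.sectorDir c₀ (j c₀ + 3))
      (x + ε • D.sectorDir c₀ (j c₀ + 1)) c = if c = c₀ then -1 else 0 := by
    intro c
    have t := (ta' c).sub ((tℓ _ (h0 c)).sub (tℓ _ (h2 c)))
    rw [sub_zero, sub_zero] at t
    refine t.eventually_int_eq hπ ?_
    filter_upwards [hl, hr] with ε k1 k2
    exact hI _ _ c (hFY' _ (h3 c₀) k1) (hFY' _ (h1 c₀) k2)
  obtain ⟨ε, k0, k1, k2⟩ := ((eventually_all.2 hev).and (hl.and hr)).exists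
  have key := hdiff x (hxY c₀) _ (hFY' _ (h3 c₀) k1) _ (hFY' _ (h1 c₀) k2) _
    (fun c => hI _ _ c (hFY' _ (h3 c₀) k1) (hFY' _ (h1 c₀) k2))
  simp only [k0] at key
  simp only
  rw [hconst _ (h3 c₀) _ (basePoint_mem _) _ k1, hconst _ (h1 c₀) _ (basePoint_mem _) _ k2, key]
  simp

end LinkDiagram

/-! ### The Goeritz matrix and the Dehn colorings of a shaded diagram -/

namespace LinkDiagram

variable {D : LinkDiagram} {A : Type*} [AddCommGroup A]

/-- The direction in question is that of the sector `3`, so the Goeritz index only records whether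
the sectors `1` and `3`, rather than `0` and `2`, are the unshaded ones. -/
theorem overOnRight_iff {c : Fin D.numCrossings} {F : D.Face} :
    D.OverOnRight c F ↔ F = D.sectorFace c 3 := by
  have h : D.rightDirection c = D.sectorDir c 3 := rfl
  have hd := (D.isFourSided_sector c).direction 3
  rw [OverOnRight, h]
  constructor
  · intro hF
    obtain ⟨ε, h1, h2⟩ := (hF.and hd).exists
    exact eq_of_mem_region h1 (D.sector_subset_region c 3 h2)
  · rintro rfl
    exact hd.mono fun ε h => D.sector_subset_region c 3 h

namespace Shading

variable (s : D.Shading)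

open Classical in
/-- The position of an unshaded face at a crossing. -/
def corner (c : Fin D.numCrossings) : Fin 4 := if D.sectorFace c 0 ∈ s.shaded then 1 else 0

/-- The first unshaded face at a crossing. -/
def source (c : Fin D.numCrossings) : D.Face := D.sectorFace c (s.corner c)

/-- The second unshaded face at a crossing. -/
def target (c : Fin D.numCrossings) : D.Face := D.sectorFace c (s.corner c + 2)

/-- The shaded face at a crossing on the left of the way from the first unshaded face to the
second one. -/
def left (c : Fin D.numCrossings) : D.Face := D.sectorFace c (s.corner c + 3)

/-- The shaded face at a crossing on the right of the way from the first unshaded face to the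
second one. -/
def right (c : Fin D.numCrossings) : D.Face := D.sectorFace c (s.corner c + 1)

theorem source_notMem (c : Fin D.numCrossings) : s.source c ∉ s.shaded := by
  unfold source corner
  split_ifs with h
  · exact (shaded_sectorFace_iff s c 0).1 h
  · exact h

theorem right_mem (c : Fin D.numCrossings) : s.right c ∈ s.shaded := by
  by_contra h
  exact s.source_notMem c ((shaded_sectorFace_iff s c _).2 h)

theorem target_notMem (c : Fin D.numCrossings) : s.target c ∉ s.shaded := by
  have h := (shaded_sectorFace_iff s c _).1 (s.right_mem c)
  rwa [add_assoc] at h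

theorem left_mem (c : Fin D.numCrossings) : s.left c ∈ s.shaded := by
  by_contra h
  refine s.target_notMem c ((shaded_sectorFace_iff s c _).2 ?_)
  rwa [add_assoc]

theorem incident_iff_of_notMem {c : Fin D.numCrossings} {F : D.Face} (hF : F ∉ s.shaded) :
    D.Incident c F ↔ F = s.source c ∨ F = s.target c := by
  rw [incident_iff]
  constructor
  · rintro ⟨i, rfl⟩
    obtain ⟨k, rfl⟩ : ∃ k, i = s.corner c + k := ⟨i - s.corner c, by abel⟩
    have hl := s.left_mem c
    have hr := s.right_mem c
    fin_cases k
    · exact Or.inl (by simp [source])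
    · exact absurd hr hF
    · exact Or.inr rfl
    · exact absurd hl hF
  · rintro (rfl | rfl)
    · exact ⟨_, rfl⟩
    · exact ⟨_, rfl⟩

theorem incident_iff_of_mem {c : Fin D.numCrossings} {F : D.Face} (hF : F ∈ s.shaded) :
    D.Incident c F ↔ F = s.left c ∨ F = s.right c := by
  rw [incident_iff]
  constructor
  · rintro ⟨i, rfl⟩
    obtain ⟨k, rfl⟩ : ∃ k, i = s.corner c + k := ⟨i - s.corner c, by abel⟩
    have hl := s.source_notMem c
    have hr := s.target_notMem c
    fin_cases k
    · exact absurd (by simpa [source] using hF) hl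
    · exact Or.inr rfl
    · exact absurd hF hr
    · exact Or.inl rfl
  · rintro (rfl | rfl)
    · exact ⟨_, rfl⟩
    · exact ⟨_, rfl⟩

/-- Collecting the shaded faces on one side of the Dehn relation leaves the unshaded ones on the
other side. The resulting sign depends on which pair of opposite sectors is unshaded, and is the
Goeritz index. -/
theorem mem_dehnColorings_iff {d : D.Face → A} : d ∈ D.dehnColorings A ↔
    ∀ c, d (s.left c) - d (s.right c) =
      s.goeritzIndex c • (d (s.source c) - d (s.target c)) := by
  classical
  refine forall_congr' fun c => ?_
  have hη : s.goeritzIndex c = if D.sectorFace c 0 ∈ s.shaded then 1 else -1 := by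
    have h3 := shaded_sectorFace_iff s c 3
    rw [show (3 : Fin 4) + 1 = 0 from rfl] at h3
    unfold goeritzIndex
    refine if_congr ?_ rfl rfl
    constructor
    · rintro ⟨F, hF⟩
      rw [overOnRight_iff] at hF
      by_contra h
      exact F.2 (hF ▸ h3.2 h)
    · intro h
      exact ⟨⟨D.sectorFace c 3, fun h' => h3.1 h' h⟩, overOnRight_iff.2 rfl⟩
  rw [hη]
  unfold left right source target corner
  split_ifs with h
  · rw [show (1 : Fin 4) + 3 = 0 from rfl, show (1 : Fin 4) + 1 = 2 from rfl,
      show (1 : Fin 4) + 2 = 3 from rfl, one_smul, sub_eq_sub_iff_add_eq_add, eq_comm, eq_comm,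
      add_comm (d (D.sectorFace c 3))]
  · rw [show (0 : Fin 4) + 3 = 3 from rfl, show (0 : Fin 4) + 1 = 1 from rfl,
      show (0 : Fin 4) + 2 = 2 from rfl, neg_smul, one_smul, neg_sub, sub_eq_sub_iff_add_eq_add,
      add_comm (d (D.sectorFace c 1))]

open Classical in
/-- The contribution of a crossing to the flow out of the face `F`, for a flow of one unit from the
first unshaded face at the crossing to the second one. -/
def outflow (c : Fin D.numCrossings) (F : D.Face) : ℤ :=
  (if s.source c = F then 1 else 0) - if s.target c = F then 1 else 0

-- The rows of the matrix sum to zero, so it acts on differences `v k - v i`, and each crossing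
-- contributes like a weighted edge of a graph Laplacian. A crossing with the same unshaded face
-- twice contributes nothing on either side.
open Classical in
theorem sum_goeritzMatrix_smul [Fintype s.Unshaded] (v : D.Face → A) (i : s.Unshaded) :
    ∑ k : s.Unshaded, s.goeritzMatrix i k • v k =
      ∑ c, s.outflow c i • (s.goeritzIndex c • (v (s.source c) - v (s.target c))) := by
  have hdiag : s.goeritzMatrix i i = -∑ k, if k ≠ i then s.goeritzEntry i k else 0 := by
    rw [goeritzMatrix, if_pos rfl, finsum_eq_sum_of_fintype]
    simp only [finsum_eq_if]
  have h1 : ∑ k : s.Unshaded, s.goeritzMatrix i k • v k =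
      ∑ k : s.Unshaded, (if k ≠ i then s.goeritzEntry i k else 0) • (v k - v i) := by
    have h2 : ∀ k : s.Unshaded, s.goeritzMatrix i k • v k =
        (if k ≠ i then s.goeritzEntry i k else 0) • v k +
          if k = i then s.goeritzMatrix i i • v i else 0 := by
      intro k
      by_cases hk : k = i
      · simp [hk]
      · rw [if_pos hk, if_neg hk, add_zero, goeritzMatrix, if_neg (Ne.symm hk)]
    simp only [h2, Finset.sum_add_distrib, Finset.sum_ite_eq', Finset.mem_univ, if_true, smul_sub,
      Finset.sum_sub_distrib, hdiag, ← Finset.sum_smul, neg_smul]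
    abel
  have h3 : ∀ k : s.Unshaded, (if k ≠ i then s.goeritzEntry i k else 0) • (v k - v i) =
      ∑ c, if k ≠ i ∧ (D.Incident c i ∧ D.Incident c k) then s.goeritzIndex c • (v i - v k)
        else 0 := by
    intro k
    by_cases hk : k = i
    · simp [hk]
    · simp only [hk, ne_eq, not_false_eq_true, if_true, true_and]
      rw [goeritzEntry, neg_smul, ← smul_neg, neg_sub, Finset.sum_smul, Finset.sum_filter]
  rw [h1, Finset.sum_congr rfl fun k _ => h3 k, Finset.sum_comm]
  refine Finset.sum_congr rfl fun c _ => ?_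
  have hinc : ∀ k : s.Unshaded, D.Incident c k ↔ (k : D.Face) = s.source c ∨ k = s.target c :=
    fun k => s.incident_iff_of_notMem k.2
  simp only [hinc]
  set a : s.Unshaded := ⟨s.source c, s.source_notMem c⟩ with ha
  set b : s.Unshaded := ⟨s.target c, s.target_notMem c⟩ with hb
  have ea : ∀ k : s.Unshaded, (k : D.Face) = s.source c ↔ k = a :=
    fun k => ⟨fun h => Subtype.ext h, fun h => congrArg Subtype.val h⟩
  have eb : ∀ k : s.Unshaded, (k : D.Face) = s.target c ↔ k = b :=
    fun k => ⟨fun h => Subtype.ext h, fun h => congrArg Subtype.val h⟩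
  have va : s.source c = (a : D.Face) := rfl
  have vb : s.target c = (b : D.Face) := rfl
  simp only [outflow, eq_comm (b := (i : D.Face)), ea, eb]
  rw [va, vb]
  by_cases h1 : i = a
  · by_cases h2 : i = b
    · have hab : a = b := h1.symm.trans h2
      rw [Finset.sum_eq_zero]
      · simp [h1, hab]
      · intro k _
        rw [if_neg]
        rintro ⟨hk, -, hk' | hk'⟩
        · exact hk (hk'.trans h1.symm)
        · exact hk (hk'.trans h2.symm)
    · rw [Finset.sum_eq_single b]
      · rw [if_pos ⟨fun h => h2 h.symm, Or.inl h1, Or.inr rfl⟩, if_pos h1, if_neg h2, sub_zero,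
          one_smul, h1]
      · intro k _ hk
        rw [if_neg]
        rintro ⟨hk1, -, hk' | hk'⟩
        · exact hk1 (hk'.trans h1.symm)
        · exact hk hk'
      · simp
  · by_cases h2 : i = b
    · rw [Finset.sum_eq_single a]
      · rw [if_pos ⟨fun h => h1 h.symm, Or.inr h2, Or.inl rfl⟩, if_neg h1, if_pos h2, zero_sub,
          neg_smul, one_smul, ← smul_neg, neg_sub, h2]
      · intro k _ hk
        rw [if_neg]
        rintro ⟨hk1, -, hk' | hk'⟩
        · exact hk hk'
        · exact hk1 (hk'.trans h2.symm)
      · simp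
    · rw [Finset.sum_eq_zero]
      · simp [h1, h2]
      · intro k _
        rw [if_neg]
        rintro ⟨-, h | h, -⟩
        · exact h1 h
        · exact h2 h

/-- This reads the kernel as Kirchhoff's law for the flow `η • (d source - d target)`. -/
theorem mem_goeritzKernel_iff [Finite D.Face] {v : s.Unshaded →₀ A} {d : D.Face → A}
    (hd : ∀ k : s.Unshaded, d k = v k) : v ∈ s.goeritzKernel A ↔
      ∀ F ∉ s.shaded, ∑ c, s.outflow c F • (s.goeritzIndex c • (d (s.source c) - d (s.target c))) = 0 := by
  have := Fintype.ofFinite s.Unshaded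
  have h : v ∈ s.goeritzKernel A ↔
      ∀ i : s.Unshaded, v.sum (fun j a => s.goeritzMatrix i j • a) = 0 := Iff.rfl
  rw [h, Subtype.forall]
  refine forall₂_congr fun F hF => ?_
  rw [Finsupp.sum_fintype _ _ fun _ => smul_zero _, ← s.sum_goeritzMatrix_smul d ⟨F, hF⟩]
  simp only [hd]

/-- The flow given by the differences of a function of the shaded faces has no sources and sinks. -/
theorem sum_outflow_smul (w : D.Face → A) {F : D.Face} (hF : F ∉ s.shaded) :
    ∑ c, s.outflow c F • (w (s.left c) - w (s.right c)) = 0 := by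
  classical
  -- With this `B`, each corner of `F` contributes the difference of `w` on the two shaded sectors
  -- adjacent to it.
  rw [← sum_corners_eq_zero (D := D) fun G G' => if G = F then w G' else 0]
  refine Finset.sum_congr rfl fun c _ => ?_
  have hl : s.left c ≠ F := fun h => hF (h ▸ s.left_mem c)
  have hr : s.right c ≠ F := fun h => hF (h ▸ s.right_mem c)
  rw [← Equiv.sum_comp (Equiv.addLeft (s.corner c)), Fin.sum_univ_four]
  simp only [Equiv.coe_addLeft, add_assoc, add_zero]
  rw [show (1 : Fin 4) + 1 = 2 from rfl, show (2 : Fin 4) + 1 = 3 from rfl,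
    show (3 : Fin 4) + 1 = 0 from rfl, add_zero]
  change s.outflow c F • (w (s.left c) - w (s.right c)) =
    ((if s.right c = F then w (s.source c) else 0) - if s.source c = F then w (s.right c) else 0) +
    (((if s.target c = F then w (s.right c) else 0) - if s.right c = F then w (s.target c) else 0) +
    (((if s.left c = F then w (s.target c) else 0) - if s.target c = F then w (s.left c) else 0) +
    ((if s.source c = F then w (s.left c) else 0) - if s.left c = F then w (s.source c) else 0)))
  rw [if_neg hr, if_neg hl, if_neg hl, if_neg hr, outflow, sub_smul]
  split_ifs <;> simp <;> abel

/-- An integer function on the faces is a combination of indicator functions, for which the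
hypothesis of `exists_potential` is conservation at a single face; shaded faces have no outflow at
all. -/
theorem exists_potential_of_outflow [Finite D.Face] {φ : Fin D.numCrossings → A}
    (hφ : ∀ F ∉ s.shaded, ∑ c, s.outflow c F • φ c = 0) :
    ∃ W : D.Face → A, ∀ c, W (s.left c) - W (s.right c) = φ c := by
  classical
  have := Fintype.ofFinite D.Face
  refine exists_potential (K := s.shadedᶜ) (j := s.corner) s.source_notMem s.target_notMem
    (fun c => not_not.2 (s.right_mem c)) (fun c => not_not.2 (s.left_mem c)) fun m => ?_
  have h1 : ∀ c, m (s.source c) - m (s.target c) = ∑ F, m F * s.outflow c F := by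
    intro c
    simp [outflow, mul_sub, Finset.sum_sub_distrib]
  change ∑ c, (m (s.source c) - m (s.target c)) • φ c = 0
  simp only [h1, Finset.sum_smul, mul_smul]
  rw [Finset.sum_comm]
  refine Finset.sum_eq_zero fun F _ => ?_
  rw [← Finset.smul_sum]
  by_cases hF : F ∈ s.shaded
  · have : ∀ c, s.outflow c F = 0 := by
      intro c
      rw [outflow, if_neg, if_neg, sub_zero]
      · rintro rfl; exact s.target_notMem c hF
      · rintro rfl; exact s.source_notMem c hF
    simp [this]
  · rw [hφ F hF, smul_zero]

/-! ### Connected components of the shaded graph -/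

theorem mk_left_eq_mk_right (c : Fin D.numCrossings) :
    s.shadedGraph.connectedComponentMk ⟨s.left c, s.left_mem c⟩ =
      s.shadedGraph.connectedComponentMk ⟨s.right c, s.right_mem c⟩ := by
  by_cases h : s.left c = s.right c
  · simp only [h]
  · refine SimpleGraph.ConnectedComponent.sound (SimpleGraph.Adj.reachable ⟨?_, c, ?_, ?_⟩)
    · exact fun h' => h (congrArg Subtype.val h')
    · exact (s.incident_iff_of_mem (s.left_mem c)).2 (Or.inl rfl)
    · exact (s.incident_iff_of_mem (s.right_mem c)).2 (Or.inr rfl)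

theorem eq_of_connectedComponentMk_eq {B : Type*} {d : D.Face → B}
    (hd : ∀ c, d (s.left c) = d (s.right c)) {S S' : s.shaded}
    (h : s.shadedGraph.connectedComponentMk S = s.shadedGraph.connectedComponentMk S') :
    d S = d S' := by
  obtain ⟨p⟩ := SimpleGraph.ConnectedComponent.exact h
  clear h
  induction p with
  | nil => rfl
  | @cons S S' S'' hadj _ ih =>
    rw [← ih]
    obtain ⟨-, c, h1, h2⟩ := hadj
    rw [s.incident_iff_of_mem S.2] at h1
    rw [s.incident_iff_of_mem S'.2] at h2
    have := hd c
    rcases h1 with h1 | h1 <;> rcases h2 with h2 | h2 <;> rw [h1, h2] <;> simp [this]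

/-- A shaded face in a component of the shaded graph. -/
def base (κ : s.shadedGraph.ConnectedComponent) : s.shaded := κ.exists_rep.choose

theorem mk_base (κ : s.shadedGraph.ConnectedComponent) :
    s.shadedGraph.connectedComponentMk (s.base κ) = κ := κ.exists_rep.choose_spec

variable (A) in
/-- A Dehn coloring is determined by its values on the unshaded faces and on one shaded face in
each component of the shaded graph. -/
def dehnColoringsAtHom [Finite D.Face] (κ₀ : s.shadedGraph.ConnectedComponent) :
    D.dehnColoringsAt A (s.base κ₀) →+ s.goeritzKernel A × ({κ // κ ≠ κ₀} → A) where
  toFun d :=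
    (⟨Finsupp.equivFunOnFinite.symm fun k : s.Unshaded => d.1 k,
      (s.mem_goeritzKernel_iff (d := d.1) fun _ => rfl).2 fun F hF => by
        rw [← s.sum_outflow_smul d.1 hF]
        exact Finset.sum_congr rfl fun c _ => by rw [s.mem_dehnColorings_iff.1 d.2.1 c]⟩,
    fun κ => d.1 (s.base κ))
  map_zero' := by
    ext <;> rfl
  map_add' d d' := by
    ext <;> rfl

/-- If the unshaded values vanish, the Dehn relation makes the coloring constant on each component
of the shaded graph. Conversely, the flow of a kernel element has a potential on the shaded faces,
which can be shifted by a constant on each component to reach any prescribed base values. -/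
theorem bijective_dehnColoringsAtHom [Finite D.Face] (κ₀ : s.shadedGraph.ConnectedComponent) :
    Function.Bijective (s.dehnColoringsAtHom A κ₀) := by
  classical
  constructor
  · rw [injective_iff_map_eq_zero]
    rintro ⟨d, hd, hd0⟩ h
    have hU : ∀ F ∉ s.shaded, d F = 0 := fun F hF =>
      DFunLike.congr_fun (congrArg Subtype.val (congrArg Prod.fst h)) (⟨F, hF⟩ : s.Unshaded)
    have hκ : ∀ κ, d (s.base κ) = 0 := by
      intro κ
      by_cases hk : κ = κ₀
      · rw [hk]; exact hd0
      · exact congrFun (congrArg Prod.snd h) ⟨κ, hk⟩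
    have hlr : ∀ c, d (s.left c) = d (s.right c) := fun c => by
      have := s.mem_dehnColorings_iff.1 hd c
      rw [hU _ (s.source_notMem c), hU _ (s.target_notMem c), sub_zero, smul_zero] at this
      exact sub_eq_zero.1 this
    refine Subtype.ext (funext fun F => ?_)
    by_cases hF : F ∈ s.shaded
    · exact (s.eq_of_connectedComponentMk_eq (S := ⟨F, hF⟩) hlr (s.mk_base _).symm).trans (hκ _)
    · exact hU F hF
  · rintro ⟨⟨v, hv⟩, u⟩
    -- The value `0` at `κ₀` is the normalization imposed on the Dehn coloring.
    let u' : s.shadedGraph.ConnectedComponent → A := fun κ => if h : κ ≠ κ₀ then u ⟨κ, h⟩ else 0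
    let v' : D.Face → A := fun F => if h : F ∉ s.shaded then v ⟨F, h⟩ else 0
    have hv' : ∀ k : s.Unshaded, v' k = v k := fun k => dif_pos k.2
    obtain ⟨W, hW⟩ := s.exists_potential_of_outflow ((s.mem_goeritzKernel_iff hv').1 hv)
    let κ : s.shaded → s.shadedGraph.ConnectedComponent := s.shadedGraph.connectedComponentMk
    -- The correction of `W` is constant on components. The shaded faces at a crossing lie in one
    -- component, so their difference is unaffected.
    let d : D.Face → A := fun F =>
      if h : F ∈ s.shaded then W F - W (s.base (κ ⟨F, h⟩)) + u' (κ ⟨F, h⟩) else v' F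
    have hdS : ∀ {F} (h : F ∈ s.shaded),
        d F = W F - W (s.base (κ ⟨F, h⟩)) + u' (κ ⟨F, h⟩) := fun h => dif_pos h
    have hdU : ∀ {F}, F ∉ s.shaded → d F = v' F := fun h => dif_neg h
    have hdb : ∀ k, d (s.base k) = u' k := fun k => by
      have : κ ⟨s.base k, (s.base k).2⟩ = k := s.mk_base k
      rw [hdS (s.base k).2, this, sub_self, zero_add]
    refine ⟨⟨d, s.mem_dehnColorings_iff.2 fun c => ?_, ?_⟩, ?_⟩
    · have hk : κ ⟨_, s.left_mem c⟩ = κ ⟨_, s.right_mem c⟩ := s.mk_left_eq_mk_right c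
      rw [hdS (s.left_mem c), hdS (s.right_mem c), hdU (s.source_notMem c),
        hdU (s.target_notMem c), hk, ← hW c]
      abel
    · change d (s.base κ₀) = 0
      rw [hdb]
      exact dif_neg (by simp)
    · refine Prod.ext (Subtype.ext (Finsupp.ext fun k => ?_)) (funext fun k => ?_)
      · exact (hdU k.2).trans (hv' k)
      · exact (hdb k).trans (dif_pos k.2)

end Shading

end LinkDiagram

end

theorem theorem15 (D : LinkDiagram) (hD : 0 < D.numComponents) (s : D.Shading)
    (A : Type*) [AddCommGroup A] :
    1 ≤ s.beta ∧
      Nonempty (D.foxColorings A ≃+ s.goeritzKernel A × (Fin (s.beta - 1) → A)) := by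
  have := LinkDiagram.finite_face hD
  have hfin : Finite s.shadedGraph.ConnectedComponent := Quot.finite _
  obtain ⟨F, hF⟩ := LinkDiagram.exists_shaded hD s
  let κ₀ := s.shadedGraph.connectedComponentMk ⟨F, hF⟩
  have hne : Nonempty s.shadedGraph.ConnectedComponent := ⟨κ₀⟩
  have hcard : Nat.card {κ // κ ≠ κ₀} = s.beta - 1 := by
    classical
    have := Fintype.ofFinite s.shadedGraph.ConnectedComponent
    rw [LinkDiagram.Shading.beta, Nat.card_eq_fintype_card, Nat.card_eq_fintype_card]
    exact Set.card_ne_eq κ₀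
  refine ⟨Nat.card_pos, ?_⟩
  -- Normalizing at a shaded face of the component `κ₀` uses up the free constant of that component.
  obtain ⟨e₁⟩ := LinkDiagram.nonempty_foxColorings_equiv (D := D) (A := A) (s.base κ₀ : D.Face)
  let e₂ := AddEquiv.ofBijective _ (s.bijective_dehnColoringsAtHom (A := A) κ₀)
  let e : {κ // κ ≠ κ₀} ≃ Fin (s.beta - 1) := (Finite.equivFin _).trans (finCongr hcard)
  let e₃ : ({κ // κ ≠ κ₀} → A) ≃+ (Fin (s.beta - 1) → A) :=
    AddEquiv.mk' (e.arrowCongr (Equiv.refl A)) fun _ _ => rfl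
  exact ⟨e₁.trans (e₂.trans ((AddEquiv.refl _).prodCongr e₃))⟩
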